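/- **Theorem.** All automata are over a one-letter alphabet. An NFA with set of states $Q$, $|Q| = n$, is in *Chrobak normal form* if it consists of a (possibly empty) stem $q_0 \to q_1 \to \dots \to q_{s-1}$ and of finitely many disjoint directed cycles, where the last state of the stem has exactly one transition into each cycle (to a distinguished state of it), $q_0$ is the only initial state, and there are no other transitions; if the stem is empty, the initial states are the distinguished states of the cycles, one in each cycle. The accepting states are arbitrary. A UFA (unambiguous finite automaton) is an NFA with at most one accepting run on each word. An automaton is given as an input by a list of natural numbers: the number of states, the number of transitions, for each state whether it is initial and whether it is accepting, and the list of its transitions (source and target). It is promised that the input automata are of the kind named. (a) There is an algorithm in LOGSPACE which decides, given a UFA in Chrobak normal form, whether it accepts all words. Without the LOGSPACE constraint, there is an algorithm which decides this in time $O(n \log^2 n)$, where $n$ is the number of states. (b) There is an algorithm in LOGSPACE which decides, given an NFA $U_1$ in Chrobak normal form and a UFA $U_2$ in Chrobak normal form, whether the language accepted by $U_1$ is a subset of the language accepted by $U_2$. Here LOGSPACE refers to deterministic Turing machines with a read-only input tape (on which the numbers are written in binary) that visit $O(\log m)$ cells of their work tapes on inputs of length $m$. Time refers to random access machines with logarithmic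 cost, on which a multiplication or division of numbers with $k$ and $l$ binary digits costs $k \cdot l$ (up to the constant cost of naming the registers). -/

import Mathlib

open Filter Asymptotics

namespace UnaryUFA

/-! ### Unary automata, unambiguity, normal form -/

/-- A nondeterministic finite automaton over the unary alphabet (the one-letter type `Unit`) whose
states are numbered `0, …, n - 1`. -/
abbrev UnaryNFA : Type := Σ n : ℕ, NFA Unit (Fin n)

/-- `r` is an accepting run of `M` on the word `w`: a sequence of `|w| + 1` states that begins in an
initial state, follows the transitions while reading `w`, and ends in an accepting state. -/
def IsAcceptingRun {α σ : Type} (M : NFA α σ) (w : List α) (r : Fin (w.length + 1) → σ) : Prop :=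
  r 0 ∈ M.start ∧
    (∀ i : Fin w.length, r i.succ ∈ M.step (r i.castSucc) (w.get i)) ∧
    r (Fin.last w.length) ∈ M.accept

/-- An automaton is unambiguous if no word has two different accepting runs. -/
def Unambiguous {α σ : Type} (M : NFA α σ) : Prop :=
  ∀ (w : List α) (r r' : Fin (w.length + 1) → σ),
    IsAcceptingRun M w r → IsAcceptingRun M w r' → r = r'

/-- The states of an automaton that consists of a stem of `s` states and of `c` cycles, the `i`-th
one of length `p i`. -/
abbrev StemCycles (s c : ℕ) (p : Fin c → ℕ) : Type := Fin s ⊕ (Σ i : Fin c, Fin (p i))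

/-- The initial states: the first state of the stem; if there is no stem, the `0`-th state of every
cycle. -/
def StemCycles.IsStart {s c : ℕ} {p : Fin c → ℕ} : StemCycles s c p → Prop
  | Sum.inl t => t.val = 0
  | Sum.inr ⟨_, j⟩ => s = 0 ∧ j.val = 0

/-- The transitions: along the stem, from the last state of the stem to the `0`-th state of every
cycle, and around each cycle. -/
def StemCycles.Edge {s c : ℕ} {p : Fin c → ℕ} : StemCycles s c p → StemCycles s c p → Prop
  | Sum.inl t, Sum.inl t' => t'.val = t.val + 1
  | Sum.inl t, Sum.inr ⟨_, j⟩ => t.val + 1 = s ∧ j.val = 0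
  | Sum.inr _, Sum.inl _ => False
  | Sum.inr ⟨i, j⟩, Sum.inr ⟨i', j'⟩ => i' = i ∧ j'.val = (j.val + 1) % p i

/-- A unary automaton is in Chrobak normal form if, up to the names of its states, it consists of a
(possibly empty) stem and of disjoint cycles. There is no restriction on the accepting states. -/
def IsChrobak {σ : Type} (M : NFA Unit σ) : Prop :=
  ∃ (s c : ℕ) (p : Fin c → ℕ), (∀ i, 0 < p i) ∧
    ∃ e : StemCycles s c p ≃ σ,
      (∀ v, e v ∈ M.start ↔ v.IsStart) ∧
      (∀ v w, e w ∈ M.step (e v) () ↔ v.Edge w)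

/-! ### Automata as inputs of machines -/

open Classical in
/-- The list of the transitions, in lexicographic order. -/
noncomputable def edgeList (A : UnaryNFA) : List (Fin A.1 × Fin A.1) :=
  (List.finRange A.1 ×ˢ List.finRange A.1).filter (fun e => e.2 ∈ A.2.step e.1 ())

open Classical in
/-- The description of an automaton by a list of natural numbers: the number of states, the number
of transitions, for each state two bits that tell whether it is initial and whether it is accepting,
and finally the source and the target of each transition. -/
noncomputable def code (A : UnaryNFA) : List ℕ :=
  A.1 :: (edgeList A).length ::
    ((List.finRange A.1).flatMap
        (fun q => [if q ∈ A.2.start then 1 else 0, if q ∈ A.2.accept then 1 else 0]) ++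
      (edgeList A).flatMap (fun e => [e.1.val, e.2.val]))

/-- The alphabet of the input words of Turing machines. -/
inductive Letter : Type
  | bit (b : Bool)
  | comma
  | semicolon

/-- A list of numbers as a word: each number in binary (lowest bit first), followed by a comma. -/
def wordOf (l : List ℕ) : List Letter :=
  l.flatMap (fun k => k.bits.map Letter.bit ++ [Letter.comma])

/-- An automaton as an input word. -/
noncomputable def word (A : UnaryNFA) : List Letter := wordOf (code A)

/-- A pair of automata as an input word. -/
noncomputable def pairWord (A : UnaryNFA × UnaryNFA) : List Letter :=
  word A.1 ++ Letter.semicolon :: word A.2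

/-! ### Turing machines with a read-only input tape, and logarithmic space -/

/-- Head movements. -/
inductive Move : Type
  | left
  | stay
  | right

/-- The new position of a head on a tape whose cells are numbered `0, 1, 2, …`; the head stays put
when it is told to leave the tape on the left. -/
def Move.apply : Move → ℕ → ℕ
  | Move.left, i => i - 1
  | Move.stay, i => i
  | Move.right, i => i + 1

/-- What is written in a cell of the input tape: an end marker or a letter. -/
inductive InputCell (α : Type) : Type
  | leftEnd
  | letter (a : α)
  | rightEnd

/-- The input tape: cell `0` is the left end marker, the word is written in the cells `1, …, |x|`,
and cell `|x| + 1` is the right end marker. -/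
def inputCell {α : Type} (x : List α) : ℕ → InputCell α
  | 0 => InputCell.leftEnd
  | i + 1 => match x[i]? with
    | some a => InputCell.letter a
    | none => InputCell.rightEnd

/-- A deterministic Turing machine with a two-way read-only input tape and finitely many two-way
read-write work tapes. -/
structure OfflineTM (α : Type) where
  /-- number of work tapes -/
  tapes : ℕ
  /-- states of the finite control -/
  State : Type
  /-- work alphabet -/
  Symbol : Type
  finite_state : Finite State
  finite_symbol : Finite Symbol
  blank : Symbol
  initial : State
  /-- `some true`: accepting halting state, `some false`: rejecting halting state, `none`: the
  machine goes on -/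
  verdict : State → Option Bool
  /-- from the state and the scanned cells: the new state, the movement of the input head, and for
  each work tape the symbol to write and the movement of its head -/
  trans : State → InputCell α → (Fin tapes → Symbol) →
    State × Move × (Fin tapes → Symbol × Move)

namespace OfflineTM

variable {α : Type}

/-- Configurations. -/
structure Config (M : OfflineTM α) where
  state : M.State
  inputHead : ℕ
  work : Fin M.tapes → ℕ → M.Symbol
  head : Fin M.tapes → ℕ

/-- The initial configuration: the work tapes are blank and all heads are on cell `0`. -/
def start (M : OfflineTM α) : M.Config where
  state := M.initial
  inputHead := 0
  work := fun _ _ => M.blank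
  head := fun _ => 0

/-- One step on the input `x`. The input head cannot pass the right end marker. A halted machine
does not move. -/
def step (M : OfflineTM α) (x : List α) (c : M.Config) : M.Config :=
  match M.verdict c.state with
  | some _ => c
  | none =>
    let a := M.trans c.state (inputCell x c.inputHead) (fun i => c.work i (c.head i))
    { state := a.1
      inputHead := min (a.2.1.apply c.inputHead) (x.length + 1)
      work := fun i => Function.update (c.work i) (c.head i) (a.2.2 i).1
      head := fun i => (a.2.2 i).2.apply (c.head i) }

/-- The configuration after `t` steps on the input `x`. -/
def run (M : OfflineTM α) (x : List α) (t : ℕ) : M.Config := (M.step x)^[t] M.start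

/-- On the input `x` the machine halts with the answer `b`. -/
def Answers (M : OfflineTM α) (x : List α) (b : Bool) : Prop :=
  ∃ t, M.verdict (M.run x t).state = some b

/-- On the input `x` the machine visits at most the first `m` cells of each work tape. -/
def UsesSpace (M : OfflineTM α) (x : List α) (m : ℕ) : Prop :=
  ∀ t i, (M.run x t).head i < m

end OfflineTM

/-- `Problem a` is decidable in LOGSPACE for the instances `a` that satisfy `Promise a` and are
given as the words `enc a`: some Turing machine gives the correct answer for each such instance and
visits `O(log m)` cells of its work tapes, where `m` is the length of the input word. -/
def DecidableInLogspace {α I : Type} (enc : I → List α) (Promise Problem : I → Prop) : Prop :=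
  ∃ (M : OfflineTM α) (S : ℕ → ℕ),
    (fun m => (S m : ℝ)) =O[atTop] (fun m : ℕ => Real.log m) ∧
    ∀ a, Promise a →
      (∃ b : Bool, M.Answers (enc a) b ∧ (b = true ↔ Problem a)) ∧
      M.UsesSpace (enc a) (S (enc a).length)

/-! ### Random access machines with logarithmic cost -/

/-- Instructions of a random access machine with registers `R 0, R 1, …` for natural numbers and
with a read-only input array `x`. -/
inductive Instr : Type
  /-- `R r := k` -/
  | const (r k : ℕ)
  /-- `R r := R s` -/
  | copy (r s : ℕ)
  /-- `R r := R (R s)` -/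
  | load (r s : ℕ)
  /-- `R (R r) := R s` -/
  | store (r s : ℕ)
  /-- `R r := x (R s)`, which is `0` outside of the array -/
  | read (r s : ℕ)
  /-- `R r := R s + R t` -/
  | add (r s t : ℕ)
  /-- `R r := max (R s - R t) 0` -/
  | sub (r s t : ℕ)
  /-- `R r := R s * R t` -/
  | mul (r s t : ℕ)
  /-- `R r := ⌊R s / R t⌋`, which is `0` if `R t = 0` -/
  | div (r s t : ℕ)
  /-- if `R r = 0`, go to the instruction with number `k` -/
  | jumpZero (r k : ℕ)
  /-- halt with the answer `b` -/
  | halt (b : Bool)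

/-- The number of binary digits of `k` (`1` for `k = 0`). -/
def len (k : ℕ) : ℕ := Nat.log 2 k + 1

/-- Configurations of a random access machine: program counter, registers, and the time spent. -/
structure RAMConfig where
  pc : ℕ
  reg : ℕ → ℕ
  time : ℕ

/-- The logarithmic cost of an instruction: the number of digits of the register names, addresses
and contents that it involves; a multiplication or a division costs, instead of the sum of the
lengths of its operands, their product (the bit cost of the school method). -/
def Instr.cost (x : List ℕ) (R : ℕ → ℕ) : Instr → ℕ
  | const r k => len r + len k
  | copy r s => len r + len s + len (R s)
  | load r s => len r + len s + len (R s) + len (R (R s))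
  | store r s => len r + len (R r) + len s + len (R s)
  | read r s => len r + len s + len (R s) + len (x.getD (R s) 0)
  | add r s t => len r + len s + len t + len (R s) + len (R t)
  | sub r s t => len r + len s + len t + len (R s) + len (R t)
  | mul r s t => len r + len s + len t + len (R s) * len (R t)
  | div r s t => len r + len s + len t + len (R s) * len (R t)
  | jumpZero r k => len r + len (R r) + len k
  | halt _ => 1

/-- The registers after an instruction. -/
def Instr.effect (x : List ℕ) (R : ℕ → ℕ) : Instr → (ℕ → ℕ)
  | const r k => Function.update R r k
  | copy r s => Function.update R r (R s)
  | load r s => Function.update R r (R (R s))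
  | store r s => Function.update R (R r) (R s)
  | read r s => Function.update R r (x.getD (R s) 0)
  | add r s t => Function.update R r (R s + R t)
  | sub r s t => Function.update R r (R s - R t)
  | mul r s t => Function.update R r (R s * R t)
  | div r s t => Function.update R r (R s / R t)
  | jumpZero _ _ => R
  | halt _ => R

/-- The program counter after an instruction. -/
def Instr.next (R : ℕ → ℕ) (pc : ℕ) : Instr → ℕ
  | jumpZero r k => if R r = 0 then k else pc + 1
  | halt _ => pc
  | _ => pc + 1

/-- One step of the program `P` on the input array `x`; nothing happens when there is no instruction
with the number `pc`. -/
def ramStep (P : List Instr) (x : List ℕ) (c : RAMConfig) : RAMConfig :=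
  match P[c.pc]? with
  | none => c
  | some a =>
    { pc := a.next c.reg c.pc
      reg := a.effect x c.reg
      time := c.time + a.cost x c.reg }

/-- The configuration after `t` steps; at the beginning all registers are `0`. -/
def ramRun (P : List Instr) (x : List ℕ) (t : ℕ) : RAMConfig :=
  (ramStep P x)^[t] { pc := 0, reg := fun _ => 0, time := 0 }

/-- On the input array `x` the program `P` halts with the answer `b` in time at most `T`. -/
def RAMAnswers (P : List Instr) (x : List ℕ) (b : Bool) (T : ℕ) : Prop :=
  ∃ t, P[(ramRun P x t).pc]? = some (Instr.halt b) ∧ (ramRun P x t).time ≤ T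

/-- `Problem a` is decidable in time `O(f n)` for the instances `a` of size `n = size a` that satisfy
`Promise a` and are given as the arrays `enc a`: some program of a random access machine gives the
correct answer for each such instance within this time, at logarithmic cost. -/
def DecidableInTime {I : Type} (enc : I → List ℕ) (size : I → ℕ) (Promise Problem : I → Prop)
    (f : ℕ → ℝ) : Prop :=
  ∃ (P : List Instr) (T : ℕ → ℕ),
    (fun n => (T n : ℝ)) =O[atTop] f ∧
    ∀ a, Promise a → ∃ b : Bool, RAMAnswers P (enc a) b (T (size a)) ∧ (b = true ↔ Problem a)

end UnaryUFA

/-! Once the stem has been left, the cycle of length p_i accepts at a set of times with period p_i.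
Unambiguity makes these sets disjoint, since two cycles accepting at the same time would give two
accepting runs (`Chrobak.eq_of_unambiguous`). So every time is covered exactly if the sum of the
indicator functions minus the constant 1 vanishes. A sum of periodic functions that vanishes at as
many consecutive arguments as the sum of the periods vanishes everywhere (`sum_periodic_eq_zero`):
the difference with shift p_c removes one function, and induction applies to the rest. The constant
has period 1, so ∑ p_i + 1 consecutive times suffice (`exists_of_window`).

The same holds along any progression d + P k, because passing from k to k + p_i still shifts the
argument by a multiple of p_i (`Chrobak.progression`). For universality, the word lengths up to the
number n of states therefore suffice. For inclusion, each accepting cycle state of the first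
automaton accepts such a progression with P at most its number n' of states, and it is enough to
inspect lengths up to n' (n + 1) (`Chrobak.subset_iff`). Both bounds lie below the square of the
number of input letters plus one.

In logarithmic space, all lengths t below this square are tested one after the other. The only
choice in a run is which cycle to enter, so acceptance of a length is decided by deterministic
walks, one for each state e: wherever there is a choice, the walk takes e if possible
(`okUpTo_iff_mem_accepts`). Only a fixed number of polynomially bounded counters is used. They are
kept in binary on parallel tracks of one work tape (`flowTM_correct`).

For the time bound, the pairs of a time t ≤ n after the entry into the cycles and a cycle accepting
at that time are counted. By disjointness there are at most n + 1 of them, with equality exactly if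
every such t is covered (`Chrobak.sum_cycleHits_eq_iff`). A state at position j of a cycle of length
P contributes (n - j) / P + 1 if it accepts, so one round along each cycle suffices. The stem is
checked by counting: the rejecting states, less those on cycles, must be none. The distinguished
states are recognised by two entries, where being initial counts as one (`Chrobak.one_lt_W_iff`).
Altogether O(n) instructions act on numbers with O(log n) digits, at cost O(log² n) each. -/

namespace UnaryUFA

section

/-! ### Structured programs and their flow charts -/

/-- Structured programs with basic actions `A` and tests `B`. -/
inductive Cmd (A B : Type) : Type
  | skip
  | act (a : A)
  | seq (c d : Cmd A B)
  | ite (b : B) (c d : Cmd A B)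
  | loop (b : B) (c : Cmd A B)

/-- Instructions of flow charts: `branch b k` goes to `k` if the test `b` fails. -/
inductive Node (A B : Type) : Type
  | act (a : A)
  | branch (b : B) (k : ℕ)
  | goto (k : ℕ)

/-- An interpretation of the actions and tests on states `S`, and the states that are allowed. -/
structure Sem (A B S : Type) where
  act : A → S → S
  test : B → S → Bool
  inv : S → Prop

variable {A B S : Type}

/-- The number of instructions of the flow chart. -/
def Cmd.size : Cmd A B → ℕ
  | skip => 0
  | act _ => 1
  | seq c d => c.size + d.size
  | ite _ c d => c.size + d.size + 2
  | loop _ c => c.size + 2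

/-- The flow chart of a program, when its first instruction has the number `s`. -/
def Cmd.comp : Cmd A B → ℕ → List (Node A B)
  | skip, _ => []
  | act a, _ => [Node.act a]
  | seq c d, s => c.comp s ++ d.comp (s + c.size)
  | ite b c d, s => Node.branch b (s + c.size + 2) ::
      (c.comp (s + 1) ++ Node.goto (s + c.size + 2 + d.size) :: d.comp (s + c.size + 2))
  | loop b c, s => Node.branch b (s + c.size + 2) :: (c.comp (s + 1) ++ [Node.goto s])

theorem Cmd.length_comp (c : Cmd A B) : ∀ s, (c.comp s).length = c.size := by
  induction c with
  | skip => intro s; rfl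
  | act a => intro s; rfl
  | seq c d hc hd => intro s; simp [comp, size, hc, hd]
  | ite b c d hc hd => intro s; simp [comp, size, hc, hd]; omega
  | loop b c hc => intro s; simp [comp, size, hc]

/-- Big-step semantics: `c` leads from `σ` to `σ'` in `n` instructions of its flow chart, and all
states on the way are allowed. -/
inductive Exec (M : Sem A B S) : Cmd A B → S → S → ℕ → Prop
  | skip {σ} : M.inv σ → Exec M Cmd.skip σ σ 0
  | act {σ} (a : A) : M.inv σ → M.inv (M.act a σ) → Exec M (Cmd.act a) σ (M.act a σ) 1
  | seq {σ τ ρ c d m n} : Exec M c σ τ m → Exec M d τ ρ n → Exec M (Cmd.seq c d) σ ρ (m + n)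
  | ite_true {σ τ b c d n} : M.inv σ → M.test b σ = true → Exec M c σ τ n →
      Exec M (Cmd.ite b c d) σ τ (n + 2)
  | ite_false {σ τ b c d n} : M.inv σ → M.test b σ = false → Exec M d σ τ n →
      Exec M (Cmd.ite b c d) σ τ (n + 1)
  | loop_false {σ b c} : M.inv σ → M.test b σ = false → Exec M (Cmd.loop b c) σ σ 1
  | loop_true {σ τ ρ b c m n} : M.inv σ → M.test b σ = true → Exec M c σ τ m →
      Exec M (Cmd.loop b c) τ ρ n → Exec M (Cmd.loop b c) σ ρ (m + 2 + n)

theorem Exec.inv_left {M : Sem A B S} {c : Cmd A B} {σ τ : S} {n : ℕ} (h : Exec M c σ τ n) :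
    M.inv σ := by
  induction h <;> assumption

theorem Exec.inv_right {M : Sem A B S} {c : Cmd A B} {σ τ : S} {n : ℕ} (h : Exec M c σ τ n) :
    M.inv τ := by
  induction h <;> assumption

/-- The effect of an instruction of a flow chart. -/
def Node.step (M : Sem A B S) (x : ℕ × S) : Node A B → ℕ × S
  | act a => (x.1 + 1, M.act a x.2)
  | branch b k => (if M.test b x.2 then x.1 + 1 else k, x.2)
  | goto k => (k, x.2)

/-- The flow chart `code` leads from `x` to `y` in `n` steps through allowed states. -/
inductive Reach (M : Sem A B S) (code : List (Node A B)) : ℕ × S → ℕ × S → ℕ → Prop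
  | refl (x) : M.inv x.2 → Reach M code x x 0
  | head {x y n} (a : Node A B) : code[x.1]? = some a → M.inv x.2 →
      Reach M code (a.step M x) y n → Reach M code x y (n + 1)

theorem Reach.trans {M : Sem A B S} {code : List (Node A B)} {x y z : ℕ × S} {m n : ℕ}
    (h : Reach M code x y m) (h' : Reach M code y z n) : Reach M code x z (m + n) := by
  induction h with
  | refl x _ => simpa using h'
  | @head x y m a h1 h2 _ ih =>
    rw [Nat.add_right_comm]
    exact Reach.head a h1 h2 (ih h')

theorem Reach.single {M : Sem A B S} {code : List (Node A B)} {x y : ℕ × S} (a : Node A B)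
    (h : code[x.1]? = some a) (hx : M.inv x.2) (hxy : a.step M x = y) (hy : M.inv y.2) :
    Reach M code x y 1 :=
  Reach.head a h hx (hxy ▸ Reach.refl _ (hxy ▸ hy))

/-- The flow chart of a program does what the program does. -/
theorem Exec.reach {M : Sem A B S} {c : Cmd A B} {σ τ : S} {n : ℕ} (h : Exec M c σ τ n) :
    ∀ (code : List (Node A B)) (s : ℕ) (pre post : List (Node A B)),
      code = pre ++ (c.comp s ++ post) → pre.length = s →
      Reach M code (s, σ) (s + c.size, τ) n := by
  -- The chart of a subprogram lies inside a larger one. The induction therefore allows arbitrary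
  -- code around it, and since jump targets are absolute, the number `s` of its first instruction
  -- must be the length of what precedes.
  induction h with
  | skip h => intro code s pre post _ _; exact Reach.refl _ h
  | act a h h' =>
    intro code s pre post hc hs
    refine Reach.single (Node.act a) ?_ h rfl h'
    simp [hc, ← hs, Cmd.comp]
  | @seq _ _ _ c d _ _ _ _ ih ih' =>
    intro code s pre post hc hs
    have h1 := ih code s pre (d.comp (s + c.size) ++ post) (by simp [hc, Cmd.comp]) hs
    have h2 := ih' code (s + c.size) (pre ++ c.comp s) post (by simp [hc, Cmd.comp])
      (by simp [hs, Cmd.length_comp])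
    simpa [Cmd.size, Nat.add_assoc] using h1.trans h2
  | @ite_true σ τ b c d n h hb h3 ih =>
    intro code s pre post hc hs
    have h1 := ih code (s + 1) (pre ++ [Node.branch b (s + c.size + 2)])
      (Node.goto (s + c.size + 2 + d.size) :: d.comp (s + c.size + 2) ++ post)
      (by simp [hc, Cmd.comp]) (by simp [hs])
    refine Reach.head (Node.branch b (s + c.size + 2)) (by simp [hc, ← hs, Cmd.comp]) h ?_
    simp only [Node.step, hb, if_true]
    refine h1.trans (Reach.single (Node.goto (s + c.size + 2 + d.size)) ?_ h3.inv_right ?_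
      h3.inv_right)
    · have e : s + 1 + c.size = (pre ++ (Node.branch b (s + c.size + 2) :: c.comp (s + 1))).length := by
        simp [Cmd.length_comp, hs]; omega
      have e2 : code = (pre ++ (Node.branch b (s + c.size + 2) :: c.comp (s + 1))) ++
          (Node.goto (s + c.size + 2 + d.size) :: (d.comp (s + c.size + 2) ++ post)) := by
        simp [hc, Cmd.comp]
      simp only [e]
      rw [e2, List.getElem?_append_right le_rfl]
      simp
    · simp only [Node.step, Cmd.size]; congr 1; omega
  | @ite_false σ τ b c d n h hb h3 ih =>
    intro code s pre post hc hs
    have h1 := ih code (s + c.size + 2) (pre ++ (Node.branch b (s + c.size + 2) ::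
      (c.comp (s + 1) ++ [Node.goto (s + c.size + 2 + d.size)])))
      post (by simp [hc, Cmd.comp]) (by simp [hs, Cmd.length_comp]; omega)
    refine Reach.head (Node.branch b (s + c.size + 2)) (by simp [hc, ← hs, Cmd.comp]) h ?_
    simp only [Node.step, hb, Cmd.size, Bool.false_eq_true, if_false]
    convert h1 using 2
    omega
  | @loop_false σ b c h hb =>
    intro code s pre post hc hs
    refine Reach.single (Node.branch b (s + c.size + 2)) (by simp [hc, ← hs, Cmd.comp]) h ?_ h
    simp [Node.step, hb, Cmd.size, Nat.add_assoc]
  | @loop_true σ τ ρ b c m n h hb h3 h4 ih ih' =>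
    intro code s pre post hc hs
    have h1 := ih code (s + 1) (pre ++ [Node.branch b (s + c.size + 2)])
      (Node.goto s :: post) (by simp [hc, Cmd.comp]) (by simp [hs])
    have h2 := ih' code s pre post hc hs
    -- A passage of the loop costs its body, the branch before it and the jump back after it.
    have e : m + 2 + n = (m + (1 + n)) + 1 := by omega
    rw [e]
    refine Reach.head (Node.branch b (s + c.size + 2)) (by simp [hc, ← hs, Cmd.comp]) h ?_
    simp only [Node.step, hb, if_true]
    refine h1.trans ((Reach.single (Node.goto s) ?_ h3.inv_right rfl h3.inv_right).trans h2)
    have e : s + 1 + c.size = (pre ++ (Node.branch b (s + c.size + 2) :: c.comp (s + 1))).length := by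
      simp [Cmd.length_comp, hs]; omega
    have e2 : code = (pre ++ (Node.branch b (s + c.size + 2) :: c.comp (s + 1))) ++
        (Node.goto s :: post) := by
      simp [hc, Cmd.comp]
    simp only [e]
    rw [e2, List.getElem?_append_right le_rfl]
    simp

/-- `c` leads from `σ` to `τ` in at most `n` instructions of its flow chart. -/
def Within (M : Sem A B S) (c : Cmd A B) (σ τ : S) (n : ℕ) : Prop := ∃ k ≤ n, Exec M c σ τ k

namespace Within

variable {M : Sem A B S} {c d : Cmd A B} {σ τ ρ : S} {b : B} {m n : ℕ}

theorem mono (h : Within M c σ τ m) (hmn : m ≤ n) : Within M c σ τ n :=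
  let ⟨k, hk, e⟩ := h; ⟨k, hk.trans hmn, e⟩

theorem skip (h : M.inv σ) : Within M Cmd.skip σ σ 0 := ⟨0, le_rfl, Exec.skip h⟩

theorem act (a : A) (h : M.inv σ) (hτ : M.act a σ = τ) (h' : M.inv τ) :
    Within M (Cmd.act a) σ τ 1 := ⟨1, le_rfl, hτ ▸ Exec.act a h (hτ ▸ h')⟩

theorem seq (h : Within M c σ τ m) (h' : Within M d τ ρ n) :
    Within M (Cmd.seq c d) σ ρ (m + n) :=
  let ⟨_, hk, e⟩ := h; let ⟨_, hk', e'⟩ := h'; ⟨_, Nat.add_le_add hk hk', Exec.seq e e'⟩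

theorem ite_true (hb : M.test b σ = true) (h : Within M c σ τ n) :
    Within M (Cmd.ite b c d) σ τ (n + 2) :=
  let ⟨_, hk, e⟩ := h; ⟨_, Nat.add_le_add_right hk 2, Exec.ite_true e.inv_left hb e⟩

theorem ite_false (hb : M.test b σ = false) (h : Within M d σ τ n) :
    Within M (Cmd.ite b c d) σ τ (n + 1) :=
  let ⟨_, hk, e⟩ := h; ⟨_, Nat.add_le_add_right hk 1, Exec.ite_false e.inv_left hb e⟩

theorem loop_false (hσ : M.inv σ) (hb : M.test b σ = false) : Within M (Cmd.loop b c) σ σ 1 :=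
  ⟨1, le_rfl, Exec.loop_false hσ hb⟩

theorem loop_true (hb : M.test b σ = true) (h : Within M c σ τ m)
    (h' : Within M (Cmd.loop b c) τ ρ n) : Within M (Cmd.loop b c) σ ρ (m + 2 + n) :=
  let ⟨_, hk, e⟩ := h; let ⟨_, hk', e'⟩ := h'
  ⟨_, Nat.add_le_add (Nat.add_le_add_right hk 2) hk', Exec.loop_true e.inv_left hb e e'⟩

/-- A loop that is passed `T` times and goes through the states `F 0, …, F T`. -/
theorem for_loop (F : ℕ → S) (K : ℕ → ℕ) : ∀ T : ℕ, M.inv (F T) →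
    (∀ t < T, M.test b (F t) = true) → M.test b (F T) = false →
    (∀ t < T, Within M c (F t) (F (t + 1)) (K t)) →
    Within M (Cmd.loop b c) (F 0) (F T) (∑ t ∈ Finset.range T, (K t + 2) + 1) := by
  intro T hT h1 h2 h3
  -- `loop_true` adds a passage in front, so the execution is built from its end: `j` is the number
  -- of passages still to come.
  have key : ∀ j ≤ T, Within M (Cmd.loop b c) (F (T - j)) (F T)
      (∑ t ∈ Finset.Ico (T - j) T, (K t + 2) + 1) := by
    intro j
    induction j with
    | zero => intro _; simpa using loop_false hT h2
    | succ j ih =>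
      intro hj
      have h4 := loop_true (h1 (T - (j + 1)) (by omega)) (h3 (T - (j + 1)) (by omega))
        (by rw [show T - (j + 1) + 1 = T - j by omega]; exact ih (by omega))
      refine h4.mono (le_of_eq ?_)
      rw [Finset.sum_eq_sum_Ico_succ_bot (a := T - (j + 1)) (by omega),
        show T - (j + 1) + 1 = T - j by omega]
      omega
  have := key T le_rfl
  rwa [Nat.sub_self, ← Finset.range_eq_Ico] at this

end Within

end

end UnaryUFA

/-! ### Logarithmic space: binary registers on one work tape -/

namespace UnaryUFA

section

/-! ### Machines with finitely many registers for binary words, as Turing machines -/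

/-- Actions: count up in binary, append a bit, clear, and move the input head. -/
inductive Act (ι : Type) : Type
  | inc (i : ι)
  | push (i : ι) (b : Bool)
  | clear (i : ι)
  | left
  | right

/-- Tests: two registers are different; the scanned input cell has a property. -/
inductive Test (α ι : Type) : Type
  | ne (i j : ι)
  | letter (p : InputCell α → Bool)

/-- The position of the input head and the contents of the registers. -/
structure Store (ι : Type) where
  pos : ℕ
  reg : ι → List Bool

/-- Binary successor, lowest bit first. -/
def incBits : List Bool → List Bool
  | [] => [true]
  | false :: l => true :: l
  | true :: l => false :: incBits l

theorem bits_succ (n : ℕ) : (n + 1).bits = incBits n.bits := by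
  induction n using Nat.binaryRec' with
  | zero => simp [incBits]
  | bit b n h ih =>
    rw [Nat.bits_append_bit _ _ h]
    cases b with
    | false =>
      rw [show Nat.bit false n + 1 = Nat.bit true n by simp [Nat.bit_val],
        Nat.bits_append_bit _ _ (by simp)]
      rfl
    | true =>
      rw [show Nat.bit true n + 1 = Nat.bit false (n + 1) by simp [Nat.bit_val]; ring,
        Nat.bits_append_bit _ _ (by simp), ih]
      rfl

/-- The carry turns ones into zeros up to the first cell `p` without a one, which absorbs it; this
may be the blank cell behind the word. The form is the one a sweep of a tape head needs: each cell
before `p` is treated locally, and nothing behind `p` changes. -/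
theorem exists_carry (l : List Bool) : ∃ p ≤ l.length,
    (∀ j < p, l[j]? = some true ∧ (incBits l)[j]? = some false) ∧ l[p]? ≠ some true ∧
      (incBits l)[p]? = some true ∧ ∀ j, p < j → (incBits l)[j]? = l[j]? := by
  induction l with
  | nil =>
    refine ⟨0, le_rfl, by simp, by simp, rfl, ?_⟩
    intro j hj
    obtain ⟨j, rfl⟩ := Nat.exists_eq_succ_of_ne_zero hj.ne'
    rfl
  | cons b l ih =>
    cases b with
    | false =>
      refine ⟨0, Nat.zero_le _, by simp, by simp, rfl, ?_⟩
      intro j hj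
      obtain ⟨j, rfl⟩ := Nat.exists_eq_succ_of_ne_zero hj.ne'
      rfl
    | true =>
      obtain ⟨p, h0, h1, h2, h3, h4⟩ := ih
      refine ⟨p + 1, by simpa using h0, ?_, by simpa using h2, by simpa [incBits] using h3, ?_⟩
      · rintro (_ | j) hj
        · exact ⟨rfl, rfl⟩
        · simpa [incBits] using h1 j (by omega)
      · rintro (_ | j) hj
        · omega
        · simpa [incBits] using h4 j (by omega)

/-- A comparison is settled at the first cell where the words differ, or where both have ended.
Reading past the end as `none` covers words of different lengths. -/
theorem exists_first_diff (l l' : List Bool) : ∃ p ≤ l.length,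
    (∀ j < p, l[j]? = l'[j]? ∧ l[j]? ≠ none) ∧
      ((l ≠ l' ∧ l[p]? ≠ l'[p]?) ∨ (l = l' ∧ l[p]? = l'[p]? ∧ l[p]? = none)) := by
  induction l generalizing l' with
  | nil =>
    refine ⟨0, le_rfl, by simp, ?_⟩
    cases l' <;> simp
  | cons b l ih =>
    cases l' with
    | nil => exact ⟨0, Nat.zero_le _, by simp, Or.inl (by simp)⟩
    | cons b' l' =>
      by_cases hb : b = b'
      · obtain ⟨p, h0, h1, h2⟩ := ih l'
        refine ⟨p + 1, by simpa using h0, ?_, by simpa [hb] using h2⟩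
        rintro (_ | j) hj
        · simp [hb]
        · simpa using h1 j (by omega)
      · exact ⟨0, Nat.zero_le _, by simp, Or.inl (by simp [hb])⟩

variable {α ι : Type} [DecidableEq ι]

/-- The effect of an action, when the input word has length `m`. -/
def Act.app (m : ℕ) (σ : Store ι) : Act ι → Store ι
  | inc i => { σ with reg := Function.update σ.reg i (incBits (σ.reg i)) }
  | push i b => { σ with reg := Function.update σ.reg i (σ.reg i ++ [b]) }
  | clear i => { σ with reg := Function.update σ.reg i [] }
  | left => { σ with pos := σ.pos - 1 }
  | right => { σ with pos := min (σ.pos + 1) (m + 1) }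

/-- The outcome of a test on the input word `x`. -/
def Test.eval (x : List α) (σ : Store ι) : Test α ι → Bool
  | ne i j => σ.reg i != σ.reg j
  | letter p => p (inputCell x σ.pos)

/-- The semantics of register machines on the input `x`, with registers of length at most `L`. -/
def storeSem (ι : Type) [DecidableEq ι] (x : List α) (L : ℕ) :
    Sem (Act ι) (Test α ι) (Store ι) where
  act a σ := a.app x.length σ
  test b σ := b.eval x σ
  inv σ := σ.pos ≤ x.length + 1 ∧ ∀ i, (σ.reg i).length ≤ L

/-- The bits in the cell `j` of all tracks. -/
def track (R : ι → List Bool) (j : ℕ) : ι → Option Bool := fun i => (R i)[j]?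

theorem track_update (R : ι → List Bool) (i : ι) (l : List Bool) (j : ℕ) :
    track (Function.update R i l) j = Function.update (track R j) i l[j]? := by
  funext k
  by_cases h : k = i
  · subst h; simp [track]
  · simp [track, h]

/-- What an instruction does with the scanned cell when the head moves to the right: what is
written, and the outcome if the head shall turn back. -/
def Node.scan : Node (Act ι) (Test α ι) →
    Option ((ι → Option Bool) → (ι → Option Bool) × Option Bool)
  | act (Act.inc i) => some fun a =>
      if a i = some true then (Function.update a i (some false), none)
      else (Function.update a i (some true), some true)
  | act (Act.push i b) => some fun a =>
      if a i = none then (Function.update a i (some b), some true) else (a, none)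
  | act (Act.clear i) => some fun a =>
      if a i = none then (a, some true) else (Function.update a i none, none)
  | branch (Test.ne i j) _ => some fun a =>
      if a i ≠ a j then (a, some true) else if a i = none then (a, some false) else (a, none)
  | _ => none

/-- The movement of the input head by an instruction. -/
def Node.move : Node (Act ι) (Test α ι) → Move
  | act Act.left => Move.left
  | act Act.right => Move.right
  | _ => Move.stay

/-- The outcome of an instruction that depends on the scanned input cell only. -/
def Node.look (a : InputCell α) : Node (Act ι) (Test α ι) → Bool
  | branch (Test.letter p) _ => p a
  | _ => true

/-- The number of the next instruction. -/
def Node.next (pc : ℕ) : Node (Act ι) (Test α ι) → Bool → ℕ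
  | act _, _ => pc + 1
  | branch _ k, b => if b then pc + 1 else k
  | goto k, _ => k

/-- One sweep suffices for every instruction on registers: the carry, the end of a register or the
first difference lies in a cell `p ≤ L`. Up to `p` the local rule rewrites the cells, and at `p` it
delivers the outcome. -/
theorem Node.scan_spec (x : List α) (L pc : ℕ) (σ : Store ι)
    (a : Node (Act ι) (Test α ι)) (f : (ι → Option Bool) → (ι → Option Bool) × Option Bool)
    (hf : a.scan = some f) (hσ : (storeSem ι x L).inv σ) :
    (a.step (storeSem ι x L) (pc, σ)).2.pos = σ.pos ∧ ∃ p ≤ L, ∃ b : Bool,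
      (∀ j < p, f (track σ.reg j) =
        (track (a.step (storeSem ι x L) (pc, σ)).2.reg j, none)) ∧
      f (track σ.reg p) = (track (a.step (storeSem ι x L) (pc, σ)).2.reg p, some b) ∧
      (∀ j, p < j → track (a.step (storeSem ι x L) (pc, σ)).2.reg j = track σ.reg j) ∧
      a.next pc b = (a.step (storeSem ι x L) (pc, σ)).1 := by
  rcases a with (i | ⟨i, b⟩ | i | _ | _) | ⟨⟨i, j⟩ | q, k⟩ | k <;>
    simp only [Node.scan, Option.some.injEq, reduceCtorEq] at hf
  · subst hf
    refine ⟨rfl, ?_⟩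
    obtain ⟨p, h0, h1, h2, h3, h4⟩ := exists_carry (σ.reg i)
    refine ⟨p, h0.trans (hσ.2 i), true, ?_, ?_, ?_, rfl⟩
    · intro j hj
      simp only [Node.step, storeSem, Act.app, track_update]
      rw [if_pos (show track σ.reg j i = some true from (h1 j hj).1), (h1 j hj).2]
    · simp only [Node.step, storeSem, Act.app, track_update]
      rw [if_neg (show ¬ track σ.reg p i = some true from h2), h3]
    · intro j hj
      simp only [Node.step, storeSem, Act.app, track_update]
      rw [h4 j hj]
      exact Function.update_eq_self i (track σ.reg j)
  · subst hf
    refine ⟨rfl, ?_⟩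
    refine ⟨(σ.reg i).length, hσ.2 i, true, ?_, ?_, ?_, rfl⟩
    · intro j hj
      simp only [Node.step, storeSem, Act.app, track_update]
      rw [if_neg (by simp [track, hj]), List.getElem?_append_left hj]
      simp only [Prod.mk.injEq, and_true]
      exact (Function.update_eq_self i (track σ.reg j)).symm
    · simp only [Node.step, storeSem, Act.app, track_update]
      rw [if_pos (by simp [track])]
      simp
    · intro j hj
      simp only [Node.step, storeSem, Act.app, track_update]
      rw [List.getElem?_eq_none (by simp; omega)]
      conv_rhs => rw [← Function.update_eq_self i (track σ.reg j)]
      congr 1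
      exact (List.getElem?_eq_none hj.le).symm
  · subst hf
    refine ⟨rfl, ?_⟩
    refine ⟨(σ.reg i).length, hσ.2 i, true, ?_, ?_, ?_, rfl⟩
    · intro j hj
      simp only [Node.step, storeSem, Act.app, track_update]
      rw [if_neg (by simp [track, hj])]
      simp
    · simp only [Node.step, storeSem, Act.app, track_update]
      rw [if_pos (by simp [track])]
      simp only [Prod.mk.injEq, and_true]
      conv_lhs => rw [← Function.update_eq_self i (track σ.reg _)]
      simp [track]
    · intro j hj
      simp only [Node.step, storeSem, Act.app, track_update]
      conv_rhs => rw [← Function.update_eq_self i (track σ.reg j)]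
      congr 1
      exact (List.getElem?_eq_none hj.le).symm
  · subst hf
    refine ⟨rfl, ?_⟩
    obtain ⟨p, h0, h1, h2⟩ := exists_first_diff (σ.reg i) (σ.reg j)
    refine ⟨p, h0.trans (hσ.2 i), σ.reg i != σ.reg j, ?_, ?_, fun _ _ => rfl, ?_⟩
    · intro l hl
      have e1 : track σ.reg l i = track σ.reg l j := (h1 l hl).1
      have e2 : track σ.reg l i ≠ none := (h1 l hl).2
      simp only [ne_eq, e1, not_true_eq_false, if_false]
      rw [← e1, if_neg e2]
      rfl
    · rcases h2 with ⟨h2, h3⟩ | ⟨h2, h3, h4⟩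
      · have e1 : track σ.reg p i ≠ track σ.reg p j := h3
        have e2 : (σ.reg i != σ.reg j) = true := by simpa using h2
        simp only [if_pos e1, e2]
        rfl
      · have e1 : track σ.reg p i = track σ.reg p j := h3
        have e2 : track σ.reg p i = none := h4
        simp only [ne_eq, e1, not_true_eq_false, if_false]
        rw [← e1, if_pos e2]
        simp [h2, Node.step]
    · rfl

/-- The remaining instructions leave the registers alone and depend on the scanned input cell at
most, so a single step of the Turing machine performs them. -/
theorem Node.look_spec (x : List α) (L pc : ℕ) (σ : Store ι) (a : Node (Act ι) (Test α ι))
    (hf : a.scan = none) (hσ : (storeSem ι x L).inv σ) :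
    (a.step (storeSem ι x L) (pc, σ)).2 =
        { σ with pos := min (a.move.apply σ.pos) (x.length + 1) } ∧
      (a.step (storeSem ι x L) (pc, σ)).1 = a.next pc (a.look (inputCell x σ.pos)) := by
  have h := hσ.1
  rcases a with (i | ⟨i, b⟩ | i | _ | _) | ⟨⟨i, j⟩ | q, k⟩ | k <;>
    simp only [Node.scan, reduceCtorEq] at hf
  · refine ⟨?_, rfl⟩
    simp only [Node.step, storeSem, Act.app, Node.move, Move.apply]
    rw [min_eq_left (by omega)]
  · exact ⟨rfl, rfl⟩
  · refine ⟨?_, rfl⟩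
    simp only [Node.step, Node.move, Move.apply]
    rw [min_eq_left h]
  · refine ⟨?_, rfl⟩
    simp only [Node.step, Node.move, Move.apply]
    rw [min_eq_left h]

end

end UnaryUFA

namespace UnaryUFA

section
variable {α ι : Type} [DecidableEq ι]

/-! ### The Turing machine of a program -/

/-- What the simulating machine is doing: beginning an instruction, moving the work head to the
right, or moving it back to the left when the outcome is known. -/
inductive Phase : Type
  | home
  | fwd
  | back (b : Bool)

instance : Finite Phase := by
  refine Finite.of_injective
    (fun p : Phase => (match p with
      | Phase.home => none
      | Phase.fwd => some none
      | Phase.back b => some (some b) : Option (Option Bool))) ?_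
  rintro (_ | _ | b) (_ | _ | b') h <;> simp_all

/-- The flow chart of a program that is followed by a test. -/
def flow (c : Cmd (Act ι) (Test α ι)) (b : Test α ι) : List (Node (Act ι) (Test α ι)) :=
  c.comp 0 ++ [Node.branch b (c.size + 2)]

/-- A number of an instruction, cut off at `n`. -/
def clamp (n k : ℕ) : Fin (n + 1) := ⟨min k n, by omega⟩

/-- The transitions of the simulating machine, which has one work tape: there is a marker (`none`)
in cell `0`, and the registers are written in parallel tracks. -/
def flowTrans (P : List (Node (Act ι) (Test α ι))) (n : ℕ) :
    Option (Fin (n + 1) × Phase) → InputCell α → Option (ι → Option Bool) →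
      Option (Fin (n + 1) × Phase) × Move × Option (ι → Option Bool) × Move
  | none, _, _ => (some (clamp n 0, Phase.home), Move.stay, none, Move.stay)
  | some (k, Phase.home), a, s =>
    match P[k.val]? with
    | none => (some (k, Phase.home), Move.stay, s, Move.stay)
    | some nd => match nd.scan with
      | some _ => (some (k, Phase.fwd), Move.stay, s, Move.right)
      | none => (some (clamp n (nd.next k (nd.look a)), Phase.home), nd.move, s, Move.stay)
  | some (k, Phase.fwd), _, s =>
    match P[k.val]?.bind Node.scan, s with
    | some f, some g => match f g with
      | (g', none) => (some (k, Phase.fwd), Move.stay, some g', Move.right)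
      | (g', some b) => (some (k, Phase.back b), Move.stay, some g', Move.left)
    | _, _ => (some (k, Phase.home), Move.stay, s, Move.stay)
  | some (k, Phase.back b), _, s =>
    match s, P[k.val]? with
    | none, some nd => (some (clamp n (nd.next k b), Phase.home), Move.stay, s, Move.stay)
    | _, _ => (some (k, Phase.back b), Move.stay, s, Move.left)

/-- The verdict of the simulating machine. -/
def flowVerdict (n m : ℕ) : Option (Fin (n + 1) × Phase) → Option Bool
  | some (k, _) => if k.val = m + 1 then some true else if k.val = m + 2 then some false else none
  | none => none

/-- The Turing machine that runs the program `c` and answers with the outcome of the test `b`. -/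
def flowTM [Finite ι] (c : Cmd (Act ι) (Test α ι)) (b : Test α ι) : OfflineTM α where
  tapes := 1
  State := Option (Fin (c.size + 2 + 1) × Phase)
  Symbol := Option (ι → Option Bool)
  finite_state := inferInstance
  finite_symbol := inferInstance
  blank := some fun _ => none
  initial := none
  verdict := flowVerdict (c.size + 2) c.size
  trans := fun q a s =>
    let r := flowTrans (flow c b) (c.size + 2) q a (s 0)
    (r.1, r.2.1, fun _ => r.2.2)

/-- `M` goes from the configuration `c` to `c'` and visits on this way the cells up to `m` only. -/
def OfflineTM.Goes (M : OfflineTM α) (x : List α) (m : ℕ) (c c' : M.Config) : Prop :=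
  ∃ t, (M.step x)^[t] c = c' ∧ ∀ u ≤ t, ∀ i, ((M.step x)^[u] c).head i ≤ m

theorem OfflineTM.Goes.trans {M : OfflineTM α} {x : List α} {m : ℕ} {c d e : M.Config}
    (h : M.Goes x m c d) (h' : M.Goes x m d e) : M.Goes x m c e := by
  obtain ⟨t, h1, h2⟩ := h
  obtain ⟨s, h3, h4⟩ := h'
  refine ⟨s + t, by rw [Function.iterate_add_apply, h1, h3], ?_⟩
  intro u hu i
  by_cases hut : u ≤ t
  · exact h2 u hut i
  · obtain ⟨v, rfl⟩ := Nat.exists_eq_add_of_le' (le_of_not_ge hut)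
    rw [Function.iterate_add_apply, h1]
    exact h4 v (by omega) i

theorem OfflineTM.Goes.refl {M : OfflineTM α} {x : List α} {m : ℕ} {c : M.Config}
    (h : ∀ i, c.head i ≤ m) : M.Goes x m c c :=
  ⟨0, rfl, fun u hu => by rw [Nat.le_zero.1 hu]; exact h⟩

theorem OfflineTM.Goes.single {M : OfflineTM α} {x : List α} {m : ℕ} {c d : M.Config}
    (h : M.step x c = d) (hc : ∀ i, c.head i ≤ m) (hd : ∀ i, d.head i ≤ m) : M.Goes x m c d := by
  refine ⟨1, h, ?_⟩
  intro u hu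
  interval_cases u
  · exact hc
  · simpa [h] using hd

/-- The work tape with the marker and the tracks. -/
def tapeOf (g : ℕ → ι → Option Bool) : ℕ → Option (ι → Option Bool)
  | 0 => none
  | j + 1 => some (g j)

theorem tapeOf_update (g : ℕ → ι → Option Bool) (j : ℕ) (a : ι → Option Bool) :
    Function.update (tapeOf g) (j + 1) (some a) = tapeOf (Function.update g j a) := by
  funext i
  cases i with
  | zero => rfl
  | succ i =>
    by_cases h : i = j
    · subst h; simp [tapeOf]
    · simp [tapeOf, h]

section

variable [Finite ι] (c : Cmd (Act ι) (Test α ι)) (b : Test α ι)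

/-- The configurations of the simulating machine. -/
def flowCfg (q : Option (Fin (c.size + 2 + 1) × Phase)) (h : ℕ) (w : ℕ → Option (ι → Option Bool))
    (k : ℕ) : (flowTM c b).Config := ⟨q, h, fun _ => w, fun _ => k⟩

theorem flow_step {q : Option (Fin (c.size + 2 + 1) × Phase)} {h k : ℕ}
    {w : ℕ → Option (ι → Option Bool)} (x : List α)
    (hq : flowVerdict (c.size + 2) c.size q = none) :
    (flowTM c b).step x (flowCfg c b q h w k) =
      let r := flowTrans (flow c b) (c.size + 2) q (inputCell x h) (w k)
      flowCfg c b r.1 (min (r.2.1.apply h) (x.length + 1)) (Function.update w k r.2.2.1)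
        (r.2.2.2.apply k) := by
  have : (flowTM c b).verdict (flowCfg c b q h w k).state = none := hq
  unfold OfflineTM.step
  rw [this]
  rfl

theorem flowVerdict_of_lt {k : ℕ} {hk : k < c.size + 2 + 1} {p : Phase} (h : k < c.size + 1) :
    flowVerdict (c.size + 2) c.size (some (⟨k, hk⟩, p)) = none := by
  simp only [flowVerdict]
  rw [if_neg (by omega), if_neg (by omega)]

/-- Invariant of the sweep: the tracks before `j` are already new, the others still old. The head is
on cell `j + 1` because cell `0` holds the marker. -/
theorem flow_forward (x : List α) {k : ℕ} (hk : k < c.size + 1) {h : ℕ} (hh : h ≤ x.length + 1)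
    {nd : Node (Act ι) (Test α ι)} (hnd : (flow c b)[k]? = some nd)
    {f : (ι → Option Bool) → (ι → Option Bool) × Option Bool} (hf : nd.scan = some f)
    {m : ℕ} (g g' : ℕ → ι → Option Bool) (p : ℕ) (hp : p < m)
    (h1 : ∀ j < p, f (g j) = (g' j, none)) :
    ∀ j ≤ p, (flowTM c b).Goes x m (flowCfg c b (some (⟨k, by omega⟩, Phase.fwd)) h (tapeOf g) 1)
      (flowCfg c b (some (⟨k, by omega⟩, Phase.fwd)) h
        (tapeOf fun i => if i < j then g' i else g i) (j + 1)) := by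
  intro j
  induction j with
  | zero => intro _; simpa using OfflineTM.Goes.refl (M := flowTM c b) (fun _ => by
      change 1 ≤ m; omega)
  | succ j ih =>
    intro hj
    refine (ih (by omega)).trans (OfflineTM.Goes.single ?_ (fun _ => by
      change j + 1 ≤ m; omega) (fun _ => by change j + 1 + 1 ≤ m; omega))
    rw [flow_step _ _ _ (flowVerdict_of_lt c hk)]
    have e : flowTrans (flow c b) (c.size + 2) (some (⟨k, by omega⟩, Phase.fwd)) (inputCell x h)
        (tapeOf (fun i => if i < j then g' i else g i) (j + 1)) =
        (some (⟨k, by omega⟩, Phase.fwd), Move.stay, some (g' j), Move.right) := by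
      simp [flowTrans, hnd, hf, tapeOf, h1 j hj]
    rw [e]
    simp only [Move.apply]
    rw [min_eq_left hh, tapeOf_update]
    congr 2
    funext i
    by_cases hi : i = j
    · subst hi; simp
    · have : i < j + 1 ↔ i < j := by omega
      simp [hi, this]

theorem flow_back (x : List α) {k : ℕ} (hk : k < c.size + 1) {h : ℕ} (hh : h ≤ x.length + 1)
    (o : Bool) {m : ℕ} (g : ℕ → ι → Option Bool) :
    ∀ j ≤ m, (flowTM c b).Goes x m
      (flowCfg c b (some (⟨k, by omega⟩, Phase.back o)) h (tapeOf g) j)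
      (flowCfg c b (some (⟨k, by omega⟩, Phase.back o)) h (tapeOf g) 0) := by
  intro j
  induction j with
  | zero => intro _; exact OfflineTM.Goes.refl (M := flowTM c b) (fun _ => Nat.zero_le _)
  | succ j ih =>
    intro hj
    refine (OfflineTM.Goes.single ?_ (fun _ => by
      change j + 1 ≤ m; omega) (fun _ => by change j ≤ m; omega)).trans (ih (by omega))
    rw [flow_step _ _ _ (flowVerdict_of_lt c hk)]
    simp only [flowTrans, tapeOf, Move.apply, min_eq_left hh, tapeOf_update,
      Function.update_eq_self, Nat.add_sub_cancel]

/-- The simulation leaves the marker, rewrites the cells before `p`, turns at `p`, returns to the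
marker with the outcome in the state, and there passes to the next instruction. -/
theorem flow_scan (x : List α) {k : ℕ} (hk : k < c.size + 1) {h : ℕ} (hh : h ≤ x.length + 1)
    {nd : Node (Act ι) (Test α ι)} (hnd : (flow c b)[k]? = some nd)
    {f : (ι → Option Bool) → (ι → Option Bool) × Option Bool} (hf : nd.scan = some f)
    {m : ℕ} (g g' : ℕ → ι → Option Bool) (p : ℕ) (hp : p < m) (o : Bool)
    (h1 : ∀ j < p, f (g j) = (g' j, none)) (h2 : f (g p) = (g' p, some o))
    (h3 : ∀ j, p < j → g' j = g j) :
    (flowTM c b).Goes x m (flowCfg c b (some (⟨k, by omega⟩, Phase.home)) h (tapeOf g) 0)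
      (flowCfg c b (some (clamp (c.size + 2) (nd.next k o), Phase.home)) h (tapeOf g') 0) := by
  have s1 : (flowTM c b).Goes x m (flowCfg c b (some (⟨k, by omega⟩, Phase.home)) h (tapeOf g) 0)
      (flowCfg c b (some (⟨k, by omega⟩, Phase.fwd)) h (tapeOf g) 1) := by
    refine OfflineTM.Goes.single ?_ (fun _ => Nat.zero_le _) (fun _ => by change 1 ≤ m; omega)
    rw [flow_step _ _ _ (flowVerdict_of_lt c hk)]
    simp [flowTrans, hnd, hf, Move.apply, min_eq_left hh]
  have s2 := flow_forward c b x hk hh hnd hf g g' p hp h1 p le_rfl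
  have s3 : (flowTM c b).Goes x m
      (flowCfg c b (some (⟨k, by omega⟩, Phase.fwd)) h
        (tapeOf fun i => if i < p then g' i else g i) (p + 1))
      (flowCfg c b (some (⟨k, by omega⟩, Phase.back o)) h (tapeOf g') p) := by
    refine OfflineTM.Goes.single ?_ (fun _ => by change p + 1 ≤ m; omega)
      (fun _ => by change p ≤ m; omega)
    rw [flow_step _ _ _ (flowVerdict_of_lt c hk)]
    have e : flowTrans (flow c b) (c.size + 2) (some (⟨k, by omega⟩, Phase.fwd)) (inputCell x h)
        (tapeOf (fun i => if i < p then g' i else g i) (p + 1)) =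
        (some (⟨k, by omega⟩, Phase.back o), Move.stay, some (g' p), Move.left) := by
      simp [flowTrans, hnd, hf, tapeOf, h2]
    rw [e]
    simp only [Move.apply]
    rw [min_eq_left hh, tapeOf_update]
    congr 2
    funext i
    rcases lt_trichotomy i p with hi | hi | hi
    · simp [hi.ne, hi]
    · subst hi; simp
    · simp [hi.ne', hi.not_gt, h3 i hi]
  have s4 := flow_back c b x hk hh o g' p (m := m) hp.le
  refine (s1.trans (s2.trans (s3.trans s4))).trans
    (OfflineTM.Goes.single ?_ (fun _ => Nat.zero_le _) (fun _ => Nat.zero_le _))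
  rw [flow_step _ _ _ (flowVerdict_of_lt c hk)]
  simp only [flowTrans, hnd, tapeOf, Move.apply, min_eq_left hh]
  congr 1
  exact Function.update_eq_self 0 (tapeOf g')

/-- The configuration in which the machine begins the instruction `k`. -/
def homeCfg (y : ℕ × Store ι) : (flowTM c b).Config :=
  flowCfg c b (some (clamp (c.size + 2) y.1, Phase.home)) y.2.pos (tapeOf (track y.2.reg)) 0

theorem flow_node (x : List α) {L : ℕ} {y : ℕ × Store ι} {nd : Node (Act ι) (Test α ι)}
    (hnd : (flow c b)[y.1]? = some nd) (hy : (storeSem ι x L).inv y.2) :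
    (flowTM c b).Goes x (L + 1) (homeCfg c b y) (homeCfg c b (nd.step (storeSem ι x L) y)) := by
  obtain ⟨k, σ⟩ := y
  have hk : k < c.size + 1 := by
    have := (List.getElem?_eq_some_iff.1 hnd).1
    simpa [flow, Cmd.length_comp] using this
  have ek : clamp (c.size + 2) k = ⟨k, by omega⟩ := by
    apply Fin.ext; simp [clamp]; omega
  cases hf : nd.scan with
  | some f =>
    obtain ⟨h0, p, hp, o, h1, h2, h3, h4⟩ := Node.scan_spec x L k σ nd f hf hy
    have := flow_scan c b x hk hy.1 hnd hf (m := L + 1) _ _ p (by omega) o h1 h2 h3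
    unfold homeCfg
    simp only [ek]
    rw [h0, ← h4]
    exact this
  | none =>
    obtain ⟨h1, h2⟩ := Node.look_spec x L k σ nd hf hy
    refine OfflineTM.Goes.single ?_ (fun _ => Nat.zero_le _) (fun _ => Nat.zero_le _)
    unfold homeCfg
    rw [h1, h2]
    simp only [ek]
    rw [flow_step _ _ _ (flowVerdict_of_lt c hk)]
    simp [flowTrans, hnd, hf, Move.apply]

theorem flow_reach (x : List α) {L : ℕ} {y z : ℕ × Store ι} {n : ℕ}
    (h : Reach (storeSem ι x L) (flow c b) y z n) :
    (flowTM c b).Goes x (L + 1) (homeCfg c b y) (homeCfg c b z) := by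
  induction h with
  | refl x _ => exact OfflineTM.Goes.refl (fun _ => Nat.zero_le _)
  | head a h1 h2 _ ih => exact (flow_node c b x h1 h2).trans ih

/-- The Turing machine answers what the program computes, in space one more than the length of the
registers. -/
theorem flowTM_correct (x : List α) {L : ℕ} {τ : Store ι} {n : ℕ}
    (h : Exec (storeSem ι x L) c ⟨0, fun _ => []⟩ τ n) :
    (flowTM c b).Answers x (b.eval x τ) ∧ (flowTM c b).UsesSpace x (L + 2) := by
  have r := h.reach (flow c b) 0 [] [Node.branch b (c.size + 2)] rfl rfl
  have g1 := flow_reach c b x r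
  have hl : (flow c b)[(0 + c.size, τ).1]? = some (Node.branch b (c.size + 2)) := by
    simp [flow, Cmd.length_comp]
  have g2 := flow_node c b x hl h.inv_right
  -- The very first step only writes the marker. A blank cell is a cell with all tracks empty, so
  -- the rest of the tape already represents empty registers.
  have g0 : (flowTM c b).Goes x (L + 1) (flowTM c b).start
      (homeCfg c b (0, ⟨0, fun _ => []⟩)) := by
    refine OfflineTM.Goes.single ?_ (fun _ => Nat.zero_le _) (fun _ => Nat.zero_le _)
    have : (flowTM c b).start = flowCfg c b none 0 (fun _ => some fun _ => none) 0 := rfl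
    rw [this, flow_step _ _ _ rfl]
    simp only [flowTrans, Move.apply, homeCfg, Nat.zero_min]
    congr 1
    funext i
    cases i with
    | zero => rfl
    | succ i => simp [tapeOf]; rfl
  obtain ⟨t, ht, hs⟩ := g0.trans (g1.trans g2)
  have hv : (flowTM c b).verdict ((flowTM c b).run x t).state = some (b.eval x τ) := by
    have : (flowTM c b).run x t = _ := ht
    rw [this]
    change flowVerdict (c.size + 2) c.size (some (clamp (c.size + 2) _, Phase.home)) = _
    have e : (storeSem ι x L).test b τ = b.eval x τ := rfl
    simp only [Node.step, e]
    cases b.eval x τ <;> simp [flowVerdict, clamp]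
  refine ⟨⟨t, hv⟩, ?_⟩
  intro u i
  by_cases hu : u ≤ t
  · exact Nat.lt_succ_of_le (hs u hu i)
  · obtain ⟨v, rfl⟩ := Nat.exists_eq_add_of_le' (le_of_not_ge hu)
    -- The space bound concerns all times; after halting the configuration is constant.
    have : ∀ v, (flowTM c b).run x (v + t) = (flowTM c b).run x t := by
      intro v
      induction v with
      | zero => simp
      | succ v ih =>
        have e : (flowTM c b).run x (v + 1 + t) =
            (flowTM c b).step x ((flowTM c b).run x (v + t)) := by
          rw [Nat.add_right_comm]; exact Function.iterate_succ_apply' _ _ _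
        rw [e, ih]
        unfold OfflineTM.step
        rw [hv]
    rw [this v]
    exact Nat.lt_succ_of_le (hs t le_rfl i)

end

end

end UnaryUFA

/-! ### Logarithmic space: acceptance by deterministic walks -/

namespace UnaryUFA

section

/-! ### A program that simulates unary automata -/

/-- The registers of the program. -/
inductive Reg : Type
  | N | E | r | e | w | fl | ok | i | j | T | B | X | Y | Z | M | good
  deriving DecidableEq

instance : Finite Reg := by
  refine Fintype.finite ⟨{Reg.N, Reg.E, Reg.r, Reg.e, Reg.w, Reg.fl, Reg.ok, Reg.i, Reg.j, Reg.T,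
    Reg.B, Reg.X, Reg.Y, Reg.Z, Reg.M, Reg.good}, ?_⟩
  intro q
  cases q <;> decide

/-- The numbers in the registers; the register `Z` contains `0`. -/
structure Vals where
  N : ℕ := 0
  E : ℕ := 0
  r : ℕ := 0
  e : ℕ := 0
  w : ℕ := 0
  fl : ℕ := 0
  ok : ℕ := 0
  i : ℕ := 0
  j : ℕ := 0
  T : ℕ := 0
  B : ℕ := 0
  X : ℕ := 0
  Y : ℕ := 0
  M : ℕ := 0
  good : ℕ := 0

/-- The number in a register. -/
def Vals.get (v : Vals) : Reg → ℕ
  | Reg.N => v.N | Reg.E => v.E | Reg.r => v.r | Reg.e => v.e | Reg.w => v.w | Reg.fl => v.fl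
  | Reg.ok => v.ok | Reg.i => v.i | Reg.j => v.j | Reg.T => v.T | Reg.B => v.B | Reg.X => v.X
  | Reg.Y => v.Y | Reg.Z => 0 | Reg.M => v.M | Reg.good => v.good

/-- Change the number in a register. -/
def Vals.set (v : Vals) (q : Reg) (k : ℕ) : Vals :=
  match q with
  | Reg.N => { v with N := k } | Reg.E => { v with E := k } | Reg.r => { v with r := k }
  | Reg.e => { v with e := k } | Reg.w => { v with w := k } | Reg.fl => { v with fl := k }
  | Reg.ok => { v with ok := k } | Reg.i => { v with i := k } | Reg.j => { v with j := k }
  | Reg.T => { v with T := k } | Reg.B => { v with B := k } | Reg.X => { v with X := k }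
  | Reg.Y => { v with Y := k } | Reg.Z => v | Reg.M => { v with M := k }
  | Reg.good => { v with good := k }

theorem Vals.get_set (v : Vals) (q : Reg) (k : ℕ) (hq : q ≠ Reg.Z) :
    (v.set q k).get = Function.update v.get q k := by
  funext s
  cases q <;> cases s <;> first | rfl | exact absurd rfl hq

theorem Vals.get_set_self (v : Vals) {q : Reg} (k : ℕ) (hq : q ≠ Reg.Z) :
    (v.set q k).get q = k := by
  rw [v.get_set q k hq, Function.update_self]

theorem Vals.get_set_of_ne (v : Vals) {q s : Reg} (k : ℕ) (h : s ≠ q) :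
    (v.set q k).get s = v.get s := by
  cases q <;> cases s <;> first | rfl | exact absurd rfl h

theorem Vals.set_set (v : Vals) (q : Reg) (k l : ℕ) : (v.set q k).set q l = v.set q l := by
  cases q <;> rfl

theorem Vals.set_get (v : Vals) (q : Reg) : v.set q (v.get q) = v := by
  cases q <;> rfl

/-- The store with the numbers `v` in the registers. -/
def mkStore (h : ℕ) (v : Vals) : Store Reg := ⟨h, fun q => (v.get q).bits⟩

/-- Programs. -/
abbrev Prog : Type := Cmd (Act Reg) (Test Letter Reg)

/-- The position of the head is on the tape, and the numbers are at most `V`. -/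
def Fits (x : List Letter) (V h : ℕ) (v : Vals) : Prop :=
  h ≤ x.length + 1 ∧ ∀ q, v.get q ≤ V

/-- The program leads from the head position `h` and the numbers `v` to `h'` and `v'`, using only
numbers with at most as many digits as `V`. -/
def Does (x : List Letter) (V : ℕ) (c : Prog) (h : ℕ) (v : Vals) (h' : ℕ) (v' : Vals) : Prop :=
  ∃ n, Exec (storeSem Reg x V.size) c (mkStore h v) (mkStore h' v') n

variable {x : List Letter} {V : ℕ} {c d : Prog} {h h' h'' : ℕ} {v v' v'' : Vals}

theorem length_bits_le {k V : ℕ} (h : k ≤ V) : k.bits.length ≤ V.size := by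
  rw [Nat.size_eq_bits_len]; exact Nat.size_le_size h

theorem bits_inj {k l : ℕ} : k.bits = l.bits ↔ k = l := by
  constructor
  · intro h
    apply (Nat.digits_inj_iff (b := 2)).1
    rw [Nat.digits_two_eq_bits, Nat.digits_two_eq_bits, h]
  · rintro rfl; rfl

theorem Fits.inv (h : Fits x V h' v) : (storeSem Reg x V.size).inv (mkStore h' v) :=
  ⟨h.1, fun q => length_bits_le (h.2 q)⟩

theorem Fits.set (h : Fits x V h' v) (q : Reg) {k : ℕ} (hk : k ≤ V) :
    Fits x V h' (v.set q k) := by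
  refine ⟨h.1, fun s => ?_⟩
  by_cases hq : q = Reg.Z
  · subst hq; exact h.2 s
  by_cases hs : s = q
  · subst hs; rw [v.get_set_self k hq]; exact hk
  · rw [v.get_set_of_ne k hs]; exact h.2 s

theorem Fits.pos (h : Fits x V h' v) {k : ℕ} (hk : k ≤ x.length + 1) : Fits x V k v := ⟨hk, h.2⟩

theorem mkStore_update (h : ℕ) (v : Vals) {q : Reg} (hq : q ≠ Reg.Z) (k : ℕ) :
    (⟨h, Function.update (mkStore h v).reg q k.bits⟩ : Store Reg) = mkStore h (v.set q k) := by
  unfold mkStore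
  congr 1
  funext s
  rw [v.get_set q k hq]
  by_cases hs : s = q
  · subst hs; simp
  · simp [hs]

namespace Does

theorem skip (hv : Fits x V h v) : Does x V Cmd.skip h v h v := ⟨_, Exec.skip hv.inv⟩

theorem seq (h1 : Does x V c h v h' v') (h2 : Does x V d h' v' h'' v'') :
    Does x V (Cmd.seq c d) h v h'' v'' :=
  let ⟨_, e1⟩ := h1; let ⟨_, e2⟩ := h2; ⟨_, Exec.seq e1 e2⟩

theorem inc (hv : Fits x V h v) (q : Reg) (hq : q ≠ Reg.Z) (hk : v.get q < V) :
    Does x V (Cmd.act (Act.inc q)) h v h (v.set q (v.get q + 1)) := by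
  have e : (storeSem Reg x V.size).act (Act.inc q) (mkStore h v) =
      mkStore h (v.set q (v.get q + 1)) := by
    rw [← mkStore_update h v hq, bits_succ]; rfl
  refine ⟨1, ?_⟩
  rw [← e]
  exact Exec.act _ hv.inv (e ▸ (hv.set q hk).inv)

theorem clear (hv : Fits x V h v) (q : Reg) (hq : q ≠ Reg.Z) :
    Does x V (Cmd.act (Act.clear q)) h v h (v.set q 0) := by
  have e : (storeSem Reg x V.size).act (Act.clear q) (mkStore h v) = mkStore h (v.set q 0) := by
    rw [← mkStore_update h v hq, Nat.zero_bits]; rfl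
  refine ⟨1, ?_⟩
  rw [← e]
  exact Exec.act _ hv.inv (e ▸ (hv.set q (Nat.zero_le V)).inv)

theorem right (hv : Fits x V h v) (hh : h ≤ x.length) :
    Does x V (Cmd.act Act.right) h v (h + 1) v := by
  have e : (storeSem Reg x V.size).act Act.right (mkStore h v) = mkStore (h + 1) v := by
    change (⟨min (h + 1) (x.length + 1), _⟩ : Store Reg) = _
    rw [min_eq_left (by omega)]; rfl
  refine ⟨1, ?_⟩
  rw [← e]
  exact Exec.act _ hv.inv (e ▸ (hv.pos (by omega)).inv)

theorem left (hv : Fits x V h v) : Does x V (Cmd.act Act.left) h v (h - 1) v :=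
  ⟨1, Exec.act Act.left hv.inv (hv.pos (show h - 1 ≤ _ from (Nat.sub_le h 1).trans hv.1)).inv⟩

theorem test_ne (q s : Reg) :
    (storeSem Reg x V.size).test (Test.ne q s) (mkStore h v) = true ↔ v.get q ≠ v.get s := by
  change ((v.get q).bits != (v.get s).bits) = true ↔ _
  rw [bne_iff_ne, ne_eq, bits_inj]

theorem test_eq (q s : Reg) :
    (storeSem Reg x V.size).test (Test.ne q s) (mkStore h v) = false ↔ v.get q = v.get s := by
  rw [← Bool.not_eq_true, test_ne, not_not]

theorem ite_ne {q s : Reg} (hn : v.get q ≠ v.get s) (h1 : Does x V c h v h' v') :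
    Does x V (Cmd.ite (Test.ne q s) c d) h v h' v' :=
  let ⟨_, e⟩ := h1; ⟨_, Exec.ite_true e.inv_left ((test_ne q s).2 hn) e⟩

theorem ite_eq {q s : Reg} (hn : v.get q = v.get s) (h1 : Does x V d h v h' v') :
    Does x V (Cmd.ite (Test.ne q s) c d) h v h' v' :=
  let ⟨_, e⟩ := h1; ⟨_, Exec.ite_false e.inv_left ((test_eq q s).2 hn) e⟩

theorem loop_ne {q s : Reg} (hn : v.get q ≠ v.get s) (h1 : Does x V c h v h' v')
    (h2 : Does x V (Cmd.loop (Test.ne q s) c) h' v' h'' v'') :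
    Does x V (Cmd.loop (Test.ne q s) c) h v h'' v'' :=
  let ⟨_, e1⟩ := h1; let ⟨_, e2⟩ := h2; ⟨_, Exec.loop_true e1.inv_left ((test_ne q s).2 hn) e1 e2⟩

theorem loop_eq {q s : Reg} (hv : Fits x V h v) (hn : v.get q = v.get s) :
    Does x V (Cmd.loop (Test.ne q s) c) h v h v :=
  ⟨_, Exec.loop_false hv.inv ((test_eq q s).2 hn)⟩

theorem loop_letter {p : InputCell Letter → Bool} (hp : p (inputCell x h) = true)
    (h1 : Does x V c h v h' v') (h2 : Does x V (Cmd.loop (Test.letter p) c) h' v' h'' v'') :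
    Does x V (Cmd.loop (Test.letter p) c) h v h'' v'' :=
  let ⟨_, e1⟩ := h1; let ⟨_, e2⟩ := h2; ⟨_, Exec.loop_true e1.inv_left hp e1 e2⟩

theorem loop_not_letter {p : InputCell Letter → Bool} (hv : Fits x V h v)
    (hp : p (inputCell x h) = false) : Does x V (Cmd.loop (Test.letter p) c) h v h v :=
  ⟨_, Exec.loop_false hv.inv hp⟩

/-- A loop that counts the register `q` up to the number in the register `s`. -/
theorem count_loop {q s : Reg} (hq : q ≠ Reg.Z) (F : ℕ → Vals) (T : ℕ)
    (hF : ∀ t ≤ T, Fits x V h (F t)) (h0 : ∀ t ≤ T, (F t).get q = t)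
    (hT : ∀ t ≤ T, (F t).get s = T)
    (hb : ∀ t < T, Does x V c h (F t) h ((F (t + 1)).set q t)) :
    Does x V (Cmd.loop (Test.ne q s) (Cmd.seq c (Cmd.act (Act.inc q)))) h (F 0) h (F T) := by
  -- Again by the number of remaining passages. The body ends in `F (t + 1)` with the counter still
  -- at `t`; the increment then completes `F (t + 1)`.
  have key : ∀ j ≤ T, Does x V (Cmd.loop (Test.ne q s) (Cmd.seq c (Cmd.act (Act.inc q))))
      h (F (T - j)) h (F T) := by
    intro j
    induction j with
    | zero => intro _; exact loop_eq (hF _ le_rfl) ((h0 _ le_rfl).trans (hT _ le_rfl).symm)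
    | succ j ih =>
      intro hj
      obtain ⟨u, hu⟩ : ∃ u, u = T - (j + 1) := ⟨_, rfl⟩
      have hu1 : T - j = u + 1 := by omega
      have hTV : T ≤ V := hT T le_rfl ▸ (hF T le_rfl).2 s
      rw [← hu]
      refine loop_ne (h' := h) (v' := F (u + 1)) ?_ ?_ (hu1 ▸ ih (by omega))
      · rw [h0 u (by omega), hT u (by omega)]; omega
      · refine seq (hb u (by omega)) ?_
        have h2 := inc ((hF (u + 1) (by omega)).set q (k := u) (by omega)) q hq
          (by rw [Vals.get_set_self _ _ hq]; omega)
        rw [Vals.get_set_self _ _ hq, Vals.set_set] at h2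
        have h3 : (F (u + 1)).set q (u + 1) = F (u + 1) := by
          have h4 := Vals.set_get (F (u + 1)) q
          rwa [h0 (u + 1) (by omega)] at h4
        rwa [h3] at h2
  simpa using key T le_rfl

end Does

/-- Copy the number in `s` to `q`. -/
def copyTo (q s : Reg) : Prog :=
  Cmd.seq (Cmd.act (Act.clear q))
    (Cmd.loop (Test.ne q s) (Cmd.seq Cmd.skip (Cmd.act (Act.inc q))))

theorem Does.copyTo (hv : Fits x V h v) {q s : Reg} (hq : q ≠ Reg.Z) (hqs : s ≠ q) :
    Does x V (copyTo q s) h v h (v.set q (v.get s)) := by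
  refine (Does.clear hv q hq).seq (Does.count_loop hq (fun t => v.set q t) (v.get s) ?_ ?_ ?_ ?_)
  · intro t ht; exact hv.set q (ht.trans (hv.2 s))
  · intro t _; exact Vals.get_set_self _ _ hq
  · intro t _; exact Vals.get_set_of_ne _ _ hqs
  · intro t ht
    simp only [Vals.set_set]
    exact Does.skip (hv.set q (ht.le.trans (hv.2 s)))

/-- Set the register `q` to `1`. -/
def setOne (q : Reg) : Prog := Cmd.seq (Cmd.act (Act.clear q)) (Cmd.act (Act.inc q))

theorem Does.setOne (hv : Fits x V h v) {q : Reg} (hq : q ≠ Reg.Z) (hV : 1 ≤ V) :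
    Does x V (setOne q) h v h (v.set q 1) := by
  have h1 := Does.inc (hv.set q (Nat.zero_le V)) q hq (by rw [Vals.get_set_self _ _ hq]; omega)
  rw [Vals.get_set_self _ _ hq, Vals.set_set] at h1
  exact (Does.clear hv q hq).seq h1

/-! ### Reading numbers from the input -/

/-- The word `w` is written on the input tape from the cell `h` on. -/
def At (x : List Letter) (h : ℕ) (w : List Letter) : Prop :=
  ∃ pre post, x = pre ++ (w ++ post) ∧ pre.length + 1 = h

theorem At.left {u w : List Letter} (h1 : At x h (u ++ w)) : At x h u :=
  let ⟨pre, post, e1, e2⟩ := h1; ⟨pre, w ++ post, by simp [e1], e2⟩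

theorem At.right {u w : List Letter} (h1 : At x h (u ++ w)) : At x (h + u.length) w :=
  let ⟨pre, post, e1, e2⟩ := h1; ⟨pre ++ u, post, by simp [e1], by simp; omega⟩

theorem At.le {u : List Letter} (h1 : At x h u) : h + u.length ≤ x.length + 1 := by
  obtain ⟨pre, post, e1, e2⟩ := h1
  simp [e1]; omega

theorem At.cell {a : Letter} {u : List Letter} (h1 : At x h (a :: u)) :
    inputCell x h = InputCell.letter a := by
  obtain ⟨pre, post, e1, rfl⟩ := h1
  simp [inputCell, e1]

theorem At.tail {a : Letter} {u : List Letter} (h1 : At x h (a :: u)) : At x (h + 1) u :=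
  At.right (u := [a]) h1

/-- A bit is scanned. -/
def isBit : InputCell Letter → Bool
  | InputCell.letter (Letter.bit _) => true
  | _ => false

/-- The bit `1` is scanned. -/
def isOne : InputCell Letter → Bool
  | InputCell.letter (Letter.bit b) => b
  | _ => false

/-- Read the bits of a number. -/
def readBits (q : Reg) : Prog :=
  Cmd.loop (Test.letter isBit)
    (Cmd.seq (Cmd.ite (Test.letter isOne) (Cmd.act (Act.push q true)) (Cmd.act (Act.push q false)))
      (Cmd.act Act.right))

/-- While a number is read lowest bit first, the register holds a prefix that may end in zeros and
then is not the binary form of any number. This is why the induction is about arbitrary words in the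
registers and not about `Vals`. -/
theorem exec_readBits (q : Reg) {L : ℕ} (l : List Bool) : ∀ (h : ℕ) (R : Reg → List Bool),
    At x h (l.map Letter.bit ++ [Letter.comma]) → (∀ s, (R s).length ≤ L) →
    (R q ++ l).length ≤ L →
    ∃ n, Exec (storeSem Reg x L) (readBits q) ⟨h, R⟩
      ⟨h + l.length, Function.update R q (R q ++ l)⟩ n := by
  induction l with
  | nil =>
    intro h R hx hR _
    have h1 := hx.le
    refine ⟨1, ?_⟩
    have e : Function.update R q (R q ++ []) = R := by simp
    rw [e]
    refine Exec.loop_false ⟨by simp at h1; change h ≤ _; omega, hR⟩ ?_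
    change isBit (inputCell x h) = false
    rw [At.cell (a := Letter.comma) (u := []) hx]; rfl
  | cons b l ih =>
    intro h R hx hR hl
    have hx' : At x h (Letter.bit b :: (l.map Letter.bit ++ [Letter.comma])) := hx
    have hc := hx'.cell
    have h1 := hx'.le
    simp only [List.length_cons] at h1
    have hI : (storeSem Reg x L).inv ⟨h, R⟩ := ⟨by change h ≤ _; omega, hR⟩
    have hR' : ∀ s, (Function.update R q (R q ++ [b]) s).length ≤ L := by
      intro s
      by_cases hs : s = q
      · subst hs; simp at hl ⊢; omega
      · simpa [hs] using hR s
    have hI' : (storeSem Reg x L).inv ⟨h, Function.update R q (R q ++ [b])⟩ :=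
      ⟨by change h ≤ _; omega, hR'⟩
    obtain ⟨n, hn⟩ := ih (h + 1) (Function.update R q (R q ++ [b])) hx'.tail hR'
      (by simpa using hl)
    have e : Function.update (Function.update R q (R q ++ [b])) q
        (Function.update R q (R q ++ [b]) q ++ l) = Function.update R q (R q ++ b :: l) := by simp
    rw [e, Nat.add_right_comm, Nat.add_assoc] at hn
    have h3 : Exec (storeSem Reg x L) (Cmd.act Act.right)
        ⟨h, Function.update R q (R q ++ [b])⟩ ⟨h + 1, Function.update R q (R q ++ [b])⟩ 1 := by
      have e : (storeSem Reg x L).act Act.right ⟨h, Function.update R q (R q ++ [b])⟩ =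
          ⟨h + 1, Function.update R q (R q ++ [b])⟩ := by
        change (⟨min (h + 1) (x.length + 1), _⟩ : Store Reg) = _
        rw [min_eq_left (by omega)]
      rw [← e]
      exact Exec.act _ hI' (e ▸ ⟨by change h + 1 ≤ _; omega, hR'⟩)
    have h4 : ∃ n, Exec (storeSem Reg x L)
        (Cmd.ite (Test.letter isOne) (Cmd.act (Act.push q true)) (Cmd.act (Act.push q false)))
        ⟨h, R⟩ ⟨h, Function.update R q (R q ++ [b])⟩ n := by
      cases b with
      | true =>
        exact ⟨_, Exec.ite_true hI (by change isOne (inputCell x h) = true; rw [hc]; rfl)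
          (Exec.act (Act.push q true) hI hI')⟩
      | false =>
        exact ⟨_, Exec.ite_false hI (by change isOne (inputCell x h) = false; rw [hc]; rfl)
          (Exec.act (Act.push q false) hI hI')⟩
    obtain ⟨n', hn'⟩ := h4
    exact ⟨_, Exec.loop_true hI (by change isBit (inputCell x h) = true; rw [hc]; rfl)
      (hn'.seq h3) hn⟩

/-- Read a number from the input into the register `q`. -/
def readNum (q : Reg) : Prog :=
  Cmd.seq (Cmd.act (Act.clear q)) (Cmd.seq (readBits q) (Cmd.act Act.right))

theorem Does.readNum (hv : Fits x V h v) {q : Reg} (hq : q ≠ Reg.Z) {k : ℕ} (hk : k ≤ V)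
    (hx : At x h (wordOf [k])) :
    Does x V (readNum q) h v (h + (wordOf [k]).length) (v.set q k) := by
  have hx' : At x h (k.bits.map Letter.bit ++ [Letter.comma]) := by simpa [wordOf] using hx
  have hle := hx'.le
  simp only [List.length_append, List.length_map, List.length_singleton] at hle
  obtain ⟨n, hn⟩ := exec_readBits q k.bits h (mkStore h (v.set q 0)).reg hx'
    (hv.set q (Nat.zero_le V)).inv.2 (by
      simpa [mkStore, Vals.get_set_self v 0 hq] using length_bits_le hk)
  have e : (mkStore h (v.set q 0)).reg q = [] := by simp [mkStore, Vals.get_set_self v 0 hq]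
  have h2 : Does x V (readBits q) h (v.set q 0) (h + k.bits.length) (v.set q k) := by
    refine ⟨n, ?_⟩
    rw [e, List.nil_append] at hn
    have e2 := mkStore_update (h + k.bits.length) (v.set q 0) hq k
    rw [Vals.set_set] at e2
    rw [← e2]
    exact hn
  have h3 := Does.right (((hv.set q hk).pos (k := h + k.bits.length)) (by omega)) (by omega)
  have e3 : h + (wordOf [k]).length = h + k.bits.length + 1 := by simp [wordOf]; omega
  rw [e3]
  exact (Does.clear hv q hq).seq (h2.seq h3)

end

end UnaryUFA

namespace UnaryUFA

section

variable {x : List Letter} {V : ℕ} {c d : Prog} {h h' h'' : ℕ} {v v' v'' : Vals}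

/-! ### One pass over the description of an automaton -/

/-- The numbers in a list of pairs. -/
def flat (l : List (ℕ × ℕ)) : List ℕ := l.flatMap fun p => [p.1, p.2]

theorem wordOf_flat_cons (p : ℕ × ℕ) (l : List (ℕ × ℕ)) :
    wordOf (flat (p :: l)) = wordOf [p.1] ++ (wordOf [p.2] ++ wordOf (flat l)) := by
  simp [wordOf, flat]

/-- Go through a list of candidates; stay with the preferred candidate `e` when it is found. -/
def pick (e d : ℕ) (l : List ℕ) : ℕ := l.foldl (fun w y => if w = e then w else y) d

/-- The indices, from `i` on, of the pairs with nonzero first component. -/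
def startList : ℕ → List (ℕ × ℕ) → List ℕ
  | _, [] => []
  | i, p :: l => (if p.1 ≠ 0 then [i] else []) ++ startList (i + 1) l

/-- Replace `f` by `1` if the pair with index `r` has nonzero second component; the indices of the
list begin with `i`. -/
def flagFrom (r : ℕ) : ℕ → List (ℕ × ℕ) → ℕ → ℕ
  | _, [], f => f
  | i, p :: l, f => flagFrom r (i + 1) l (if p.2 ≠ 0 ∧ r = i then 1 else f)

/-- The targets of the edges with source `r`. -/
def targets (r : ℕ) (l : List (ℕ × ℕ)) : List ℕ := (l.filter fun p => p.1 = r).map Prod.snd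

theorem pick_targets_cons (e w r : ℕ) (p : ℕ × ℕ) (l : List (ℕ × ℕ)) :
    pick e w (targets r (p :: l)) =
      pick e (if p.1 = r then (if w = e then w else p.2) else w) (targets r l) := by
  by_cases h : p.1 = r
  · rw [if_pos h, targets, List.filter_cons_of_pos (by simpa using h)]; rfl
  · rw [if_neg h, targets, List.filter_cons_of_neg (by simpa using h)]; rfl

/-- Replace the number in `w` by the number in `y`, unless it is the preferred one. -/
def choose (y : Reg) : Prog := Cmd.ite (Test.ne Reg.w Reg.e) (copyTo Reg.w y) Cmd.skip

theorem does_choose (hv : Fits x V h v) {y : Reg} (hy : y ≠ Reg.w) :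
    Does x V (choose y) h v h (v.set Reg.w (if v.w = v.e then v.w else v.get y)) := by
  by_cases hw : v.w = v.e
  · rw [if_pos hw]
    exact Does.ite_eq hw (Does.skip hv)
  · rw [if_neg hw]
    exact Does.ite_ne hw (Does.copyTo hv (by decide) hy)

theorem does_congr {k : ℕ} {u : Vals} (hc : Does x V c h v k u) (hk : k = h') (hu : u = v') :
    Does x V c h v h' v' := hk ▸ hu ▸ hc

/-- Moves the case distinction from the control flow into the value assigned to one register, so
that longer programs can be composed without splitting cases. -/
theorem does_unless (hv : Fits x V h v) {a b q : Reg} {k : ℕ}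
    (hc : Does x V c h v h (v.set q k)) :
    Does x V (Cmd.ite (Test.ne a b) Cmd.skip c) h v h
      (v.set q (if v.get a = v.get b then k else v.get q)) := by
  by_cases h1 : v.get a = v.get b
  · rw [if_pos h1]
    exact Does.ite_eq h1 hc
  · rw [if_neg h1, Vals.set_get]
    exact Does.ite_ne h1 (Does.skip hv)

theorem does_when (hv : Fits x V h v) {a b a' b' q : Reg} {k : ℕ}
    (hc : Does x V c h v h (v.set q k)) :
    Does x V (Cmd.ite (Test.ne a b) (Cmd.ite (Test.ne a' b') Cmd.skip c) Cmd.skip) h v h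
      (v.set q (if v.get a ≠ v.get b ∧ v.get a' = v.get b' then k else v.get q)) := by
  by_cases h1 : v.get a = v.get b
  · rw [if_neg (by simp [h1]), Vals.set_get]
    exact Does.ite_eq h1 (Does.skip hv)
  · simp only [ne_eq, h1, not_false_eq_true, true_and]
    exact Does.ite_ne h1 (does_unless hv hc)

/-- Process the description of a state. -/
def stateBody : Prog :=
  Cmd.seq (readNum Reg.X) <| Cmd.seq (readNum Reg.Y) <|
  Cmd.seq (Cmd.ite (Test.ne Reg.X Reg.Z)
    (Cmd.ite (Test.ne Reg.r Reg.N) Cmd.skip (choose Reg.i)) Cmd.skip) <|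
  Cmd.seq (Cmd.ite (Test.ne Reg.Y Reg.Z)
    (Cmd.ite (Test.ne Reg.r Reg.i) Cmd.skip (setOne Reg.fl)) Cmd.skip) <|
  Cmd.seq (Cmd.act (Act.clear Reg.X)) <| Cmd.seq (Cmd.act (Act.clear Reg.Y)) <|
  Cmd.act (Act.inc Reg.i)

/-- Process the description of an edge. -/
def edgeBody : Prog :=
  Cmd.seq (readNum Reg.X) <| Cmd.seq (readNum Reg.Y) <|
  Cmd.seq (Cmd.ite (Test.ne Reg.X Reg.r) Cmd.skip (choose Reg.Y)) <|
  Cmd.seq (Cmd.act (Act.clear Reg.X)) <| Cmd.seq (Cmd.act (Act.clear Reg.Y)) <|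
  Cmd.act (Act.inc Reg.i)

theorem does_stateBody (hv : Fits x V h v) (p : ℕ × ℕ) (hX : v.X = 0) (hY : v.Y = 0)
    (hp : p.1 ≤ V ∧ p.2 ≤ V) (hi : v.i < V) (hx : At x h (wordOf [p.1] ++ wordOf [p.2])) :
    Does x V stateBody h v (h + (wordOf [p.1] ++ wordOf [p.2]).length)
      { v with
        i := v.i + 1
        w := if p.1 ≠ 0 ∧ v.r = v.N then (if v.w = v.e then v.w else v.i) else v.w
        fl := if p.2 ≠ 0 ∧ v.r = v.i then 1 else v.fl } := by
  have hle := hx.le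
  rw [List.length_append] at hle ⊢
  have f1 := (hv.set Reg.X hp.1).pos (k := h + (wordOf [p.1]).length) (by omega)
  have f2 := (f1.set Reg.Y hp.2).pos
    (k := h + (wordOf [p.1]).length + (wordOf [p.2]).length) (by omega)
  have hw : (if p.1 ≠ 0 ∧ v.r = v.N then (if v.w = v.e then v.w else v.i) else v.w) ≤ V := by
    have := hv.2 Reg.w
    have := hv.2 Reg.i
    simp only [Vals.get] at *
    split_ifs <;> assumption
  have hf : (if p.2 ≠ 0 ∧ v.r = v.i then 1 else v.fl) ≤ V := by
    have := hv.2 Reg.fl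
    simp only [Vals.get] at *
    split_ifs <;> omega
  have f3 := f2.set Reg.w hw
  have f4 := f3.set Reg.fl hf
  have f5 := f4.set Reg.X (Nat.zero_le V)
  have f6 := f5.set Reg.Y (Nat.zero_le V)
  have s1 := Does.readNum hv (q := Reg.X) (by decide) hp.1 hx.left
  have s2 := Does.readNum f1 (q := Reg.Y) (by decide) hp.2 hx.right
  have s5 := Does.clear f4 Reg.X (by decide)
  have s6 := Does.clear f5 Reg.Y (by decide)
  have s7 := Does.inc f6 Reg.i (by decide) hi
  have s3 := does_when f2 (a := Reg.X) (b := Reg.Z) (a' := Reg.r) (b' := Reg.N)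
    (does_choose f2 (y := Reg.i) (by decide))
  have s4 := does_when f3 (a := Reg.Y) (b := Reg.Z) (a' := Reg.r) (b' := Reg.i)
    (Does.setOne f3 (q := Reg.fl) (by decide) (by omega))
  refine does_congr (s1.seq (s2.seq (s3.seq (s4.seq (s5.seq (s6.seq s7)))))) (Nat.add_assoc _ _ _) ?_
  simp only [Vals.set, Vals.get, hX, hY]

theorem does_edgeBody (hv : Fits x V h v) (p : ℕ × ℕ) (hX : v.X = 0) (hY : v.Y = 0)
    (hp : p.1 ≤ V ∧ p.2 ≤ V) (hi : v.i < V) (hx : At x h (wordOf [p.1] ++ wordOf [p.2])) :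
    Does x V edgeBody h v (h + (wordOf [p.1] ++ wordOf [p.2]).length)
      { v with
        i := v.i + 1
        w := if p.1 = v.r then (if v.w = v.e then v.w else p.2) else v.w } := by
  have hle := hx.le
  rw [List.length_append] at hle ⊢
  have f1 := (hv.set Reg.X hp.1).pos (k := h + (wordOf [p.1]).length) (by omega)
  have f2 := (f1.set Reg.Y hp.2).pos
    (k := h + (wordOf [p.1]).length + (wordOf [p.2]).length) (by omega)
  have hw : (if p.1 = v.r then (if v.w = v.e then v.w else p.2) else v.w) ≤ V := by
    have := hv.2 Reg.w
    simp only [Vals.get] at *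
    split_ifs <;> first | assumption | exact hp.2
  have f3 := f2.set Reg.w hw
  have f4 := f3.set Reg.X (Nat.zero_le V)
  have f5 := f4.set Reg.Y (Nat.zero_le V)
  have s1 := Does.readNum hv (q := Reg.X) (by decide) hp.1 hx.left
  have s2 := Does.readNum f1 (q := Reg.Y) (by decide) hp.2 hx.right
  have s4 := Does.clear f3 Reg.X (by decide)
  have s5 := Does.clear f4 Reg.Y (by decide)
  have s6 := Does.inc f5 Reg.i (by decide) hi
  have s3 := does_unless f2 (a := Reg.X) (b := Reg.r) (does_choose f2 (y := Reg.Y) (by decide))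
  refine does_congr (s1.seq (s2.seq (s3.seq (s4.seq (s5.seq s6))))) (Nat.add_assoc _ _ _) ?_
  simp only [Vals.set, Vals.get, hX, hY]

/-- For the induction the list is a tail of the description, with indices beginning at `v.i`.
Initial states are candidates only if `v.r = v.N`, that is, before the run has begun. -/
theorem does_stateLoop (ps : List (ℕ × ℕ)) : ∀ (h : ℕ) (v : Vals), Fits x V h v →
    At x h (wordOf (flat ps)) → v.X = 0 → v.Y = 0 → v.i + ps.length = v.N →
    (∀ p ∈ ps, p.1 ≤ V ∧ p.2 ≤ V) →
    Does x V (Cmd.loop (Test.ne Reg.i Reg.N) stateBody) h v (h + (wordOf (flat ps)).length)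
      { v with
        i := v.N
        w := if v.r = v.N then pick v.e v.w (startList v.i ps) else v.w
        fl := flagFrom v.r v.i ps v.fl } := by
  induction ps with
  | nil =>
    intro h v hv _ _ _ hi _
    have hi' : v.i = v.N := by simpa using hi
    simp only [startList, pick, flagFrom, List.foldl_nil, ite_self]
    obtain ⟨⟩ := v
    simp only at hi'
    subst hi'
    exact Does.loop_eq (q := Reg.i) (s := Reg.N) hv rfl
  | cons p ps ih =>
    intro h v hv hx hX hY hi hp
    have hx' : At x h ((wordOf [p.1] ++ wordOf [p.2]) ++ wordOf (flat ps)) := by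
      rw [List.append_assoc, ← wordOf_flat_cons]; exact hx
    have hN : v.N ≤ V := hv.2 Reg.N
    simp only [List.length_cons] at hi
    have s1 := does_stateBody hv p hX hY (hp p (by simp)) (by omega) hx'.left
    have hle := hx'.left.le
    have hw : (if p.1 ≠ 0 ∧ v.r = v.N then (if v.w = v.e then v.w else v.i) else v.w) ≤ V := by
      have := hv.2 Reg.w
      have := hv.2 Reg.i
      simp only [Vals.get] at *
      split_ifs <;> assumption
    have hf : (if p.2 ≠ 0 ∧ v.r = v.i then 1 else v.fl) ≤ V := by
      have := hv.2 Reg.fl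
      simp only [Vals.get] at *
      split_ifs <;> omega
    have f1 := (((hv.set Reg.i (k := v.i + 1) (by omega)).set Reg.w hw).set Reg.fl hf).pos hle
    have s2 := ih _ _ f1 hx'.right hX hY (by simp only [Vals.set]; omega)
      (fun q hq => hp q (by simp [hq]))
    have s3 := Does.loop_ne (show v.get Reg.i ≠ v.get Reg.N by simp only [Vals.get]; omega) s1 s2
    have e : h + (wordOf (flat (p :: ps))).length =
        h + (wordOf [p.1] ++ wordOf [p.2]).length + (wordOf (flat ps)).length := by
      rw [wordOf_flat_cons]; simp only [List.length_append]; omega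
    rw [e]
    convert s3 using 1
    simp only [Vals.set, flagFrom, startList]
    congr 1
    by_cases hr : v.r = v.N <;> by_cases h1 : p.1 = 0 <;> simp [hr, h1, pick]

theorem does_edgeLoop (es : List (ℕ × ℕ)) : ∀ (h : ℕ) (v : Vals), Fits x V h v →
    At x h (wordOf (flat es)) → v.X = 0 → v.Y = 0 → v.i + es.length = v.E →
    (∀ p ∈ es, p.1 ≤ V ∧ p.2 ≤ V) →
    Does x V (Cmd.loop (Test.ne Reg.i Reg.E) edgeBody) h v (h + (wordOf (flat es)).length)
      { v with
        i := v.E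
        w := pick v.e v.w (targets v.r es) } := by
  induction es with
  | nil =>
    intro h v hv _ _ _ hi _
    have hi' : v.i = v.E := by simpa using hi
    simp only [targets, pick, List.filter_nil, List.map_nil, List.foldl_nil]
    obtain ⟨⟩ := v
    simp only at hi'
    subst hi'
    exact Does.loop_eq (q := Reg.i) (s := Reg.E) hv rfl
  | cons p ps ih =>
    intro h v hv hx hX hY hi hp
    have hx' : At x h ((wordOf [p.1] ++ wordOf [p.2]) ++ wordOf (flat ps)) := by
      rw [List.append_assoc, ← wordOf_flat_cons]; exact hx
    have hN : v.E ≤ V := hv.2 Reg.E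
    simp only [List.length_cons] at hi
    have s1 := does_edgeBody hv p hX hY (hp p (by simp)) (by omega) hx'.left
    have hle := hx'.left.le
    have hw : (if p.1 = v.r then (if v.w = v.e then v.w else p.2) else v.w) ≤ V := by
      have := hv.2 Reg.w
      simp only [Vals.get] at *
      split_ifs <;> first | assumption | exact (hp p (by simp)).2
    have f1 := ((hv.set Reg.i (k := v.i + 1) (by omega)).set Reg.w hw).pos hle
    have s2 := ih _ _ f1 hx'.right hX hY (by simp only [Vals.set]; omega)
      (fun q hq => hp q (by simp [hq]))
    have s3 := Does.loop_ne (show v.get Reg.i ≠ v.get Reg.E by simp only [Vals.get]; omega) s1 s2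
    have e : h + (wordOf (flat (p :: ps))).length =
        h + (wordOf [p.1] ++ wordOf [p.2]).length + (wordOf (flat ps)).length := by
      rw [wordOf_flat_cons]; simp only [List.length_append]; omega
    rw [e]
    convert s3 using 1
    simp only [Vals.set]
    congr 1
    exact pick_targets_cons _ _ _ _ _

/-- The next state of the walk with preference `e`. The state `n` stands for the situation before
the beginning of a run, and `n + 1` means that there is no next state. -/
def nextState (n : ℕ) (ps es : List (ℕ × ℕ)) (e r : ℕ) : ℕ :=
  pick e (n + 1) ((if r = n then startList 0 ps else []) ++ targets r es)

/-- The numbers that describe an automaton. -/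
def descr (n : ℕ) (ps es : List (ℕ × ℕ)) : List ℕ :=
  n :: es.length :: (flat ps ++ flat es)

/-- One step of the walk: a pass over the description of the automaton. The program `go` moves the
head to its beginning. -/
def pass (go : Prog) : Prog :=
  Cmd.seq (readNum Reg.N) <| Cmd.seq (readNum Reg.E) <|
  Cmd.seq (copyTo Reg.w Reg.N) <| Cmd.seq (Cmd.act (Act.inc Reg.w)) <|
  Cmd.seq (Cmd.act (Act.clear Reg.fl)) <|
  Cmd.seq (Cmd.act (Act.clear Reg.i)) <| Cmd.seq (Cmd.loop (Test.ne Reg.i Reg.N) stateBody) <|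
  Cmd.seq (Cmd.act (Act.clear Reg.i)) <| Cmd.seq (Cmd.loop (Test.ne Reg.i Reg.E) edgeBody) <|
  Cmd.seq (Cmd.act (Act.clear Reg.i)) <| Cmd.seq (copyTo Reg.r Reg.w) <|
  Cmd.seq (Cmd.act (Act.clear Reg.w)) go

theorem pick_le {e d : ℕ} {l : List ℕ} {m : ℕ} (hd : d ≤ m) (hl : ∀ y ∈ l, y ≤ m) :
    pick e d l ≤ m := by
  induction l generalizing d with
  | nil => exact hd
  | cons y l ih =>
    refine ih (d := if d = e then d else y) ?_ (fun z hz => hl z (by simp [hz]))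
    split_ifs
    · exact hd
    · exact hl y (by simp)

theorem startList_le {i : ℕ} {l : List (ℕ × ℕ)} : ∀ y ∈ startList i l, y ≤ i + l.length := by
  induction l generalizing i with
  | nil => simp [startList]
  | cons p l ih =>
    intro y hy
    rw [startList, List.mem_append] at hy
    rcases hy with hy | hy
    · split_ifs at hy
      · simp at hy; omega
      · simp at hy
    · have := ih y hy
      simp only [List.length_cons]
      omega

theorem targets_le {r m : ℕ} {l : List (ℕ × ℕ)} (hl : ∀ p ∈ l, p.1 ≤ m ∧ p.2 ≤ m) :
    ∀ y ∈ targets r l, y ≤ m := by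
  intro y hy
  simp only [targets, List.mem_map, List.mem_filter] at hy
  obtain ⟨p, ⟨hp, _⟩, rfl⟩ := hy
  exact (hl p hp).2

theorem flagFrom_le {r i f m : ℕ} {l : List (ℕ × ℕ)} (hf : f ≤ m) (hm : 1 ≤ m) :
    flagFrom r i l f ≤ m := by
  induction l generalizing i f with
  | nil => exact hf
  | cons p l ih =>
    refine ih ?_
    split_ifs
    · exact hm
    · exact hf

end

end UnaryUFA

namespace UnaryUFA

section
variable {x : List Letter} {V : ℕ} {c d : Prog} {h h' h'' : ℕ} {v v' v'' : Vals}
-- All scratch registers are `0` before and after, so that passes can be iterated. The flag refers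
-- to the state that is left, not to the one that is entered. The strict bound on `n` leaves room
-- for the default `n + 1`, which stands for a missing successor.
theorem does_pass {n : ℕ} {ps es : List (ℕ × ℕ)} {go : Prog} (hps : ps.length = n)
    (hx : At x h (wordOf (descr n ps es))) (hn : n < V) (hE : es.length ≤ V)
    (hp : ∀ p ∈ ps, p.1 ≤ V ∧ p.2 ≤ V) (he : ∀ p ∈ es, p.1 ≤ V ∧ p.2 ≤ V)
    (hgo : ∀ k v, Fits x V k v → Does x V go k v h v)
    (hv : Fits x V h v) (hN : v.N = n) (hEv : v.E = es.length) (hX : v.X = 0) (hY : v.Y = 0)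
    (hw : v.w = 0) (hi : v.i = 0) :
    Does x V (pass go) h v h
      { v with r := nextState n ps es v.e v.r, fl := flagFrom v.r 0 ps 0 } := by
  have hx' : At x h (wordOf [n] ++ (wordOf [es.length] ++ (wordOf (flat ps) ++ wordOf (flat es)))) := by
    have : wordOf (descr n ps es) =
      wordOf [n] ++ (wordOf [es.length] ++ (wordOf (flat ps) ++ wordOf (flat es))) := by
      simp [wordOf, descr]
    rwa [this] at hx
  have hx2 := hx'.right
  have hx3 := hx2.right
  have hx4 := hx3.right
  have hle1 := hx'.left.le
  have hle2 := hx2.left.le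
  have hle3 := hx3.left.le
  have hle4 := hx4.le
  have s1 := Does.readNum hv (q := Reg.N) (by decide) hn.le hx'.left
  have f1 := (hv.set Reg.N hn.le).pos hle1
  have s2 := Does.readNum f1 (q := Reg.E) (by decide) hE hx2.left
  have f2 := (f1.set Reg.E hE).pos hle2
  have s3 := Does.copyTo f2 (q := Reg.w) (s := Reg.N) (by decide) (by decide)
  have f3 := f2.set Reg.w (k := n) hn.le
  have s4 := Does.inc f3 Reg.w (by decide) hn
  have f4 := f3.set Reg.w (k := n + 1) hn
  have s5 := Does.clear f4 Reg.fl (by decide)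
  have f5 := f4.set Reg.fl (Nat.zero_le V)
  have s6 := Does.clear f5 Reg.i (by decide)
  have f6 := f5.set Reg.i (Nat.zero_le V)
  have s7 := does_stateLoop ps _ _ f6 hx3.left hX hY (show 0 + ps.length = n by omega) hp
  obtain ⟨w7, hw7⟩ : ∃ w7, w7 = if v.r = n then pick v.e (n + 1) (startList 0 ps) else n + 1 :=
    ⟨_, rfl⟩
  obtain ⟨g7, hg7⟩ : ∃ g7, g7 = flagFrom v.r 0 ps 0 := ⟨_, rfl⟩
  have s7' := does_congr
    (v' := { v with N := n, E := es.length, i := n, w := w7, fl := g7 }) s7 rfl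
    (by rw [hw7, hg7]; rfl)
  have b7 : w7 ≤ V := by
    rw [hw7]
    split_ifs
    · refine pick_le hn (fun y hy => (startList_le y hy).trans ?_)
      omega
    · exact hn
  have f7 := (((((hv.set Reg.N hn.le).set Reg.E hE).set Reg.i (k := n) hn.le).set Reg.w b7).set
    Reg.fl (k := g7) (hg7 ▸ flagFrom_le (Nat.zero_le V) (by omega))).pos hle3
  have s8 := Does.clear f7 Reg.i (by decide)
  have f8 := f7.set Reg.i (Nat.zero_le V)
  have s9 := does_edgeLoop es _ _ f8 hx4 hX hY (show 0 + es.length = es.length by omega) he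
  obtain ⟨w9, hw9⟩ : ∃ w9, w9 = pick v.e w7 (targets v.r es) := ⟨_, rfl⟩
  have s9' := does_congr
    (v' := { v with N := n, E := es.length, i := es.length, w := w9, fl := g7 }) s9 rfl
    (by rw [hw9]; rfl)
  have b9 : w9 ≤ V := hw9 ▸ pick_le b7 (targets_le he)
  have f9 := (((((hv.set Reg.N hn.le).set Reg.E hE).set Reg.i (k := es.length) hE).set
    Reg.w b9).set Reg.fl (k := g7) (hg7 ▸ flagFrom_le (Nat.zero_le V) (by omega))).pos hle4
  have s10 := Does.clear f9 Reg.i (by decide)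
  have f10 := f9.set Reg.i (Nat.zero_le V)
  have s11 := Does.copyTo f10 (q := Reg.r) (s := Reg.w) (by decide) (by decide)
  have f11 := f10.set Reg.r b9
  have s12 := Does.clear f11 Reg.w (by decide)
  have f12 := f11.set Reg.w (Nat.zero_le V)
  have s13 := hgo _ _ f12
  refine does_congr (s1.seq (s2.seq (s3.seq (s4.seq (s5.seq (s6.seq (s7'.seq (s8.seq (s9'.seq
    (s10.seq (s11.seq (s12.seq s13)))))))))))) rfl ?_
  have e9 : w9 = nextState n ps es v.e v.r := by
    rw [hw9, hw7, nextState]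
    split_ifs <;> simp [pick, List.foldl_append]
  rw [← e9, ← hg7]
  simp only [Vals.set, hw, hi, ← hN, ← hEv]

end

end UnaryUFA

namespace UnaryUFA

section
variable {x : List Letter} {V : ℕ} {c d : Prog} {h h' h'' : ℕ} {v v' v'' : Vals}

/-! ### Acceptance of a word -/

theorem nextState_le {n m e r : ℕ} {ps es : List (ℕ × ℕ)} (hn : n < m) (hps : ps.length = n)
    (he : ∀ p ∈ es, p.1 ≤ m ∧ p.2 ≤ m) : nextState n ps es e r ≤ m := by
  refine pick_le hn ?_
  intro y hy
  rw [List.mem_append] at hy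
  rcases hy with hy | hy
  · split_ifs at hy
    · have := startList_le y hy
      omega
    · simp at hy
  · exact targets_le he y hy

/-- The walk with preference `e` after `t` passes: the state, and whether the state before was
accepting. -/
def walk (n : ℕ) (ps es : List (ℕ × ℕ)) (e t : ℕ) : ℕ × ℕ :=
  (fun s : ℕ × ℕ => (nextState n ps es e s.1, flagFrom s.1 0 ps 0))^[t] (n, 0)

theorem walk_succ (n : ℕ) (ps es : List (ℕ × ℕ)) (e t : ℕ) :
    walk n ps es e (t + 1) = (nextState n ps es e (walk n ps es e t).1,
      flagFrom (walk n ps es e t).1 0 ps 0) :=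
  Function.iterate_succ_apply' _ _ _

/-- Whether a walk with one of the first `k` preferences accepts the word of length `t`. -/
def okUpTo (n : ℕ) (ps es : List (ℕ × ℕ)) (t : ℕ) : ℕ → ℕ
  | 0 => 0
  | k + 1 => if (walk n ps es k (t + 2)).2 ≠ 0 then 1 else okUpTo n ps es t k

theorem okUpTo_ne_zero {n : ℕ} {ps es : List (ℕ × ℕ)} {t k : ℕ} :
    okUpTo n ps es t k ≠ 0 ↔ ∃ e < k, (walk n ps es e (t + 2)).2 ≠ 0 := by
  induction k with
  | zero => simp [okUpTo]
  | succ k ih =>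
    rw [okUpTo]
    by_cases hk : (walk n ps es k (t + 2)).2 ≠ 0
    · rw [if_pos hk]
      exact ⟨fun _ => ⟨k, by omega, hk⟩, fun _ => one_ne_zero⟩
    · rw [if_neg hk, ih]
      constructor
      · rintro ⟨e, h1, h2⟩; exact ⟨e, by omega, h2⟩
      · rintro ⟨e, h1, h2⟩
        rcases Nat.lt_succ_iff_lt_or_eq.1 h1 with h3 | rfl
        · exact ⟨e, h3, h2⟩
        · exact absurd h2 hk

theorem okUpTo_le (n : ℕ) (ps es : List (ℕ × ℕ)) (t k : ℕ) : okUpTo n ps es t k ≤ 1 := by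
  induction k with
  | zero => simp [okUpTo]
  | succ k ih => rw [okUpTo]; split_ifs <;> omega

/-- Simulate the walk with the preference in register `e`. -/
def tryWalk (go : Prog) : Prog :=
  Cmd.seq (copyTo Reg.r Reg.N) <| Cmd.seq (Cmd.act (Act.clear Reg.fl)) <|
  Cmd.seq (Cmd.act (Act.clear Reg.j)) <|
  Cmd.seq (Cmd.loop (Test.ne Reg.j Reg.T) (Cmd.seq (pass go) (Cmd.act (Act.inc Reg.j)))) <|
  Cmd.seq (pass go) <| Cmd.seq (pass go) <|
  Cmd.seq (Cmd.ite (Test.ne Reg.fl Reg.Z) (setOne Reg.ok) Cmd.skip) <|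
  Cmd.seq (Cmd.act (Act.clear Reg.r)) <| Cmd.seq (Cmd.act (Act.clear Reg.fl)) <|
  Cmd.act (Act.clear Reg.j)

/-- Decide whether the automaton accepts the word whose length is in register `T`. -/
def accept (go : Prog) : Prog :=
  Cmd.seq go <| Cmd.seq (Cmd.act (Act.clear Reg.ok)) <|
  Cmd.seq (readNum Reg.N) <| Cmd.seq (readNum Reg.E) <| Cmd.seq go <|
  Cmd.seq (Cmd.loop (Test.ne Reg.e Reg.N) (Cmd.seq (tryWalk go) (Cmd.act (Act.inc Reg.e)))) <|
  Cmd.seq (Cmd.act (Act.clear Reg.e)) <| Cmd.seq (Cmd.act (Act.clear Reg.N)) <|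
  Cmd.act (Act.clear Reg.E)

/-- The description of an automaton is written on the input tape from the cell `h` on, the program
`go` moves the head to this cell, and the numbers are at most `V`. -/
structure Ready (x : List Letter) (V h n : ℕ) (ps es : List (ℕ × ℕ)) (go : Prog) : Prop where
  length_eq : ps.length = n
  at_descr : At x h (wordOf (descr n ps es))
  lt : n < V
  length_le : es.length ≤ V
  le : ∀ p ∈ ps, p.1 ≤ V ∧ p.2 ≤ V
  le' : ∀ p ∈ es, p.1 ≤ V ∧ p.2 ≤ V
  does_go : ∀ k v, Fits x V k v → Does x V go k v h v

section

variable {n : ℕ} {ps es : List (ℕ × ℕ)} {go : Prog} {T B M g o : ℕ}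

theorem Ready.pos_le (R : Ready x V h n ps es go) : h ≤ x.length + 1 := by
  have := R.at_descr.le
  omega

theorem walk_le (R : Ready x V h n ps es go) (e t : ℕ) :
    (walk n ps es e t).1 ≤ V ∧ (walk n ps es e t).2 ≤ V := by
  have h0 := R.lt
  cases t with
  | zero => exact ⟨h0.le, Nat.zero_le V⟩
  | succ t =>
    rw [walk_succ]
    exact ⟨nextState_le R.lt R.length_eq R.le', flagFrom_le (Nat.zero_le V) (by omega)⟩

/-- The numbers while a walk is simulated. -/
def walkVals (n E e T B M g o r fl j : ℕ) : Vals :=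
  { N := n, E := E, e := e, T := T, B := B, M := M, good := g, ok := o, r := r, fl := fl, j := j }

theorem fits_walkVals (hh : h ≤ x.length + 1) {n E e T B M g o r fl j : ℕ}
    (h1 : n ≤ V) (h2 : E ≤ V) (h3 : e ≤ V) (h4 : T ≤ V) (h5 : B ≤ V) (h6 : M ≤ V) (h7 : g ≤ V)
    (h8 : o ≤ V) (h9 : r ≤ V) (h10 : fl ≤ V) (h11 : j ≤ V) :
    Fits x V h (walkVals n E e T B M g o r fl j) := by
  refine ⟨hh, fun q => ?_⟩
  cases q <;> simp only [Vals.get, walkVals] <;> first | assumption | exact Nat.zero_le V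

theorem does_tryWalk (R : Ready x V h n ps es go) {e : ℕ} (he : e ≤ V) (hT : T ≤ V) (hB : B ≤ V)
    (hM : M ≤ V) (hg : g ≤ V) (ho : o ≤ V) :
    Does x V (tryWalk go) h (walkVals n es.length e T B M g o 0 0 0)
      h (walkVals n es.length e T B M g
        (if (walk n ps es e (T + 2)).2 ≠ 0 then 1 else o) 0 0 0) := by
  have fit : ∀ t j, j ≤ V → Fits x V h (walkVals n es.length e T B M g o
      (walk n ps es e t).1 (walk n ps es e t).2 j) := fun t j hj =>
    fits_walkVals R.pos_le R.lt.le R.length_le he hT hB hM hg ho (walk_le R e t).1 (walk_le R e t).2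
      hj
  have one : ∀ t j, j ≤ V → Does x V (pass go) h
      (walkVals n es.length e T B M g o (walk n ps es e t).1 (walk n ps es e t).2 j) h
      (walkVals n es.length e T B M g o (walk n ps es e (t + 1)).1
        (walk n ps es e (t + 1)).2 j) := by
    intro t j hj
    refine does_congr (does_pass R.length_eq R.at_descr R.lt R.length_le R.le R.le' R.does_go
      (fit t j hj) rfl rfl rfl rfl rfl rfl) rfl ?_
    rw [walk_succ]
    rfl
  have f0 : Fits x V h (walkVals n es.length e T B M g o 0 0 0) :=
    fits_walkVals R.pos_le R.lt.le R.length_le he hT hB hM hg ho (Nat.zero_le V) (Nat.zero_le V)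
      (Nat.zero_le V)
  have s1 := Does.copyTo f0 (q := Reg.r) (s := Reg.N) (by decide) (by decide)
  have f1 := f0.set Reg.r (k := n) R.lt.le
  have s2 := Does.clear f1 Reg.fl (by decide)
  have f2 := f1.set Reg.fl (Nat.zero_le V)
  have s3 := Does.clear f2 Reg.j (by decide)
  have s4 := Does.count_loop (x := x) (V := V) (h := h) (c := pass go) (q := Reg.j) (s := Reg.T)
    (by decide) (fun t => walkVals n es.length e T B M g o (walk n ps es e t).1
      (walk n ps es e t).2 t) T (fun t ht => fit t t (ht.trans hT)) (fun t _ => rfl)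
      (fun t _ => rfl) (fun t ht => one t t (ht.le.trans hT))
  -- Two passes more than there are letters: the first pass only selects an initial state, and the
  -- acceptance of a state is recorded by the pass that leaves it.
  have s5 := one T T hT
  have s6 := one (T + 1) T hT
  have f6 := fit (T + 2) T hT
  obtain ⟨o', ho'⟩ : ∃ o', o' = if (walk n ps es e (T + 2)).2 ≠ 0 then 1 else o := ⟨_, rfl⟩
  rw [← ho']
  have s7 : Does x V (Cmd.ite (Test.ne Reg.fl Reg.Z) (setOne Reg.ok) Cmd.skip) h
      (walkVals n es.length e T B M g o (walk n ps es e (T + 2)).1 (walk n ps es e (T + 2)).2 T) h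
      (walkVals n es.length e T B M g o' (walk n ps es e (T + 2)).1
        (walk n ps es e (T + 2)).2 T) := by
    by_cases hf : (walk n ps es e (T + 2)).2 = 0
    · rw [ho', if_neg (by simpa using hf)]
      exact Does.ite_eq (show (walkVals n es.length e T B M g o (walk n ps es e (T + 2)).1
        (walk n ps es e (T + 2)).2 T).get Reg.fl = 0 from hf) (Does.skip f6)
    · rw [ho', if_pos hf]
      exact Does.ite_ne (show (walkVals n es.length e T B M g o (walk n ps es e (T + 2)).1
        (walk n ps es e (T + 2)).2 T).get Reg.fl ≠ 0 from hf)
        (Does.setOne f6 (q := Reg.ok) (by decide) (by have := R.lt; omega))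
  have f7 : Fits x V h (walkVals n es.length e T B M g o' (walk n ps es e (T + 2)).1
      (walk n ps es e (T + 2)).2 T) :=
    fits_walkVals R.pos_le R.lt.le R.length_le he hT hB hM hg
      (by rw [ho']; have := R.lt; split_ifs <;> omega) (walk_le R e _).1 (walk_le R e _).2 hT
  have s8 := Does.clear f7 Reg.r (by decide)
  have f8 := f7.set Reg.r (Nat.zero_le V)
  have s9 := Does.clear f8 Reg.fl (by decide)
  have f9 := f8.set Reg.fl (Nat.zero_le V)
  have s10 := Does.clear f9 Reg.j (by decide)
  exact s1.seq (s2.seq (s3.seq (s4.seq (s5.seq (s6.seq (s7.seq (s8.seq (s9.seq s10))))))))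

/-- The numbers in the main loop. -/
def mainVals (T B M g o : ℕ) : Vals := { T := T, B := B, M := M, good := g, ok := o }

theorem fits_mainVals (hh : h ≤ x.length + 1) (h4 : T ≤ V) (h5 : B ≤ V) (h6 : M ≤ V) (h7 : g ≤ V)
    (h8 : o ≤ V) : Fits x V h (mainVals T B M g o) := by
  refine ⟨hh, fun q => ?_⟩
  cases q <;> simp only [Vals.get, mainVals] <;> first | assumption | exact Nat.zero_le V

/-- The header is read once in advance because the loop over the preferences needs the number of
states; afterwards everything but `ok` is restored. -/
theorem does_accept (R : Ready x V h n ps es go) {k : ℕ} (hk : k ≤ x.length + 1) (hT : T ≤ V)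
    (hB : B ≤ V) (hM : M ≤ V) (hg : g ≤ V) (ho : o ≤ V) :
    Does x V (accept go) k (mainVals T B M g o) h (mainVals T B M g (okUpTo n ps es T n)) := by
  have hV : 1 ≤ V := by have := R.lt; omega
  have hx : At x h (wordOf [n] ++ (wordOf [es.length] ++ wordOf (flat ps ++ flat es))) := by
    have : wordOf (descr n ps es) = wordOf [n] ++ (wordOf [es.length] ++
      wordOf (flat ps ++ flat es)) := by simp [wordOf, descr]
    exact this ▸ R.at_descr
  have hle1 := hx.left.le
  have hle2 := hx.right.left.le
  have hok : ∀ e, okUpTo n ps es T e ≤ V := fun e => (okUpTo_le n ps es T e).trans hV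
  have fk : Fits x V k (mainVals T B M g o) := fits_mainVals hk hT hB hM hg ho
  have s1 := R.does_go k _ fk
  have f1 := fk.pos R.pos_le
  have s2 := Does.clear f1 Reg.ok (by decide)
  have f2 := f1.set Reg.ok (Nat.zero_le V)
  have s3 := Does.readNum f2 (q := Reg.N) (by decide) R.lt.le hx.left
  have f3 := (f2.set Reg.N R.lt.le).pos hle1
  have s4 := Does.readNum f3 (q := Reg.E) (by decide) R.length_le hx.right.left
  have f4 := (f3.set Reg.E R.length_le).pos hle2
  have s5 := R.does_go _ _ f4
  have s6 := Does.count_loop (x := x) (V := V) (h := h) (c := tryWalk go) (q := Reg.e) (s := Reg.N)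
    (by decide) (fun e => walkVals n es.length e T B M g (okUpTo n ps es T e) 0 0 0) n
    (fun e he => fits_walkVals R.pos_le R.lt.le R.length_le (he.trans R.lt.le) hT hB hM hg
      (hok e) (Nat.zero_le V) (Nat.zero_le V) (Nat.zero_le V))
    (fun t _ => rfl) (fun t _ => rfl)
    (fun e he => does_tryWalk R (he.le.trans R.lt.le) hT hB hM hg (hok e))
  have f6 := fits_walkVals R.pos_le R.lt.le R.length_le R.lt.le hT hB hM hg (hok n)
    (Nat.zero_le V) (Nat.zero_le V) (Nat.zero_le V)
  have s7 := Does.clear f6 Reg.e (by decide)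
  have f7 := f6.set Reg.e (Nat.zero_le V)
  have s8 := Does.clear f7 Reg.N (by decide)
  have f8 := f7.set Reg.N (Nat.zero_le V)
  have s9 := Does.clear f8 Reg.E (by decide)
  exact s1.seq (s2.seq (s3.seq (s4.seq (s5.seq (s6.seq (s7.seq (s8.seq s9)))))))

end

/-! ### Moving the head to the descriptions -/

/-- The scanned cell is not the left end marker. -/
def notLeftEnd : InputCell Letter → Bool
  | InputCell.leftEnd => false
  | _ => true

/-- The scanned cell is not the right end marker. -/
def notRightEnd : InputCell Letter → Bool
  | InputCell.rightEnd => false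
  | _ => true

/-- The scanned cell does not contain a semicolon. -/
def notSemicolon : InputCell Letter → Bool
  | InputCell.letter Letter.semicolon => false
  | _ => true

/-- Go to the first letter. -/
def goFirst : Prog :=
  Cmd.seq (Cmd.loop (Test.letter notLeftEnd) (Cmd.act Act.left)) (Cmd.act Act.right)

/-- Go to the letter behind the first semicolon. -/
def goSecond : Prog :=
  Cmd.seq goFirst <|
  Cmd.seq (Cmd.loop (Test.letter notSemicolon) (Cmd.act Act.right)) (Cmd.act Act.right)

theorem does_goFirst (k : ℕ) (v : Vals) (hv : Fits x V k v) : Does x V goFirst k v 1 v := by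
  have key : ∀ k, k ≤ x.length + 1 →
      Does x V (Cmd.loop (Test.letter notLeftEnd) (Cmd.act Act.left)) k v 0 v := by
    intro k
    induction k with
    | zero => intro hk; exact Does.loop_not_letter (hv.pos hk) rfl
    | succ k ih =>
      intro hk
      refine Does.loop_letter ?_ (Does.left (hv.pos hk)) (ih (by omega))
      simp only [inputCell]
      cases x[k]? <;> rfl
  exact (key k hv.1).seq (Does.right (hv.pos (Nat.zero_le _)) (Nat.zero_le _))

theorem does_goSecond {u w : List Letter} (hu : Letter.semicolon ∉ u)
    (hx : x = u ++ Letter.semicolon :: w) (k : ℕ) (v : Vals) (hv : Fits x V k v) :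
    Does x V goSecond k v (u.length + 2) v := by
  have hlen : x.length = u.length + w.length + 1 := by simp [hx]; omega
  have key : ∀ j ≤ u.length, Does x V (Cmd.loop (Test.letter notSemicolon) (Cmd.act Act.right))
      (u.length - j + 1) v (u.length + 1) v := by
    intro j
    induction j with
    | zero =>
      intro _
      refine Does.loop_not_letter (hv.pos (by omega)) ?_
      simp [inputCell, hx, notSemicolon]
    | succ j ih =>
      intro hj
      refine Does.loop_letter ?_ (Does.right (hv.pos (by omega)) (by omega))
        (by rw [show u.length - (j + 1) + 1 + 1 = u.length - j + 1 by omega]; exact ih (by omega))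
      have hl : u.length - (j + 1) < u.length := by omega
      have : x[u.length - (j + 1)]? = some u[u.length - (j + 1)] := by
        rw [hx, List.getElem?_append_left hl, List.getElem?_eq_getElem hl]
      simp only [inputCell, this]
      have hm : u[u.length - (j + 1)] ∈ u := List.getElem_mem hl
      cases hc : u[u.length - (j + 1)] with
      | bit b => rfl
      | comma => rfl
      | semicolon => exact absurd (hc ▸ hm) hu
  have k1 := key u.length le_rfl
  rw [Nat.sub_self] at k1
  exact (does_goFirst k v hv).seq (k1.seq (Does.right (hv.pos (by omega)) (by omega)))

/-! ### The main program -/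

/-- Compute the square of the number of cells of the input tape without the right end marker. -/
def square : Prog :=
  Cmd.seq (Cmd.loop (Test.letter notRightEnd) (Cmd.seq (Cmd.act (Act.inc Reg.M)) (Cmd.act Act.right)))
  <| Cmd.seq (Cmd.loop (Test.ne Reg.i Reg.M) (Cmd.seq
      (Cmd.seq (Cmd.loop (Test.ne Reg.j Reg.M) (Cmd.seq (Cmd.act (Act.inc Reg.B))
        (Cmd.act (Act.inc Reg.j)))) (Cmd.act (Act.clear Reg.j)))
      (Cmd.act (Act.inc Reg.i)))) (Cmd.act (Act.clear Reg.i))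

/-- The cells counted are the left end marker and the letters, which gives `x.length + 1`;
multiplication is done by two nested counting loops. The square is what inclusion requires, where
the lengths to inspect are bounded by a product of two numbers of states. -/
theorem does_square (hV : (x.length + 1) ^ 2 ≤ V) :
    Does x V square 0 {} (x.length + 1) (mainVals 0 ((x.length + 1) ^ 2) (x.length + 1) 0 0) := by
  have hV1 : x.length + 1 ≤ V := le_trans (by nlinarith) hV
  obtain ⟨m, hm⟩ : ∃ m, m = x.length + 1 := ⟨_, rfl⟩
  have fit : ∀ h B i j, h ≤ m → B ≤ V → i ≤ V → j ≤ V →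
      Fits x V h { M := m, B := B, i := i, j := j } := by
    intro h B i j h1 h2 h3 h4
    refine ⟨hm ▸ h1, fun q => ?_⟩
    cases q <;> simp only [Vals.get] <;> first | assumption | omega
  have s1 : ∀ k ≤ m, Does x V (Cmd.loop (Test.letter notRightEnd)
      (Cmd.seq (Cmd.act (Act.inc Reg.M)) (Cmd.act Act.right))) (m - k) { M := m - k }
        m { M := m } := by
    intro k
    have fit' : ∀ h k, h ≤ m → k ≤ m → Fits x V h { M := k } := by
      intro h k h1 h2
      refine ⟨hm ▸ h1, fun q => ?_⟩
      cases q <;> simp only [Vals.get] <;> omega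
    induction k with
    | zero =>
      intro _
      refine Does.loop_not_letter (fit' _ _ (by omega) (by omega)) ?_
      rw [Nat.sub_zero, hm]
      simp [inputCell, notRightEnd]
    | succ k ih =>
      intro hk
      obtain ⟨u, hu⟩ : ∃ u, u = m - (k + 1) := ⟨_, rfl⟩
      have hu1 : m - k = u + 1 := by omega
      have ih' := ih (by omega)
      rw [hu1] at ih'
      rw [← hu]
      refine Does.loop_letter ?_ ((Does.inc (fit' u u (by omega) (by omega)) Reg.M (by decide)
        (by simp only [Vals.get]; omega)).seq
        (Does.right (fit' u (u + 1) (by omega) (by omega)) (by omega))) ih'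
      cases u with
      | zero => rfl
      | succ u =>
        simp only [inputCell]
        rw [List.getElem?_eq_getElem (by omega)]
        rfl
  have hmm : m * m ≤ V := by rw [hm, ← sq]; exact hV
  have s2 : ∀ i < m, Does x V (Cmd.loop (Test.ne Reg.j Reg.M) (Cmd.seq (Cmd.act (Act.inc Reg.B))
        (Cmd.act (Act.inc Reg.j)))) m { M := m, B := i * m, i := i }
        m { M := m, B := (i + 1) * m, i := i, j := m } := by
    intro i hi
    have hb : (i + 1) * m ≤ V := (Nat.mul_le_mul_right m hi).trans hmm
    have hb' : (i + 1) * m = i * m + m := by ring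
    rw [hb'] at hb ⊢
    refine Does.count_loop (x := x) (V := V) (by decide)
      (fun j => { M := m, B := i * m + j, i := i, j := j }) m
      (fun j hj => fit _ _ _ _ le_rfl (by omega) (by omega) (by omega)) (fun _ _ => rfl)
      (fun _ _ => rfl) ?_
    intro j hj
    exact Does.inc (fit m (i * m + j) i j le_rfl (by omega) (by omega) (by omega)) Reg.B (by decide)
      (by simp only [Vals.get]; omega)
  have s3 := Does.count_loop (x := x) (V := V) (h := m) (q := Reg.i) (s := Reg.M)
    (c := Cmd.seq (Cmd.loop (Test.ne Reg.j Reg.M) (Cmd.seq (Cmd.act (Act.inc Reg.B))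
        (Cmd.act (Act.inc Reg.j)))) (Cmd.act (Act.clear Reg.j))) (by decide)
    (fun i => { M := m, B := i * m, i := i }) m
    (fun i hi => fit _ _ _ _ le_rfl ((Nat.mul_le_mul_right m hi).trans hmm) (by omega) (by omega))
    (fun _ _ => rfl) (fun _ _ => rfl)
    (fun i hi => (s2 i hi).seq (Does.clear (fit _ _ _ _ le_rfl
      ((Nat.mul_le_mul_right m hi).trans hmm) (by omega) (by omega)) Reg.j (by decide)))
  have s4 := Does.clear (fit m (m * m) m 0 le_rfl hmm (by omega) (by omega)) Reg.i (by decide)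
  have t1 := s1 m le_rfl
  rw [Nat.sub_self] at t1
  rw [← hm, sq]
  simp only [Nat.zero_mul] at s3
  exact t1.seq (s3.seq s4)

/-- Perform a check for all numbers below the square of the length of the input tape; the register
`good` tells whether all checks were successful. -/
def mainProg (check : Prog) : Prog :=
  Cmd.seq square <| Cmd.seq (setOne Reg.good) <| Cmd.seq goFirst <|
  Cmd.loop (Test.ne Reg.T Reg.B) (Cmd.seq check (Cmd.act (Act.inc Reg.T)))

/-- Whether the numbers below `t` have the property `P`. -/
def goodUpTo (P : ℕ → Prop) [DecidablePred P] : ℕ → ℕ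
  | 0 => 1
  | t + 1 => if P t then goodUpTo P t else 0

theorem goodUpTo_ne_zero {P : ℕ → Prop} [DecidablePred P] {t : ℕ} :
    goodUpTo P t ≠ 0 ↔ ∀ u < t, P u := by
  induction t with
  | zero => simp [goodUpTo]
  | succ t ih =>
    rw [goodUpTo]
    by_cases h : P t
    · rw [if_pos h, ih]
      constructor
      · intro h1 u hu
        rcases Nat.lt_succ_iff_lt_or_eq.1 hu with h3 | rfl
        · exact h1 u h3
        · exact h
      · intro h1 u hu; exact h1 u (by omega)
    · rw [if_neg h]
      exact ⟨fun h1 => absurd rfl h1, fun h1 => absurd (h1 t (by omega)) h⟩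

theorem goodUpTo_le (P : ℕ → Prop) [DecidablePred P] (t : ℕ) : goodUpTo P t ≤ 1 := by
  induction t with
  | zero => simp [goodUpTo]
  | succ t ih => rw [goodUpTo]; split_ifs <;> omega

theorem does_mainProg (P : ℕ → Prop) [DecidablePred P] {check : Prog}
    (hV : (x.length + 1) ^ 2 ≤ V)
    (hc : ∀ T B M g, T ≤ V → B ≤ V → M ≤ V → g ≤ V → Does x V check 1 (mainVals T B M g 0)
      1 (mainVals T B M (if P T then g else 0) 0)) :
    Does x V (mainProg check) 0 {} 1 (mainVals ((x.length + 1) ^ 2) ((x.length + 1) ^ 2)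
      (x.length + 1) (goodUpTo P ((x.length + 1) ^ 2)) 0) := by
  have hV1 : x.length + 1 ≤ V := le_trans (by nlinarith) hV
  have hg : ∀ t, goodUpTo P t ≤ V := fun t => (goodUpTo_le P t).trans (by omega)
  have s1 := does_square hV
  have f1 : Fits x V (x.length + 1) (mainVals 0 ((x.length + 1) ^ 2) (x.length + 1) 0 0) :=
    fits_mainVals le_rfl (Nat.zero_le V) hV hV1 (Nat.zero_le V) (Nat.zero_le V)
  have s2 := Does.setOne f1 (q := Reg.good) (by decide) (by omega)
  have f2 := f1.set Reg.good (k := 1) (by omega)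
  have s3 := does_goFirst _ _ f2
  have s4 := Does.count_loop (x := x) (V := V) (h := 1) (q := Reg.T) (s := Reg.B) (c := check)
    (by decide)
    (fun t => mainVals t ((x.length + 1) ^ 2) (x.length + 1) (goodUpTo P t) 0) ((x.length + 1) ^ 2)
    (fun t ht => fits_mainVals (by omega) (ht.trans hV) hV hV1 (hg t) (Nat.zero_le V))
    (fun _ _ => rfl) (fun _ _ => rfl)
    (fun t ht => hc t _ _ _ (ht.le.trans hV) hV hV1 (hg t))
  exact s1.seq (s2.seq (s3.seq s4))

/-- Check that the first automaton accepts. -/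
def checkFirst : Prog :=
  Cmd.seq (accept goFirst) <|
  Cmd.seq (Cmd.ite (Test.ne Reg.ok Reg.Z) Cmd.skip (Cmd.act (Act.clear Reg.good))) <|
  Cmd.seq (Cmd.act (Act.clear Reg.ok)) goFirst

/-- Check that the second automaton accepts if the first one accepts. -/
def checkBoth : Prog :=
  Cmd.seq (accept goFirst) <|
  Cmd.seq (Cmd.ite (Test.ne Reg.ok Reg.Z) (Cmd.seq (accept goSecond)
    (Cmd.ite (Test.ne Reg.ok Reg.Z) Cmd.skip (Cmd.act (Act.clear Reg.good)))) Cmd.skip) <|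
  Cmd.seq (Cmd.act (Act.clear Reg.ok)) goFirst

theorem does_checkFirst {n : ℕ} {ps es : List (ℕ × ℕ)} (R : Ready x V 1 n ps es goFirst)
    {T B M g : ℕ} (hT : T ≤ V) (hB : B ≤ V) (hM : M ≤ V) (hg : g ≤ V) :
    Does x V checkFirst 1 (mainVals T B M g 0) 1
      (mainVals T B M (if okUpTo n ps es T n ≠ 0 then g else 0) 0) := by
  have hV : 1 ≤ V := by have := R.lt; omega
  have s1 := does_accept R R.pos_le hT hB hM hg (Nat.zero_le V)
  have f1 : ∀ k o, k ≤ V → o ≤ 1 → Fits x V 1 (mainVals T B M k o) := fun k o hk ho =>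
    fits_mainVals R.pos_le hT hB hM hk (ho.trans hV)
  obtain ⟨o, ho⟩ : ∃ o, o = okUpTo n ps es T n := ⟨_, rfl⟩
  have ho1 : o ≤ 1 := ho ▸ okUpTo_le _ _ _ _ _
  rw [← ho] at s1 ⊢
  have s2 : Does x V (Cmd.ite (Test.ne Reg.ok Reg.Z) Cmd.skip (Cmd.act (Act.clear Reg.good)))
      1 (mainVals T B M g o) 1 (mainVals T B M (if o ≠ 0 then g else 0) o) := by
    by_cases h0 : o = 0
    · rw [if_neg (by simpa using h0)]
      exact Does.ite_eq (show (mainVals T B M g o).get Reg.ok = 0 from h0)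
        (Does.clear (f1 g o hg ho1) Reg.good (by decide))
    · rw [if_pos h0]
      exact Does.ite_ne (show (mainVals T B M g o).get Reg.ok ≠ 0 from h0)
        (Does.skip (f1 g o hg ho1))
  have hg' : (if o ≠ 0 then g else 0) ≤ V := by split_ifs <;> omega
  have s3 := Does.clear (f1 _ o hg' ho1) Reg.ok (by decide)
  have s4 := does_goFirst _ _ (f1 _ 0 hg' (by omega))
  exact s1.seq (s2.seq (s3.seq s4))

theorem does_checkBoth {n n' : ℕ} {ps es ps' es' : List (ℕ × ℕ)}
    (R : Ready x V 1 n ps es goFirst) (R' : Ready x V h n' ps' es' goSecond)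
    {T B M g : ℕ} (hT : T ≤ V) (hB : B ≤ V) (hM : M ≤ V) (hg : g ≤ V) :
    Does x V checkBoth 1 (mainVals T B M g 0) 1
      (mainVals T B M (if okUpTo n ps es T n ≠ 0 → okUpTo n' ps' es' T n' ≠ 0 then g else 0) 0) := by
  have hV : 1 ≤ V := by have := R.lt; omega
  have s1 := does_accept R R.pos_le hT hB hM hg (Nat.zero_le V)
  have f1 : ∀ h k o, h ≤ x.length + 1 → k ≤ V → o ≤ 1 → Fits x V h (mainVals T B M k o) :=
    fun h k o hh hk ho => fits_mainVals hh hT hB hM hk (ho.trans hV)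
  obtain ⟨o, ho⟩ : ∃ o, o = okUpTo n ps es T n := ⟨_, rfl⟩
  obtain ⟨o', ho'⟩ : ∃ o', o' = okUpTo n' ps' es' T n' := ⟨_, rfl⟩
  have ho1 : o ≤ 1 := ho ▸ okUpTo_le _ _ _ _ _
  have ho1' : o' ≤ 1 := ho' ▸ okUpTo_le _ _ _ _ _
  have s2 := does_accept R' R.pos_le hT hB hM hg (ho1.trans hV)
  rw [← ho] at s1 ⊢
  rw [← ho'] at s2 ⊢
  obtain ⟨g', hg'⟩ : ∃ g', g' = if o ≠ 0 → o' ≠ 0 then g else 0 := ⟨_, rfl⟩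
  have hgV : g' ≤ V := by rw [hg']; split_ifs <;> omega
  rw [← hg']
  -- The two branches leave the head and `ok` in different conditions. These are left unspecified,
  -- since the last commands of the check reset both.
  have s3 : ∃ k u, k ≤ x.length + 1 ∧ u ≤ 1 ∧ Does x V
      (Cmd.ite (Test.ne Reg.ok Reg.Z) (Cmd.seq (accept goSecond)
        (Cmd.ite (Test.ne Reg.ok Reg.Z) Cmd.skip (Cmd.act (Act.clear Reg.good)))) Cmd.skip)
      1 (mainVals T B M g o) k (mainVals T B M g' u) := by
    by_cases h0 : o = 0
    · refine ⟨1, o, R.pos_le, ho1, ?_⟩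
      rw [hg', if_pos (fun h => absurd h0 h)]
      exact Does.ite_eq (show (mainVals T B M g o).get Reg.ok = 0 from h0)
        (Does.skip (f1 1 g o R.pos_le hg ho1))
    · refine ⟨h, o', R'.pos_le, ho1', ?_⟩
      refine Does.ite_ne (show (mainVals T B M g o).get Reg.ok ≠ 0 from h0) (s2.seq ?_)
      by_cases h1 : o' = 0
      · rw [hg', if_neg (fun h => h h0 h1)]
        exact Does.ite_eq (show (mainVals T B M g o').get Reg.ok = 0 from h1)
          (Does.clear (f1 h g o' R'.pos_le hg ho1') Reg.good (by decide))
      · rw [hg', if_pos (fun _ => h1)]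
        exact Does.ite_ne (show (mainVals T B M g o').get Reg.ok ≠ 0 from h1)
          (Does.skip (f1 h g o' R'.pos_le hg ho1'))
  obtain ⟨k, u, hk, hu, s3⟩ := s3
  have s4 := Does.clear (f1 k g' u hk hgV hu) Reg.ok (by decide)
  have s5 := does_goFirst _ _ (f1 k g' 0 hk hgV (by omega))
  exact s1.seq (s3.seq (s4.seq s5))

end

end UnaryUFA

/-! ### Disjoint periodic sets and unambiguous cycles -/

namespace UnaryUFA

section

/-! ### Sums of periodic functions -/

/-- A sum of periodic functions that vanishes on as many consecutive numbers as the sum of the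
periods vanishes everywhere. -/
theorem sum_periodic_eq_zero {ι : Type*} [DecidableEq ι] (S : Finset ι) (p : ι → ℕ)
    (hp : ∀ i ∈ S, 0 < p i) : ∀ f : ι → ℕ → ℤ, (∀ i ∈ S, ∀ k, f i (k + p i) = f i k) →
    (∀ k < ∑ i ∈ S, p i, ∑ i ∈ S, f i k = 0) → ∀ k, ∑ i ∈ S, f i k = 0 := by
  induction S using Finset.induction_on with
  | empty => intro f _ _ k; simp
  | insert a S ha ih =>
    intro f hf hz
    have hpa : 0 < p a := hp a (by simp)
    -- The difference with shift `p a` cancels `f a` and keeps the other periods. It vanishes on a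
    -- window shorter by `p a`, which is just enough for the induction hypothesis.
    have h1 : ∀ k, ∑ i ∈ S, (f i (k + p a) - f i k) = 0 := by
      refine ih (fun i hi => hp i (by simp [hi])) (fun i k => f i (k + p a) - f i k) ?_ ?_
      · intro i hi k
        have e1 := hf i (by simp [hi]) k
        have e2 := hf i (by simp [hi]) (k + p a)
        rw [e1, ← e2, Nat.add_right_comm]
      · intro k hk
        have e1 := hz k (by rw [Finset.sum_insert ha]; omega)
        have e2 := hz (k + p a) (by rw [Finset.sum_insert ha]; omega)
        rw [Finset.sum_insert ha] at e1 e2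
        have e3 := hf a (by simp) k
        simp only [Finset.sum_sub_distrib]
        omega
    -- Hence the whole sum has period `p a`, and it vanishes on the first `p a` numbers.
    intro k
    induction k using Nat.strong_induction_on with
    | _ k ihk =>
      by_cases hk : k < p a
      · exact hz k (by rw [Finset.sum_insert ha]; omega)
      · obtain ⟨l, rfl⟩ := Nat.exists_eq_add_of_le' (not_lt.1 hk)
        have e0 := ihk l (by omega)
        have e1 := h1 l
        have e3 := hf a (by simp) l
        rw [Finset.sum_insert ha] at e0 ⊢
        rw [Finset.sum_sub_distrib] at e1
        omega

/-- Pairwise exclusive periodic predicates that cover one more number than the sum of the periods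
cover all numbers. -/
theorem exists_of_window {c : ℕ} (p : Fin c → ℕ) (hp : ∀ i, 0 < p i) (C : Fin c → ℕ → Prop)
    (hC : ∀ i k, C i (k + p i) ↔ C i k) (h1 : ∀ i j k, C i k → C j k → i = j)
    (hw : ∀ k ≤ ∑ i, p i, ∃ i, C i k) (k : ℕ) : ∃ i, C i k := by
  classical
  -- The additional index `none` carries the constant `-1` with period `1`, which accounts for the
  -- one additional number in the window. Exclusiveness makes the indicator functions add up to
  -- exactly `1` there.
  have key := sum_periodic_eq_zero (Finset.univ : Finset (Option (Fin c)))
    (fun o => o.elim 1 p) (by rintro (_ | i) _ <;> simp [hp])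
    (fun o k => o.elim (-1) (fun i => if C i k then 1 else 0))
    (by rintro (_ | i) _ k <;> simp [hC]) (by
      intro k hk
      simp only [Fintype.sum_option, Option.elim] at hk ⊢
      obtain ⟨i, hi⟩ := hw k (by omega)
      rw [Finset.sum_eq_single i]
      · simp [hi]
      · intro j _ hj
        rw [if_neg (fun h => hj (h1 j i k h hi))]
      · simp) k
  simp only [Fintype.sum_option, Option.elim] at key
  by_contra hn
  push Not at hn
  simp [hn] at key

/-! ### Automata in Chrobak normal form -/

/-- Chrobak normal form, with the isomorphism. -/
structure Chrobak {σ : Type} (M : NFA Unit σ) (s c : ℕ) (p : Fin c → ℕ) where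
  pos : ∀ i, 0 < p i
  e : StemCycles s c p ≃ σ
  start : ∀ v, e v ∈ M.start ↔ v.IsStart
  step : ∀ v w, e w ∈ M.step (e v) () ↔ v.Edge w

theorem IsChrobak.exists_chrobak {σ : Type} {M : NFA Unit σ} (h : IsChrobak M) :
    ∃ (s c : ℕ) (p : Fin c → ℕ), Nonempty (Chrobak M s c p) := by
  obtain ⟨s, c, p, h1, e, h2, h3⟩ := h
  exact ⟨s, c, p, ⟨⟨h1, e, h2, h3⟩⟩⟩

/-- The state `v` can be reached by a word of length `t`. -/
def StemCycles.ReachedAt {s c : ℕ} {p : Fin c → ℕ} (t : ℕ) : StemCycles s c p → Prop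
  | Sum.inl u => u.val = t
  | Sum.inr ⟨i, j⟩ => s ≤ t ∧ j.val = (t - s) % p i

namespace Chrobak

variable {σ : Type} {M : NFA Unit σ} {s c : ℕ} {p : Fin c → ℕ} (K : Chrobak M s c p)

/-- The state `k` steps after the distinguished state of the cycle `i`. -/
def cyc (i : Fin c) (k : ℕ) : StemCycles s c p := Sum.inr ⟨i, ⟨k % p i, Nat.mod_lt _ (K.pos i)⟩⟩

theorem isStart_iff_reachedAt {s c : ℕ} {p : Fin c → ℕ} (v : StemCycles s c p) : v.IsStart ↔ v.ReachedAt 0 := by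
  rcases v with u | ⟨i, j⟩
  · exact Iff.rfl
  · simp [StemCycles.IsStart, StemCycles.ReachedAt]

include K in
-- All cycles are entered at the same time `s`, so the time elapsed since then determines the
-- position on each of them. At the moment of entry, `t + 1 - s` is `0` and the position is the
-- distinguished state.
theorem reachedAt_succ (t : ℕ) (v : StemCycles s c p) :
    (∃ u : StemCycles s c p, u.ReachedAt t ∧ u.Edge v) ↔ v.ReachedAt (t + 1) := by
  constructor
  · rintro ⟨u | ⟨i, j⟩, h1, h2⟩ <;> rcases v with u' | ⟨i', j'⟩ <;>
      simp only [StemCycles.ReachedAt, StemCycles.Edge] at h1 h2 ⊢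
    · omega
    · have : t + 1 - s = 0 := by omega
      rw [this, Nat.zero_mod]
      omega
    · obtain ⟨rfl, h2⟩ := h2
      refine ⟨by omega, ?_⟩
      rw [h2, h1.2, Nat.mod_add_mod, Nat.sub_add_comm h1.1]
  · rcases v with u' | ⟨i', j'⟩ <;> intro h
    · simp only [StemCycles.ReachedAt] at h
      exact ⟨Sum.inl ⟨t, by omega⟩, rfl, h⟩
    · simp only [StemCycles.ReachedAt] at h
      by_cases hs : s ≤ t
      · refine ⟨K.cyc i' (t - s), ⟨hs, rfl⟩, rfl, ?_⟩
        simp only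
        rw [h.2, Nat.mod_add_mod, Nat.sub_add_comm hs]
      · refine ⟨Sum.inl ⟨t, by omega⟩, rfl, ?_⟩
        have : t + 1 - s = 0 := by omega
        simp only [StemCycles.Edge]
        rw [h.2, this, Nat.zero_mod]
        omega

theorem mem_eval (w : List Unit) (v : StemCycles s c p) :
    K.e v ∈ M.eval w ↔ v.ReachedAt w.length := by
  induction w using List.reverseRecOn generalizing v with
  | nil => rw [NFA.eval_nil, K.start, isStart_iff_reachedAt]; rfl
  | append_singleton w a ih =>
    rw [NFA.eval_append_singleton, NFA.mem_stepSet, List.length_append, List.length_singleton,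
      ← K.reachedAt_succ]
    constructor
    · rintro ⟨q, h1, h2⟩
      obtain ⟨u, rfl⟩ := K.e.surjective q
      exact ⟨u, (ih u).1 h1, (K.step u v).1 h2⟩
    · rintro ⟨u, h1, h2⟩
      exact ⟨K.e u, (ih u).2 h1, (K.step u v).2 h2⟩

theorem mem_accepts (w : List Unit) :
    w ∈ M.accepts ↔ ∃ v, K.e v ∈ M.accept ∧ v.ReachedAt w.length := by
  rw [NFA.mem_accepts]
  constructor
  · rintro ⟨q, h1, h2⟩
    obtain ⟨v, rfl⟩ := K.e.surjective q
    exact ⟨v, h1, (K.mem_eval w v).1 h2⟩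
  · rintro ⟨v, h1, h2⟩
    exact ⟨K.e v, h1, (K.mem_eval w v).2 h2⟩

theorem mem_accepts_of_lt {w : List Unit} (hw : w.length < s) :
    w ∈ M.accepts ↔ K.e (Sum.inl ⟨w.length, hw⟩) ∈ M.accept := by
  rw [K.mem_accepts]
  constructor
  · rintro ⟨u | ⟨i, j⟩, h1, h2⟩
    · have : u = ⟨w.length, hw⟩ := Fin.ext h2
      rwa [← this]
    · exact absurd h2.1 (by omega)
  · exact fun h => ⟨_, h, rfl⟩

theorem mem_accepts_of_le {w : List Unit} (hw : s ≤ w.length) :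
    w ∈ M.accepts ↔ ∃ i, K.e (K.cyc i (w.length - s)) ∈ M.accept := by
  rw [K.mem_accepts]
  constructor
  · rintro ⟨u | ⟨i, j⟩, h1, h2⟩
    · have := u.isLt
      simp only [StemCycles.ReachedAt] at h2
      omega
    · refine ⟨i, ?_⟩
      have : j = ⟨(w.length - s) % p i, Nat.mod_lt _ (K.pos i)⟩ := Fin.ext h2.2
      rw [this] at h1
      exact h1
  · rintro ⟨i, h⟩
    exact ⟨_, h, hw, rfl⟩

theorem cyc_add (i : Fin c) (k : ℕ) : K.cyc i (k + p i) = K.cyc i k := by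
  simp [cyc]

/-- The state at the time `t` of the run that enters the cycle `i`. -/
def path (i : Fin c) (t : ℕ) : StemCycles s c p :=
  if h : t < s then Sum.inl ⟨t, h⟩ else K.cyc i (t - s)

theorem path_isStart (i : Fin c) : (K.path i 0).IsStart := by
  unfold path
  split_ifs with h
  · rfl
  · exact ⟨by omega, by simp⟩

theorem path_edge (i : Fin c) (t : ℕ) : (K.path i t).Edge (K.path i (t + 1)) := by
  unfold path
  split_ifs with h h' h'
  · rfl
  · refine ⟨show t + 1 = s by omega, ?_⟩
    have : t + 1 - s = 0 := by omega
    simp [this]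
  · omega
  · refine ⟨rfl, ?_⟩
    simp only
    rw [Nat.mod_add_mod, Nat.sub_add_comm (by omega)]

/-- The paths along the stem into the cycles `i` and `j` are accepting runs on the same word of
length `s + k`. They coincide, so their last states lie on the same cycle. -/
theorem eq_of_unambiguous (hM : Unambiguous M) {i j : Fin c} {k : ℕ}
    (hi : K.e (K.cyc i k) ∈ M.accept) (hj : K.e (K.cyc j k) ∈ M.accept) : i = j := by
  have run : ∀ i, K.e (K.cyc i k) ∈ M.accept →
      IsAcceptingRun M (List.replicate (s + k) ()) (fun t => K.e (K.path i t.val)) := by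
    intro i hi
    refine ⟨(K.start _).2 (K.path_isStart i), fun t => (K.step _ _).2 (K.path_edge i t.val), ?_⟩
    have : K.path i (s + k) = K.cyc i k := by simp [path]
    simpa [this] using hi
  have h := congrFun (hM _ _ _ (run i hi) (run j hj)) (Fin.last _)
  have e : ∀ i, K.path i (s + k) = K.cyc i k := fun i => by simp [path]
  simp only [Fin.val_last, List.length_replicate, e, EmbeddingLike.apply_eq_iff_eq] at h
  simp only [cyc, Sum.inr.injEq, Sigma.mk.injEq] at h
  exact h.1

include K in
theorem card_eq [Fintype σ] : Fintype.card σ = s + ∑ i, p i := by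
  rw [← Fintype.card_congr K.e]
  simp

/-- If a progression of numbers beyond the stem is accepted for sufficiently many members, it is
accepted. -/
theorem progression (hM : Unambiguous M) (d P : ℕ)
    (h : ∀ k ≤ ∑ i, p i, ∃ i, K.e (K.cyc i (d + P * k)) ∈ M.accept) (k : ℕ) :
    ∃ i, K.e (K.cyc i (d + P * k)) ∈ M.accept := by
  -- Whatever `P` is, increasing `k` by `p i` adds a multiple of `p i` to the position; so the
  -- periods, and the length of the window, do not depend on `P`.
  refine exists_of_window p K.pos (fun i k => K.e (K.cyc i (d + P * k)) ∈ M.accept) ?_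
    (fun i j k hi hj => K.eq_of_unambiguous hM hi hj) h k
  intro i k
  have : K.cyc i (d + P * (k + p i)) = K.cyc i (d + P * k) := by
    have : d + P * (k + p i) = (d + P * k) + p i * P := by ring
    simp [cyc, this]
  rw [this]

include K in
-- The lengths below `B` contain the whole stem and `∑ p i + 1` consecutive times from `s` on, a
-- full window for the progression with difference `1`.
theorem universal_iff (hM : Unambiguous M) {B : ℕ} (hB : s + ∑ i, p i < B) :
    (∀ w, w ∈ M.accepts) ↔ ∀ t < B, List.replicate t () ∈ M.accepts := by
  refine ⟨fun h t _ => h _, fun h w => ?_⟩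
  have hr : w = List.replicate w.length () := List.eq_replicate_iff.2 ⟨rfl, by simp⟩
  by_cases hw : w.length < B
  · rw [hr]; exact h _ hw
  · rw [K.mem_accepts_of_le (by omega)]
    have := K.progression hM 0 1 (fun k hk => by
      have h1 := h (s + k) (by omega)
      rw [K.mem_accepts_of_le (by simp)] at h1
      simpa using h1) (w.length - s)
    simpa using this

include K in
-- A long accepted word of `M'` ends on a cycle of some length `P`, so `M'` accepts all lengths `d +
-- P * k`, where `d` is the first visit of that cycle state. The members with `s ≤ k ≤ s + ∑ p i`
-- lie beyond the stem of `M` and below `B`; they form a full window for `M`, which therefore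
-- accepts all later members too.
theorem subset_iff {σ' : Type} {M' : NFA Unit σ'} {s' c' : ℕ} {p' : Fin c' → ℕ}
    (K' : Chrobak M' s' c' p') (hM : Unambiguous M) {B : ℕ}
    (hB : (s' + ∑ i, p' i) * (s + ∑ i, p i + 1) < B) :
    (∀ w, w ∈ M'.accepts → w ∈ M.accepts) ↔
      ∀ t < B, List.replicate t () ∈ M'.accepts → List.replicate t () ∈ M.accepts := by
  refine ⟨fun h t _ => h _, fun h w hw => ?_⟩
  have hr : w = List.replicate w.length () := List.eq_replicate_iff.2 ⟨rfl, by simp⟩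
  by_cases hwB : w.length < B
  · rw [hr] at hw ⊢; exact h _ hwB hw
  push Not at hwB
  obtain ⟨t, ht⟩ : ∃ t, t = w.length := ⟨_, rfl⟩
  have hs' : s' ≤ t := by
    have : s' ≤ (s' + ∑ i, p' i) * (s + ∑ i, p i + 1) :=
      (Nat.le_add_right _ _).trans (Nat.le_mul_of_pos_right _ (Nat.succ_pos _))
    omega
  obtain ⟨i, hi⟩ := (K'.mem_accepts_of_le (ht ▸ hs')).1 hw
  obtain ⟨P, hP⟩ : ∃ P, P = p' i := ⟨_, rfl⟩
  have hP0 : 0 < P := hP ▸ K'.pos i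
  have hPle : P ≤ ∑ i, p' i := hP ▸ Finset.single_le_sum (fun _ _ => Nat.zero_le _) (Finset.mem_univ i)
  have hmod : (t - s') % P < P := Nat.mod_lt _ hP0
  obtain ⟨d, hd⟩ : ∃ d, d = s' + (t - s') % P := ⟨_, rfl⟩
  have hk0 : t = d + P * ((t - s') / P) := by
    have := Nat.mod_add_div (t - s') P
    omega
  have hd' : d ≤ s' + ∑ i, p' i := by omega
  have acc' : ∀ k, List.replicate (d + P * k) () ∈ M'.accepts := by
    intro k
    rw [K'.mem_accepts_of_le (by simp; omega)]
    refine ⟨i, ?_⟩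
    have : K'.cyc i ((List.replicate (d + P * k) ()).length - s') =
        K'.cyc i (w.length - s') := by
      have : d + P * k - s' = (t - s') % P + P * k := by omega
      simp [cyc, this, ← hP, ← ht]
    rw [this]
    exact hi
  have bound : ∀ k ≤ s + ∑ i, p i, d + P * k < B := by
    intro k hk
    refine lt_of_le_of_lt ?_ hB
    calc d + P * k ≤ (s' + ∑ i, p' i) + (s' + ∑ i, p' i) * (s + ∑ i, p i) := by
          gcongr; omega
      _ = _ := by ring
  -- Since `P` is positive, skipping `s` members of the progression is enough to leave the stem of
  -- `M`.
  have hsP : ∀ k, s ≤ d + P * (s + k) := by intro k; nlinarith [Nat.zero_le (P * k)]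
  have prog := K.progression hM (d + P * s - s) P (fun k hk => by
    have h1 := h _ (bound (s + k) (by omega)) (acc' (s + k))
    rw [K.mem_accepts_of_le (by simpa using hsP k)] at h1
    have e : d + P * (s + k) - s = d + P * s - s + P * k := by
      have := hsP 0
      rw [Nat.mul_add] at *
      omega
    simpa [e] using h1)
  -- Otherwise `t` would be one of the members below `B`.
  have hk1 : s ≤ (t - s') / P := by
    by_contra hlt
    have := bound ((t - s') / P) (by omega)
    omega
  obtain ⟨k, hk⟩ := Nat.exists_eq_add_of_le hk1
  rw [K.mem_accepts_of_le (by rw [← ht, hk0, hk]; exact hsP k)]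
  have e : w.length - s = d + P * s - s + P * k := by
    rw [← ht, hk0, hk]
    have := hsP 0
    rw [Nat.mul_add] at *
    omega
  rw [e]
  exact prog k

end Chrobak

end

end UnaryUFA

/-! ### Correctness of the walks and the LOGSPACE algorithms -/

namespace UnaryUFA

section

/-! ### The numbers that describe an automaton -/

open Classical in
/-- For each state, whether it is initial and whether it is accepting. -/
noncomputable def stateList (A : UnaryNFA) : List (ℕ × ℕ) :=
  (List.finRange A.1).map fun q =>
    (if q ∈ A.2.start then 1 else 0, if q ∈ A.2.accept then 1 else 0)

/-- The transitions as pairs of numbers. -/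
noncomputable def edgePairs (A : UnaryNFA) : List (ℕ × ℕ) :=
  (edgeList A).map fun e => (e.1.val, e.2.val)

theorem code_eq (A : UnaryNFA) : code A = descr A.1 (stateList A) (edgePairs A) := by
  simp [code, descr, stateList, edgePairs, flat, List.flatMap_map]

theorem length_stateList (A : UnaryNFA) : (stateList A).length = A.1 := by
  simp [stateList]

theorem getElem?_stateList (A : UnaryNFA) (i : ℕ) (h : i < A.1) :
    ∃ p, (stateList A)[i]? = some p ∧ (p.1 ≠ 0 ↔ (⟨i, h⟩ : Fin A.1) ∈ A.2.start) ∧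
      (p.2 ≠ 0 ↔ (⟨i, h⟩ : Fin A.1) ∈ A.2.accept) ∧ p.1 ≤ 1 ∧ p.2 ≤ 1 := by
  classical
  refine ⟨(if (⟨i, h⟩ : Fin A.1) ∈ A.2.start then 1 else 0,
    if (⟨i, h⟩ : Fin A.1) ∈ A.2.accept then 1 else 0), ?_, ?_, ?_, ?_, ?_⟩
  · simp [stateList, h]
  all_goals split_ifs <;> simp [*]

theorem stateList_le (A : UnaryNFA) : ∀ p ∈ stateList A, p.1 ≤ 1 ∧ p.2 ≤ 1 := by
  intro p hp
  simp only [stateList, List.mem_map] at hp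
  obtain ⟨q, _, rfl⟩ := hp
  constructor <;> simp only <;> split_ifs <;> omega

theorem mem_edgePairs (A : UnaryNFA) (p : ℕ × ℕ) :
    p ∈ edgePairs A ↔ ∃ u v : Fin A.1, v ∈ A.2.step u () ∧ p = (u.val, v.val) := by
  simp only [edgePairs, edgeList, List.mem_map, List.mem_filter, decide_eq_true_eq]
  constructor
  · rintro ⟨⟨u, v⟩, ⟨_, h⟩, rfl⟩; exact ⟨u, v, h, rfl⟩
  · rintro ⟨u, v, h, rfl⟩
    exact ⟨(u, v), ⟨by simp [List.mem_product], h⟩, rfl⟩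

theorem mem_targets (A : UnaryNFA) (r y : ℕ) :
    y ∈ targets r (edgePairs A) ↔ ∃ u v : Fin A.1, v ∈ A.2.step u () ∧ u.val = r ∧ v.val = y := by
  simp only [targets, List.mem_map, List.mem_filter, mem_edgePairs, decide_eq_true_eq]
  constructor
  · rintro ⟨p, ⟨⟨u, v, h, rfl⟩, h1⟩, h2⟩; exact ⟨u, v, h, h1, h2⟩
  · rintro ⟨u, v, h, h1, h2⟩; exact ⟨_, ⟨⟨u, v, h, rfl⟩, h1⟩, h2⟩

theorem mem_startList {l : List (ℕ × ℕ)} : ∀ {i y : ℕ},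
    y ∈ startList i l ↔ ∃ k p, l[k]? = some p ∧ p.1 ≠ 0 ∧ y = i + k := by
  induction l with
  | nil => simp [startList]
  | cons p l ih =>
    intro i y
    rw [startList, List.mem_append, ih]
    constructor
    · rintro (h | ⟨k, q, h1, h2, h3⟩)
      · split_ifs at h with hp
        · exact ⟨0, p, rfl, hp, by simpa using h⟩
        · simp at h
      · exact ⟨k + 1, q, by simpa using h1, h2, by omega⟩
    · rintro ⟨_ | k, q, h1, h2, h3⟩
      · simp only [List.getElem?_cons_zero, Option.some.injEq] at h1
        subst h1
        left
        simp [h2, h3]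
      · exact Or.inr ⟨k, q, by simpa using h1, h2, by omega⟩

theorem flagFrom_ne_zero {r : ℕ} {l : List (ℕ × ℕ)} : ∀ {i f : ℕ},
    flagFrom r i l f ≠ 0 ↔ f ≠ 0 ∨ ∃ k p, l[k]? = some p ∧ p.2 ≠ 0 ∧ r = i + k := by
  induction l with
  | nil => simp [flagFrom]
  | cons p l ih =>
    intro i f
    rw [flagFrom, ih]
    constructor
    · rintro (h | ⟨k, q, h1, h2, h3⟩)
      · split_ifs at h with hp
        · exact Or.inr ⟨0, p, rfl, hp.1, by omega⟩
        · exact Or.inl h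
      · exact Or.inr ⟨k + 1, q, by simpa using h1, h2, by omega⟩
    · rintro (h | ⟨_ | k, q, h1, h2, h3⟩)
      · left; split_ifs
        · exact one_ne_zero
        · exact h
      · simp only [List.getElem?_cons_zero, Option.some.injEq] at h1
        subst h1
        left
        simp [h2, h3]
      · exact Or.inr ⟨k, q, by simpa using h1, h2, by omega⟩

theorem mem_startList_stateList (A : UnaryNFA) (y : ℕ) :
    y ∈ startList 0 (stateList A) ↔ ∃ q : Fin A.1, q ∈ A.2.start ∧ q.val = y := by
  rw [mem_startList]
  constructor
  · rintro ⟨k, p, h1, h2, h3⟩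
    have hk : k < A.1 := by
      rw [← length_stateList A]; exact (List.getElem?_eq_some_iff.1 h1).1
    obtain ⟨p', e1, e2, _⟩ := getElem?_stateList A k hk
    rw [h1, Option.some.injEq] at e1
    subst e1
    exact ⟨⟨k, hk⟩, e2.1 h2, by simp [h3]⟩
  · rintro ⟨q, h, rfl⟩
    obtain ⟨p', e1, e2, _⟩ := getElem?_stateList A q q.isLt
    exact ⟨q, p', e1, e2.2 h, by omega⟩

theorem flagFrom_stateList (A : UnaryNFA) (r : ℕ) :
    flagFrom r 0 (stateList A) 0 ≠ 0 ↔ ∃ q : Fin A.1, q ∈ A.2.accept ∧ q.val = r := by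
  rw [flagFrom_ne_zero]
  simp only [ne_eq, not_true_eq_false, false_or]
  constructor
  · rintro ⟨k, p, h1, h2, h3⟩
    have hk : k < A.1 := by
      rw [← length_stateList A]; exact (List.getElem?_eq_some_iff.1 h1).1
    obtain ⟨p', e1, _, e2, _⟩ := getElem?_stateList A k hk
    rw [h1, Option.some.injEq] at e1
    subst e1
    exact ⟨⟨k, hk⟩, e2.1 h2, by simp [h3]⟩
  · rintro ⟨q, h, rfl⟩
    obtain ⟨p', e1, _, e2, _⟩ := getElem?_stateList A q q.isLt
    exact ⟨q, p', e1, e2.2 h, by omega⟩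

/-! ### The walks find the accepted words -/

theorem pick_self (e : ℕ) (l : List ℕ) : pick e e l = e := by
  induction l with
  | nil => rfl
  | cons y l ih => simpa [pick] using ih

theorem pick_mem (e d : ℕ) (l : List ℕ) : pick e d l ∈ l ∨ pick e d l = d := by
  induction l generalizing d with
  | nil => exact Or.inr rfl
  | cons y l ih =>
    rcases ih (if d = e then d else y) with h | h
    · exact Or.inl (List.mem_cons_of_mem _ h)
    · change pick e (if d = e then d else y) l = _ at h
      change pick e (if d = e then d else y) l ∈ _ ∨ pick e (if d = e then d else y) l = d
      rw [h]
      split_ifs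
      · exact Or.inr rfl
      · exact Or.inl List.mem_cons_self

theorem pick_of_mem {e d : ℕ} {l : List ℕ} (h : e ∈ l) : pick e d l = e := by
  induction l generalizing d with
  | nil => simp at h
  | cons y l ih =>
    change pick e (if d = e then d else y) l = e
    rcases List.mem_cons.1 h with rfl | h
    · split_ifs with hd
      · rw [hd, pick_self]
      · exact pick_self _ _
    · exact ih h

/-- Without a real choice the preference does not matter. The default must differ from `e`, because
otherwise it would be kept; in the walks it is `n + 1`, which is not a state. -/
theorem pick_of_forall {e d z : ℕ} {l : List ℕ} (hl : l ≠ []) (h : ∀ y ∈ l, y = z) (hd : d ≠ e) :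
    pick e d l = z := by
  cases l with
  | nil => exact absurd rfl hl
  | cons y l =>
    change pick e (if d = e then d else y) l = z
    rw [if_neg hd]
    rcases pick_mem e y l with h1 | h1
    · exact h _ (List.mem_cons_of_mem _ h1)
    · rw [h1]; exact h _ List.mem_cons_self

section

variable (A : UnaryNFA)

/-- The candidates for the next state of a walk. -/
noncomputable def candidates (r : ℕ) : List ℕ :=
  (if r = A.1 then startList 0 (stateList A) else []) ++ targets r (edgePairs A)

theorem mem_candidates_of_ne {r y : ℕ} (hr : r ≠ A.1) :
    y ∈ candidates A r ↔ ∃ u v : Fin A.1, v ∈ A.2.step u () ∧ u.val = r ∧ v.val = y := by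
  rw [candidates, if_neg hr, List.nil_append, mem_targets]

theorem mem_candidates_self {y : ℕ} :
    y ∈ candidates A A.1 ↔ ∃ q : Fin A.1, q ∈ A.2.start ∧ q.val = y := by
  rw [candidates, if_pos rfl, List.mem_append, mem_startList_stateList, mem_targets]
  constructor
  · rintro (h | ⟨u, v, _, h, _⟩)
    · exact h
    · have := u.isLt
      omega
  · exact Or.inl

/-- With any preference a walk follows transitions from an initial state until it is stuck, so it
can never accept wrongly. The shift by one is the pass that selects the initial state. This needs no
normal form. -/
theorem walk_sound (e t : ℕ) :
    (∃ q : Fin A.1, q.val = (walk A.1 (stateList A) (edgePairs A) e (t + 1)).1 ∧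
      q ∈ A.2.eval (List.replicate t ())) ∨
    (walk A.1 (stateList A) (edgePairs A) e (t + 1)).1 = A.1 + 1 := by
  induction t with
  | zero =>
    rw [walk_succ]
    rcases pick_mem e (A.1 + 1) (candidates A A.1) with h | h
    · obtain ⟨q, h1, h2⟩ := (mem_candidates_self A).1 h
      exact Or.inl ⟨q, h2, h1⟩
    · exact Or.inr h
  | succ t ih =>
    rw [walk_succ]
    obtain ⟨r, hr⟩ : ∃ r, r = (walk A.1 (stateList A) (edgePairs A) e (t + 1)).1 := ⟨_, rfl⟩
    rw [← hr] at ih ⊢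
    have hrn : r ≠ A.1 := by
      rcases ih with ⟨q, h, _⟩ | h
      · have := q.isLt; omega
      · omega
    rcases pick_mem e (A.1 + 1) (candidates A r) with h | h
    · obtain ⟨u, v, h1, h2, h3⟩ := (mem_candidates_of_ne A hrn).1 h
      refine Or.inl ⟨v, h3, ?_⟩
      rcases ih with ⟨q, h4, h5⟩ | h4
      · rw [List.replicate_succ', NFA.eval_append_singleton, NFA.mem_stepSet]
        refine ⟨q, h5, ?_⟩
        have : q = u := Fin.ext (h4.trans h2.symm)
        rwa [this]
      · have := u.isLt; omega
    · exact Or.inr h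

/-- The walk with preference `e` keeps to the run `f` if each step of `f`, including the choice of
its first state, is either forced or leads to `e`. -/
theorem walk_complete {s c : ℕ} {p : Fin c → ℕ} (K : Chrobak A.2 s c p) (e : ℕ) (he : e < A.1)
    (f : ℕ → StemCycles s c p) (t : ℕ) (h0 : (f 0).IsStart)
    (h0' : (∀ u : StemCycles s c p, u.IsStart → u = f 0) ∨ e = (K.e (f 0)).val)
    (h1 : ∀ m < t, (f m).Edge (f (m + 1)))
    (h1' : ∀ m < t, (∀ u, (f m).Edge u → u = f (m + 1)) ∨ e = (K.e (f (m + 1))).val) :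
    ∀ m ≤ t, (walk A.1 (stateList A) (edgePairs A) e (m + 1)).1 = (K.e (f m)).val := by
  have hpick : ∀ (r : ℕ) (z : Fin A.1), z.val ∈ candidates A r →
      ((∀ y ∈ candidates A r, y = z.val) ∨ e = z.val) →
      nextState A.1 (stateList A) (edgePairs A) e r = z.val := by
    intro r z hz h
    rcases h with h | h
    · exact pick_of_forall (List.ne_nil_of_mem hz) h (by omega)
    · rw [← h] at hz ⊢
      exact pick_of_mem hz
  intro m
  induction m with
  | zero =>
    intro _
    rw [walk_succ]
    refine hpick _ _ ((mem_candidates_self A).2 ⟨_, (K.start _).2 h0, rfl⟩) (h0'.imp_left ?_)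
    intro hu y hy
    obtain ⟨q, hq, rfl⟩ := (mem_candidates_self A).1 hy
    obtain ⟨u, rfl⟩ := K.e.surjective q
    rw [hu u ((K.start u).1 hq)]
  | succ m ih =>
    intro hm
    rw [walk_succ, ih (by omega)]
    have hne : (K.e (f m)).val ≠ A.1 := (K.e (f m)).isLt.ne
    refine hpick _ _ ((mem_candidates_of_ne A hne).2
      ⟨_, _, (K.step _ _).2 (h1 m (by omega)), rfl, rfl⟩) ((h1' m (by omega)).imp_left ?_)
    intro hu y hy
    obtain ⟨q, q', h2, h3, rfl⟩ := (mem_candidates_of_ne A hne).1 hy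
    obtain ⟨u, rfl⟩ := K.e.surjective q'
    have : q = K.e (f m) := Fin.ext h3
    rw [this] at h2
    rw [hu u ((K.step _ u).1 h2)]

/-- In normal form, the only choice is the entry into the cycles, or the initial state if there is
no stem. Preferring the distinguished state of an accepting cycle resolves it in the right way, and
all other steps are forced. -/
theorem okUpTo_iff_mem_accepts (hA : IsChrobak A.2) (t : ℕ) :
    okUpTo A.1 (stateList A) (edgePairs A) t A.1 ≠ 0 ↔ List.replicate t () ∈ A.2.accepts := by
  obtain ⟨s, c, p, ⟨K⟩⟩ := hA.exists_chrobak
  rw [okUpTo_ne_zero]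
  constructor
  · rintro ⟨e, _, h⟩
    rw [walk_succ, flagFrom_stateList] at h
    obtain ⟨q, h1, h2⟩ := h
    rcases walk_sound A e t with ⟨q', h3, h4⟩ | h3
    · have : q = q' := Fin.ext (h2.trans h3.symm)
      exact NFA.mem_accepts.2 ⟨q, h1, this ▸ h4⟩
    · have := q.isLt; omega
  · intro h
    have fin : ∀ (e : ℕ) (v : StemCycles s c p), K.e v ∈ A.2.accept →
        (walk A.1 (stateList A) (edgePairs A) e (t + 1)).1 = (K.e v).val →
        (walk A.1 (stateList A) (edgePairs A) e (t + 2)).2 ≠ 0 := by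
      intro e v hv hw
      rw [walk_succ, flagFrom_stateList]
      exact ⟨_, hv, hw.symm⟩
    by_cases hts : t < s
    · rw [K.mem_accepts_of_lt (by simpa using hts)] at h
      have h' : K.e (Sum.inl ⟨t, hts⟩) ∈ A.2.accept := by simpa using h
      refine ⟨(K.e (Sum.inl ⟨t, hts⟩)).val, (K.e _).isLt, fin _ _ h' ?_⟩
      -- Within the stem every step is forced and any state may serve as the preference. The minimum
      -- with `t` only makes the run a total function of the time.
      have := walk_complete A K (K.e (Sum.inl ⟨t, hts⟩)).val (K.e _).isLt
        (fun m => Sum.inl ⟨min m t, by omega⟩) t (by simp [StemCycles.IsStart]) (Or.inl ?_) ?_ ?_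
        t le_rfl
      · simpa using this
      · rintro (u | ⟨i, j⟩) hu
        · simp only [StemCycles.IsStart] at hu
          congr 1
          exact Fin.ext (by simpa using hu)
        · exact absurd hu.1 (by omega)
      · intro m hm
        simp only [StemCycles.Edge]
        omega
      · intro m hm
        left
        rintro (u | ⟨i, j⟩) hu
        · simp only [StemCycles.Edge] at hu
          congr 1
          exact Fin.ext (by simp only; omega)
        · simp only [StemCycles.Edge] at hu
          omega
    · rw [K.mem_accepts_of_le (by simpa using hts)] at h
      obtain ⟨i, hi⟩ := h
      rw [List.length_replicate] at hi
      refine ⟨(K.e (K.cyc i 0)).val, (K.e _).isLt, fin _ _ hi ?_⟩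
      have := walk_complete A K (K.e (K.cyc i 0)).val (K.e _).isLt (K.path i) t (K.path_isStart i)
        ?_ (fun m _ => K.path_edge i m) ?_ t le_rfl
      · rw [this]
        simp [Chrobak.path, hts]
      -- With a stem the initial state is unique; without one it is the preferred state.
      · by_cases hs : 0 < s
        · left
          rintro (u | ⟨i, j⟩) hu
          · simp only [Chrobak.path, hs, dif_pos]
            congr 1
            exact Fin.ext hu
          · exact absurd hu.1 (by omega)
        · right
          simp [Chrobak.path, hs]
      · intro m hm
        by_cases hms : m + 1 < s
        · left
          have hms' : m < s := by omega
          simp only [Chrobak.path, hms, hms', dif_pos]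
          rintro (u | ⟨i, j⟩) hu
          · congr 1
            exact Fin.ext hu
          · simp only [StemCycles.Edge] at hu
            omega
        · by_cases hms' : m < s
          · right
            have : m + 1 - s = 0 := by omega
            simp [Chrobak.path, hms, this]
          · left
            simp only [Chrobak.path, hms, hms', dif_neg, not_false_eq_true]
            rintro (u | ⟨i', j⟩) hu
            · exact absurd hu id
            · obtain ⟨rfl, hu⟩ := hu
              simp only [Chrobak.cyc]
              congr 2
              apply Fin.ext
              simp only at hu ⊢
              rw [hu, Nat.mod_add_mod, Nat.sub_add_comm (by omega)]

end

/-! ### Logarithmic space -/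

theorem length_le_length_wordOf (l : List ℕ) : l.length ≤ (wordOf l).length := by
  induction l with
  | nil => simp
  | cons k l ih =>
    have : wordOf (k :: l) = wordOf [k] ++ wordOf l := by simp [wordOf]
    rw [this, List.length_append]
    simp only [List.length_cons, wordOf, List.flatMap_nil, List.append_nil, List.flatMap_cons,
      List.length_append, List.length_nil]
    simp only [wordOf] at ih
    omega

theorem length_flat (l : List (ℕ × ℕ)) : (flat l).length = 2 * l.length := by
  induction l with
  | nil => rfl
  | cons p l ih => simp only [flat, List.flatMap_cons, List.length_append, List.length_cons,
      List.length_nil] at ih ⊢; omega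

/-- Every number of the description is followed by a comma, so states and transitions are fewer than
the input letters. This keeps all counters logarithmic and provides the bounds on the lengths to be
inspected. -/
theorem length_word_ge (A : UnaryNFA) :
    2 + 2 * A.1 + 2 * (edgePairs A).length ≤ (word A).length := by
  have := length_le_length_wordOf (code A)
  have e : (code A).length = 2 + 2 * A.1 + 2 * (edgePairs A).length := by
    rw [code_eq]
    simp only [descr, List.length_cons, List.length_append, length_flat, length_stateList]
    omega
  rwa [e] at this

theorem semicolon_notMem_wordOf (l : List ℕ) : Letter.semicolon ∉ wordOf l := by
  simp [wordOf]

theorem ready {x : List Letter} {V h : ℕ} {go : Prog} (A : UnaryNFA) (hV : (word A).length ≤ V)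
    (hx : At x h (word A)) (hgo : ∀ k v, Fits x V k v → Does x V go k v h v) :
    Ready x V h A.1 (stateList A) (edgePairs A) go := by
  have := length_word_ge A
  refine ⟨length_stateList A, ?_, by omega, by omega, ?_, ?_, hgo⟩
  · rw [← code_eq]; exact hx
  · intro p hp
    have := stateList_le A p hp
    omega
  · intro p hp
    obtain ⟨u, v, _, rfl⟩ := (mem_edgePairs A p).1 hp
    have := u.isLt
    have := v.isLt
    simp only
    omega

/-- A sufficient space bound. -/
def spaceBound (m : ℕ) : ℕ := ((m + 1) ^ 2).size + 2

theorem spaceBound_isBigO :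
    (fun m => (spaceBound m : ℝ)) =O[atTop] (fun m : ℕ => Real.log m) := by
  have h1 : ∀ᶠ m : ℕ in atTop, (1 : ℝ) ≤ Real.log m := by
    have := (Real.tendsto_log_atTop.comp tendsto_natCast_atTop_atTop).eventually_ge_atTop 1
    exact this
  refine IsBigO.of_bound (4 / Real.log 2 + 3) ?_
  filter_upwards [h1, eventually_ge_atTop 2] with m hm hm2
  have hl2 : 0 < Real.log 2 := Real.log_pos one_lt_two
  rw [Real.norm_of_nonneg (Nat.cast_nonneg _), Real.norm_of_nonneg (by linarith)]
  -- For `m ≥ 2`, `m + 1 ≤ m ^ 2`. A pure power of `m` is convenient because its logarithm is `4 *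
  -- Real.log m`.
  have e1 : ((m + 1) ^ 2).size ≤ Nat.log 2 ((m ^ 2) ^ 2) + 1 := by
    rw [Nat.size_le]
    refine lt_of_le_of_lt ?_ (Nat.lt_pow_succ_log_self one_lt_two _)
    exact Nat.pow_le_pow_left (by nlinarith) 2
  have e2 : (Nat.log 2 ((m ^ 2) ^ 2) : ℝ) ≤ Real.log ((m ^ 2) ^ 2 : ℕ) / Real.log 2 := by
    rw [le_div_iff₀ hl2, ← Real.log_pow]
    apply Real.log_le_log (by positivity)
    exact_mod_cast Nat.pow_log_le_self 2 (by positivity)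
  have e3 : Real.log ((m ^ 2) ^ 2 : ℕ) = 4 * Real.log m := by
    push_cast
    rw [← pow_mul, Real.log_pow]
    norm_num
  have e4 : (spaceBound m : ℝ) ≤ Nat.log 2 ((m ^ 2) ^ 2) + 3 := by
    have : spaceBound m ≤ Nat.log 2 ((m ^ 2) ^ 2) + 3 := by unfold spaceBound; omega
    exact_mod_cast this
  rw [e3] at e2
  calc (spaceBound m : ℝ) ≤ 4 * Real.log m / Real.log 2 + 3 := by linarith
    _ = 4 / Real.log 2 * Real.log m + 3 * 1 := by ring
    _ ≤ 4 / Real.log 2 * Real.log m + 3 * Real.log m := by gcongr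
    _ = _ := by ring

/-- A problem that is decided by a check for all numbers below the square of the input length is
decidable in LOGSPACE. -/
theorem decidableInLogspace_of_check {I : Type} (enc : I → List Letter) (Promise Problem : I → Prop)
    (check : Prog) (P : I → ℕ → Prop) [∀ a, DecidablePred (P a)]
    (hc : ∀ a, Promise a → ∀ T B M g, T ≤ ((enc a).length + 1) ^ 2 →
      B ≤ ((enc a).length + 1) ^ 2 → M ≤ ((enc a).length + 1) ^ 2 →
      g ≤ ((enc a).length + 1) ^ 2 →
      Does (enc a) (((enc a).length + 1) ^ 2) check 1 (mainVals T B M g 0) 1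
        (mainVals T B M (if P a T then g else 0) 0))
    (hP : ∀ a, Promise a → (Problem a ↔ ∀ t < ((enc a).length + 1) ^ 2, P a t)) :
    DecidableInLogspace enc Promise Problem := by
  refine ⟨flowTM (mainProg check) (Test.ne Reg.good Reg.Z), spaceBound, spaceBound_isBigO, ?_⟩
  intro a ha
  obtain ⟨n, hn⟩ := does_mainProg (P a) le_rfl (hc a ha)
  have e : mkStore 0 {} = ⟨0, fun _ => []⟩ := by
    unfold mkStore
    congr 1
    funext q
    cases q <;> exact Nat.zero_bits
  rw [e] at hn
  obtain ⟨h1, h2⟩ := flowTM_correct (mainProg check) (Test.ne Reg.good Reg.Z) (enc a) hn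
  refine ⟨⟨_, h1, ?_⟩, h2⟩
  rw [hP a ha, ← goodUpTo_ne_zero]
  exact Does.test_ne (x := enc a) (V := 0) Reg.good Reg.Z

theorem universality_in_logspace : DecidableInLogspace word
    (fun A : UnaryNFA => IsChrobak A.2 ∧ Unambiguous A.2)
    (fun A => ∀ w : List Unit, w ∈ A.2.accepts) := by
  refine decidableInLogspace_of_check _ _ _ checkFirst
    (fun A t => okUpTo A.1 (stateList A) (edgePairs A) t A.1 ≠ 0) ?_ ?_
  · intro A _ T B M g hT hB hM hg
    refine does_checkFirst (ready A (by nlinarith) ⟨[], [], by simp, rfl⟩ ?_) hT hB hM hg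
    exact does_goFirst
  · intro A hA
    obtain ⟨s, c, p, ⟨K⟩⟩ := hA.1.exists_chrobak
    have h1 := K.card_eq
    rw [Fintype.card_fin] at h1
    have h2 := length_word_ge A
    rw [K.universal_iff hA.2 (B := ((word A).length + 1) ^ 2) (by nlinarith)]
    simp only [okUpTo_iff_mem_accepts A hA.1]

theorem inclusion_in_logspace : DecidableInLogspace pairWord
    (fun A : UnaryNFA × UnaryNFA => IsChrobak A.1.2 ∧ IsChrobak A.2.2 ∧ Unambiguous A.2.2)
    (fun A => ∀ w : List Unit, w ∈ A.1.2.accepts → w ∈ A.2.2.accepts) := by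
  refine decidableInLogspace_of_check _ _ _ checkBoth
    (fun A t => okUpTo A.1.1 (stateList A.1) (edgePairs A.1) t A.1.1 ≠ 0 →
      okUpTo A.2.1 (stateList A.2) (edgePairs A.2) t A.2.1 ≠ 0) ?_ ?_
  · intro A _ T B M g hT hB hM hg
    have hl : (pairWord A).length = (word A.1).length + (word A.2).length + 1 := by
      simp [pairWord]; omega
    refine does_checkBoth (h := (word A.1).length + 2)
      (ready A.1 (by nlinarith) ⟨[], _, rfl, rfl⟩ does_goFirst)
      (ready A.2 (by nlinarith) ⟨word A.1 ++ [Letter.semicolon], [], by simp, by simp⟩ ?_)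
      hT hB hM hg
    exact does_goSecond (semicolon_notMem_wordOf _) rfl
  · intro A hA
    have hl : (pairWord A).length = (word A.1).length + (word A.2).length + 1 := by
      simp [pairWord]; omega
    obtain ⟨s', c', p', ⟨K'⟩⟩ := hA.1.exists_chrobak
    obtain ⟨s, c, p, ⟨K⟩⟩ := hA.2.1.exists_chrobak
    have h1 := K.card_eq
    have h1' := K'.card_eq
    rw [Fintype.card_fin] at h1 h1'
    have h2 := length_word_ge A.1
    have h2' := length_word_ge A.2
    -- Both numbers of states are smaller than the length of the pair word, so the product bound for
    -- inclusion is below the square.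
    rw [K.subset_iff K' hA.2.2 (B := ((pairWord A).length + 1) ^ 2)
      (by rw [← h1, ← h1', hl]; nlinarith)]
    simp only [okUpTo_iff_mem_accepts A.1 hA.1, okUpTo_iff_mem_accepts A.2 hA.2.1]

end

end UnaryUFA

/-! ### Time: structured programs at logarithmic cost -/

namespace UnaryUFA

section

/-! ### Random access machines that run structured programs -/

/-- An instruction without jump whose operands are small. -/
def Instr.fine : Instr → Bool
  | Instr.const r k => r < 1024 && k < 1024
  | Instr.copy r s | Instr.load r s | Instr.store r s | Instr.read r s => r < 1024 && s < 1024
  | Instr.add r s t | Instr.sub r s t | Instr.mul r s t | Instr.div r s t =>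
    r < 1024 && s < 1024 && t < 1024
  | _ => false

/-- The instruction of a random access machine for an instruction of a flow chart. The register `0`
contains `0`. -/
def Node.toInstr : Node Instr ℕ → Instr
  | act a => a
  | branch r k => Instr.jumpZero r k
  | goto k => Instr.jumpZero 0 k

/-- An instruction of a flow chart with small operands. -/
def Node.fine : Node Instr ℕ → Bool
  | act a => a.fine
  | branch r k => r < 1024 && k < 1024
  | goto k => k < 1024

/-- The semantics of programs of random access machines, with numbers at most `V`. -/
def ramSem (x : List ℕ) (V : ℕ) : Sem Instr ℕ (ℕ → ℕ) where
  act a R := a.effect x R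
  test r R := R r != 0
  inv R := R 0 = 0 ∧ ∀ r, R r ≤ V

theorem len_mono {k l : ℕ} (h : k ≤ l) : len k ≤ len l :=
  Nat.add_le_add_right (Nat.log_mono_right h) 1

theorem len_le_ten {k : ℕ} (h : k < 1024) : len k ≤ 10 := by
  have := len_mono (Nat.le_of_lt_succ h)
  have h2 : len 1023 = 10 := by
    unfold len
    rw [(Nat.log_eq_iff (b := 2) (m := 9) (n := 1023) (by norm_num)).2 (by norm_num)]
  omega

/-- Operands in the program text are below `1024` and have at most 10 digits, at most three of them
per instruction; contents have at most `len V` digits. Only multiplication and division make the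
bound quadratic. -/
theorem Node.cost_le {x : List ℕ} {V : ℕ} {R : ℕ → ℕ} {pc : ℕ} (nd : Node Instr ℕ)
    (hnd : nd.fine = true) (hR : (ramSem x V).inv R)
    (hR' : (ramSem x V).inv (nd.step (ramSem x V) (pc, R)).2) :
    nd.toInstr.cost x R ≤ 40 * len V ^ 2 := by
  have h1 : 1 ≤ len V := by simp [len]
  have hr : ∀ r, len (R r) ≤ len V := fun r => len_mono (hR.2 r)
  have hsq : len V ≤ len V ^ 2 := by nlinarith
  have hm : ∀ r s, len (R r) * len (R s) ≤ len V ^ 2 := fun r s => by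
    rw [sq]; exact Nat.mul_le_mul (hr r) (hr s)
  rcases nd with a | ⟨r, k⟩ | k
  · cases a with
    | const r k =>
      simp [Node.fine, Instr.fine] at hnd
      have := len_le_ten hnd.1
      have := len_le_ten hnd.2
      simp only [Node.toInstr, Instr.cost]; omega
    | copy r s =>
      simp [Node.fine, Instr.fine] at hnd
      have := len_le_ten hnd.1
      have := len_le_ten hnd.2
      have := hr s
      simp only [Node.toInstr, Instr.cost]; omega
    | load r s =>
      simp [Node.fine, Instr.fine] at hnd
      have := len_le_ten hnd.1
      have := len_le_ten hnd.2
      have := hr s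
      have := hr (R s)
      simp only [Node.toInstr, Instr.cost]; omega
    | store r s =>
      simp [Node.fine, Instr.fine] at hnd
      have := len_le_ten hnd.1
      have := len_le_ten hnd.2
      have := hr s
      have := hr r
      simp only [Node.toInstr, Instr.cost]; omega
    | read r s =>
      simp [Node.fine, Instr.fine] at hnd
      have := len_le_ten hnd.1
      have := len_le_ten hnd.2
      have := hr s
      -- The entry of the input array is bounded only because it is the content of a register after
      -- the step.
      have h2 := len_mono (hR'.2 r)
      have e : (Node.step (ramSem x V) (pc, R) (Node.act (Instr.read r s))).2 r =
          x.getD (R s) 0 := by simp [Node.step, ramSem, Instr.effect]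
      rw [e] at h2
      simp only [Node.toInstr, Instr.cost]; omega
    | add r s t =>
      simp [Node.fine, Instr.fine] at hnd
      have := len_le_ten hnd.1.1
      have := len_le_ten hnd.1.2
      have := len_le_ten hnd.2
      have := hr s
      have := hr t
      simp only [Node.toInstr, Instr.cost]; omega
    | sub r s t =>
      simp [Node.fine, Instr.fine] at hnd
      have := len_le_ten hnd.1.1
      have := len_le_ten hnd.1.2
      have := len_le_ten hnd.2
      have := hr s
      have := hr t
      simp only [Node.toInstr, Instr.cost]; omega
    | mul r s t =>
      simp [Node.fine, Instr.fine] at hnd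
      have := len_le_ten hnd.1.1
      have := len_le_ten hnd.1.2
      have := len_le_ten hnd.2
      have := hm s t
      simp only [Node.toInstr, Instr.cost]; omega
    | div r s t =>
      simp [Node.fine, Instr.fine] at hnd
      have := len_le_ten hnd.1.1
      have := len_le_ten hnd.1.2
      have := len_le_ten hnd.2
      have := hm s t
      simp only [Node.toInstr, Instr.cost]; omega
    | jumpZero r k => simp [Node.fine, Instr.fine] at hnd
    | halt b => simp [Node.fine, Instr.fine] at hnd
  · simp [Node.fine] at hnd
    have := len_le_ten hnd.1
    have := len_le_ten hnd.2
    have := hr r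
    simp only [Node.toInstr, Instr.cost]; omega
  · simp [Node.fine] at hnd
    have := len_le_ten hnd
    have := hr 0
    have := len_le_ten (k := 0) (by norm_num)
    simp only [Node.toInstr, Instr.cost]; omega

theorem Node.ramStep_eq {x : List ℕ} {V : ℕ} {R : ℕ → ℕ} {pc τ : ℕ} {P : List Instr}
    (nd : Node Instr ℕ) (hnd : nd.fine = true) (hR : (ramSem x V).inv R)
    (hP : P[pc]? = some nd.toInstr) :
    ramStep P x ⟨pc, R, τ⟩ = ⟨(nd.step (ramSem x V) (pc, R)).1, (nd.step (ramSem x V) (pc, R)).2,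
      τ + nd.toInstr.cost x R⟩ := by
  unfold ramStep
  simp only [hP]
  rcases nd with a | ⟨r, k⟩ | k
  · cases a <;> first | rfl | simp [Node.fine, Instr.fine] at hnd
  · simp only [Node.toInstr, Instr.next, Instr.effect, Node.step, ramSem]
    by_cases h : R r = 0 <;> simp [h]
  · simp only [Node.toInstr, Instr.next, Instr.effect, Node.step]
    rw [if_pos hR.1]

theorem Reach.inv_left {A B S : Type} {M : Sem A B S} {code : List (Node A B)} {y z : ℕ × S} {n : ℕ}
    (h : Reach M code y z n) : M.inv y.2 := by
  cases h <;> assumption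

theorem ram_reach {x : List ℕ} {V : ℕ} {code : List (Node Instr ℕ)} {P : List Instr}
    (hcode : ∀ nd ∈ code, nd.fine = true) (hP : ∀ (i : ℕ) (nd : Node Instr ℕ), code[i]? = some nd →
      P[i]? = some nd.toInstr) {y z : ℕ × (ℕ → ℕ)} {n : ℕ} (h : Reach (ramSem x V) code y z n) :
    ∀ τ, ∃ τ' ≤ τ + n * (40 * len V ^ 2),
      (ramStep P x)^[n] ⟨y.1, y.2, τ⟩ = ⟨z.1, z.2, τ'⟩ := by
  induction h with
  | refl y _ => intro τ; exact ⟨τ, by omega, rfl⟩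
  | @head y z n nd h1 h2 h3 ih =>
    intro τ
    have hf := hcode nd (List.mem_of_getElem? h1)
    have hc := nd.cost_le hf h2 h3.inv_left
    obtain ⟨τ', h4, h5⟩ := ih (τ + nd.toInstr.cost x y.2)
    refine ⟨τ', ?_, ?_⟩
    · rw [Nat.succ_mul]; omega
    · rw [Function.iterate_succ_apply, nd.ramStep_eq hf h2 (hP _ _ h1)]
      exact h5

/-- The program that runs `c` and then answers whether the register `r` contains `0`. -/
def ramProgram (c : Cmd Instr ℕ) (r : ℕ) : List Instr :=
  ((c.comp 0).map Node.toInstr) ++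
    [Instr.jumpZero r (c.size + 2), Instr.halt false, Instr.halt true]

/-- The final jump is the one additional instruction in the bound; the time is taken on arrival at a
halting instruction, so halting itself adds nothing. -/
theorem ramProgram_answers {x : List ℕ} {V : ℕ} {c : Cmd Instr ℕ} {r : ℕ}
    (hc : (c.comp 0).all Node.fine = true) (hr : r < 1024) (hs : c.size < 1000) {R : ℕ → ℕ} {n : ℕ}
    (h : Within (ramSem x V) c (fun _ => 0) R n) :
    RAMAnswers (ramProgram c r) x (R r == 0) ((n + 1) * (40 * len V ^ 2)) := by
  obtain ⟨k, hk, h⟩ := h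
  have hP : ∀ (i : ℕ) (nd : Node Instr ℕ), (c.comp 0)[i]? = some nd → (ramProgram c r)[i]? = some nd.toInstr := by
    intro i nd hi
    have hlt : i < (c.comp 0).length := (List.getElem?_eq_some_iff.1 hi).1
    rw [ramProgram, List.getElem?_append_left (by simpa using hlt), List.getElem?_map, hi]
    rfl
  obtain ⟨τ, h1, h2⟩ := ram_reach (List.all_eq_true.1 hc) hP
    (h.reach (c.comp 0) 0 [] [] (by simp) rfl) 0
  have hl : (ramProgram c r)[0 + c.size]? = some (Node.branch r (c.size + 2)).toInstr := by
    rw [ramProgram, List.getElem?_append_right (by simp [Cmd.length_comp])]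
    simp [Cmd.length_comp, Node.toInstr]
  have hf : (Node.branch r (c.size + 2) : Node Instr ℕ).fine = true := by
    simp [Node.fine]; omega
  have h3 := Node.ramStep_eq (τ := τ) (Node.branch r (c.size + 2)) hf h.inv_right hl
  have h4 := (Node.branch r (c.size + 2)).cost_le (pc := 0) hf h.inv_right h.inv_right
  have h5 := h3
  rw [← show ramRun (ramProgram c r) x k = ⟨0 + c.size, R, τ⟩ from h2] at h5
  replace h5 : ramRun (ramProgram c r) x (k + 1) = _ :=
    (Function.iterate_succ_apply' (ramStep (ramProgram c r) x) k _).trans h5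
  refine ⟨k + 1, ?_, ?_⟩
  · rw [h5]
    simp only [Node.step, ramSem]
    by_cases h0 : R r = 0
    · simp only [h0, bne_self_eq_false, Bool.false_eq_true, if_false]
      rw [ramProgram, List.getElem?_append_right (by simp [Cmd.length_comp])]
      simp [Cmd.length_comp]
    · have : (R r != 0) = true := by simpa using h0
      simp only [this, if_true]
      rw [ramProgram, List.getElem?_append_right (by simp [Cmd.length_comp])]
      simp [Cmd.length_comp, h0]
  · rw [h5]
    simp only
    have := Nat.mul_le_mul_right (40 * len V ^ 2) hk
    rw [Nat.succ_mul]
    omega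

/-! ### Named registers and two arrays -/

/-- The registers `1, …, 14`, and two arrays in the registers from `16` on. -/
structure RS where
  one : ℕ := 0
  n : ℕ := 0
  e : ℕ := 0
  ptr : ℕ := 0
  cnt : ℕ := 0
  x : ℕ := 0
  y : ℕ := 0
  D : ℕ := 0
  C : ℕ := 0
  f : ℕ := 0
  q : ℕ := 0
  p : ℕ := 0
  k : ℕ := 0
  m : ℕ := 0
  W : ℕ → ℕ := fun _ => 0
  S : ℕ → ℕ := fun _ => 0

/-- The contents of the registers. -/
def RS.get (s : RS) : ℕ → ℕ
  | 0 => 0 | 1 => s.one | 2 => s.n | 3 => s.e | 4 => s.ptr | 5 => s.cnt | 6 => s.x | 7 => s.y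
  | 8 => s.D | 9 => s.C | 10 => s.f | 11 => s.q | 12 => s.p | 13 => s.k | 14 => s.m | 15 => 0
  | r + 16 => if r % 2 = 0 then s.W (r / 2) else s.S (r / 2)

/-- Change the contents of a named register. -/
def RS.set (s : RS) (r v : ℕ) : RS :=
  match r with
  | 1 => { s with one := v } | 2 => { s with n := v } | 3 => { s with e := v }
  | 4 => { s with ptr := v } | 5 => { s with cnt := v } | 6 => { s with x := v }
  | 7 => { s with y := v } | 8 => { s with D := v } | 9 => { s with C := v }
  | 10 => { s with f := v } | 11 => { s with q := v } | 12 => { s with p := v }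
  | 13 => { s with k := v } | 14 => { s with m := v } | _ => s

/-- Change the contents of a register that belongs to an array. -/
def RS.put (s : RS) (a v : ℕ) : RS :=
  if (a - 16) % 2 = 0 then { s with W := Function.update s.W ((a - 16) / 2) v }
  else { s with S := Function.update s.S ((a - 16) / 2) v }

/-- The two arrays are interleaved, so that both can grow without bound. Addresses are written with
`u + u` because the programs compute them by addition. -/
theorem RS.get_W (s : RS) (u : ℕ) : s.get (u + u + 16) = s.W u := by
  have h1 : (u + u) % 2 = 0 := by omega
  have h2 : (u + u) / 2 = u := by omega
  simp [RS.get, h1, h2]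

theorem RS.get_S (s : RS) (u : ℕ) : s.get (u + u + 17) = s.S u := by
  have h1 : (u + u + 1) % 2 = 1 := by omega
  have h2 : (u + u + 1) / 2 = u := by omega
  change s.get ((u + u + 1) + 16) = _
  simp [RS.get, h1, h2]

theorem RS.put_W (s : RS) (u v : ℕ) :
    s.put (u + u + 16) v = { s with W := Function.update s.W u v } := by
  have h1 : (u + u + 16 - 16) % 2 = 0 := by omega
  have h2 : (u + u + 16 - 16) / 2 = u := by omega
  rw [RS.put, if_pos h1, h2]

theorem RS.put_S (s : RS) (u v : ℕ) :
    s.put (u + u + 17) v = { s with S := Function.update s.S u v } := by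
  have h1 : ¬ (u + u + 17 - 16) % 2 = 0 := by omega
  have h2 : (u + u + 17 - 16) / 2 = u := by omega
  rw [RS.put, if_neg h1, h2]

theorem RS.get_set (s : RS) (r v : ℕ) (h1 : 1 ≤ r) (h2 : r ≤ 14) :
    (s.set r v).get = Function.update s.get r v := by
  funext i
  by_cases hi : i < 16
  · interval_cases r <;> interval_cases i <;> rfl
  · obtain ⟨j, rfl⟩ := Nat.exists_eq_add_of_le' (not_lt.1 hi)
    rw [Function.update_of_ne (by omega)]
    interval_cases r <;> rfl

theorem RS.get_put (s : RS) (a v : ℕ) (ha : 16 ≤ a) :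
    (s.put a v).get = Function.update s.get a v := by
  obtain ⟨b, rfl⟩ := Nat.exists_eq_add_of_le' ha
  funext i
  by_cases hi : i < 16
  · rw [Function.update_of_ne (by omega)]
    unfold RS.put
    split_ifs <;> interval_cases i <;> rfl
  · obtain ⟨j, rfl⟩ := Nat.exists_eq_add_of_le' (not_lt.1 hi)
    unfold RS.put
    rw [Nat.add_sub_cancel]
    by_cases hij : j = b
    · subst hij
      rw [Function.update_self]
      split_ifs with hb <;> simp [RS.get, hb]
    · rw [Function.update_of_ne (by omega)]
      split_ifs with hb
      · by_cases hj : j % 2 = 0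
        · have : j / 2 ≠ b / 2 := by omega
          simp [RS.get, hj, this]
        · simp [RS.get, hj]
      · by_cases hj : j % 2 = 0
        · simp [RS.get, hj]
        · have : j / 2 ≠ b / 2 := by omega
          simp [RS.get, hj, this]

/-- The effect of an instruction on named registers and arrays. -/
def RS.exec (x : List ℕ) (s : RS) : Instr → RS
  | Instr.const r k => s.set r k
  | Instr.copy r t => s.set r (s.get t)
  | Instr.load r t => s.set r (s.get (s.get t))
  | Instr.store r t => s.put (s.get r) (s.get t)
  | Instr.read r t => s.set r (x.getD (s.get t) 0)
  | Instr.add r t u => s.set r (s.get t + s.get u)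
  | Instr.sub r t u => s.set r (s.get t - s.get u)
  | Instr.mul r t u => s.set r (s.get t * s.get u)
  | Instr.div r t u => s.set r (s.get t / s.get u)
  | _ => s

/-- The target of the instruction is a named register. -/
def Instr.named : Instr → Bool
  | Instr.const r _ | Instr.copy r _ | Instr.load r _ | Instr.read r _ | Instr.add r _ _
  | Instr.sub r _ _ | Instr.mul r _ _ | Instr.div r _ _ => 1 ≤ r && r ≤ 14
  | _ => true

/-- The result of the instruction is at most `V`, and it is stored in an array if it is stored. -/
def Instr.Safe (x : List ℕ) (V : ℕ) (s : RS) : Instr → Prop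
  | Instr.const _ k => k ≤ V
  | Instr.store r _ => 16 ≤ s.get r
  | Instr.read _ t => x.getD (s.get t) 0 ≤ V
  | Instr.add _ t u => s.get t + s.get u ≤ V
  | Instr.mul _ t u => s.get t * s.get u ≤ V
  | _ => True

/-- All numbers are at most `V`. -/
def RS.Le (V : ℕ) (s : RS) : Prop := ∀ r, s.get r ≤ V

theorem RS.Le.inv {x : List ℕ} {V : ℕ} {s : RS} (h : s.Le V) : (ramSem x V).inv s.get := ⟨rfl, h⟩

theorem RS.Le.set {V : ℕ} {s : RS} (h : s.Le V) {r v : ℕ} (h1 : 1 ≤ r) (h2 : r ≤ 14)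
    (hv : v ≤ V) : (s.set r v).Le V := by
  intro i
  rw [RS.get_set s r v h1 h2]
  by_cases hi : i = r
  · subst hi; simpa using hv
  · rw [Function.update_of_ne hi]; exact h i

theorem RS.Le.put {V : ℕ} {s : RS} (h : s.Le V) {a v : ℕ} (ha : 16 ≤ a)
    (hv : v ≤ V) : (s.put a v).Le V := by
  intro i
  rw [RS.get_put s a v ha]
  by_cases hi : i = a
  · subst hi; simpa using hv
  · rw [Function.update_of_ne hi]; exact h i

theorem within_act {x : List ℕ} {V : ℕ} {s : RS} (hs : s.Le V) (a : Instr) (ha : a.named = true)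
    (h : a.Safe x V s) :
    Within (ramSem x V) (Cmd.act a) s.get (s.exec x a).get 1 ∧ (s.exec x a).Le V := by
  have key : (ramSem x V).act a s.get = (s.exec x a).get ∧ (s.exec x a).Le V := by
    cases a with
    | store r t => exact ⟨(RS.get_put s _ _ h).symm, hs.put h (hs _)⟩
    | jumpZero r k => exact ⟨rfl, hs⟩
    | halt b => exact ⟨rfl, hs⟩
    | const r k =>
      simp only [Instr.named, Bool.and_eq_true, decide_eq_true_eq] at ha
      exact ⟨(RS.get_set s _ _ ha.1 ha.2).symm, hs.set ha.1 ha.2 h⟩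
    | copy r t =>
      simp only [Instr.named, Bool.and_eq_true, decide_eq_true_eq] at ha
      exact ⟨(RS.get_set s _ _ ha.1 ha.2).symm, hs.set ha.1 ha.2 (hs _)⟩
    | load r t =>
      simp only [Instr.named, Bool.and_eq_true, decide_eq_true_eq] at ha
      exact ⟨(RS.get_set s _ _ ha.1 ha.2).symm, hs.set ha.1 ha.2 (hs _)⟩
    | read r t =>
      simp only [Instr.named, Bool.and_eq_true, decide_eq_true_eq] at ha
      exact ⟨(RS.get_set s _ _ ha.1 ha.2).symm, hs.set ha.1 ha.2 h⟩
    | add r t u =>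
      simp only [Instr.named, Bool.and_eq_true, decide_eq_true_eq] at ha
      exact ⟨(RS.get_set s _ _ ha.1 ha.2).symm, hs.set ha.1 ha.2 h⟩
    | sub r t u =>
      simp only [Instr.named, Bool.and_eq_true, decide_eq_true_eq] at ha
      exact ⟨(RS.get_set s _ _ ha.1 ha.2).symm, hs.set ha.1 ha.2 ((Nat.sub_le _ _).trans (hs _))⟩
    | mul r t u =>
      simp only [Instr.named, Bool.and_eq_true, decide_eq_true_eq] at ha
      exact ⟨(RS.get_set s _ _ ha.1 ha.2).symm, hs.set ha.1 ha.2 h⟩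
    | div r t u =>
      simp only [Instr.named, Bool.and_eq_true, decide_eq_true_eq] at ha
      exact ⟨(RS.get_set s _ _ ha.1 ha.2).symm, hs.set ha.1 ha.2 ((Nat.div_le_self _ _).trans (hs _))⟩
  exact ⟨Within.act a hs.inv key.1 key.2.inv, key.2⟩

/-- A sequence of instructions. -/
def block : List Instr → Cmd Instr ℕ
  | [] => Cmd.skip
  | a :: l => Cmd.seq (Cmd.act a) (block l)

/-- All instructions of the sequence are safe. -/
def SafeBlock (x : List ℕ) (V : ℕ) : List Instr → RS → Prop
  | [], _ => True
  | a :: l, s => a.Safe x V s ∧ SafeBlock x V l (s.exec x a)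

theorem within_block {x : List ℕ} {V : ℕ} (l : List Instr) {s s' : RS}
    (hs : s.Le V) (hl : l.all Instr.named = true) (h : SafeBlock x V l s)
    (h' : l.foldl (RS.exec x) s = s') :
    Within (ramSem x V) (block l) s.get s'.get l.length ∧ s'.Le V := by
  induction l generalizing s with
  | nil => subst h'; exact ⟨Within.skip hs.inv, hs⟩
  | cons a l ih =>
    simp only [List.all_cons, Bool.and_eq_true] at hl
    obtain ⟨h1, h2⟩ := within_act hs a hl.1 h.1
    obtain ⟨h3, h4⟩ := ih h2 hl.2 h.2 h'
    exact ⟨(h1.seq h3).mono (by simp; omega), h4⟩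

end

end UnaryUFA

/-! ### Time: the counting program and its running time -/

namespace UnaryUFA

section

/-! ### A calculus for programs of random access machines -/

/-- `c` leads from `s` to `s'` in at most `m` instructions, with numbers at most `V`. -/
def Runs (x : List ℕ) (V : ℕ) (c : Cmd Instr ℕ) (s s' : RS) (m : ℕ) : Prop :=
  s.Le V → Within (ramSem x V) c s.get s'.get m ∧ s'.Le V

namespace Runs

variable {x : List ℕ} {V : ℕ} {c d : Cmd Instr ℕ} {s s' s'' : RS} {m k r : ℕ}

theorem mono (h : Runs x V c s s' m) (hm : m ≤ k) : Runs x V c s s' k :=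
  fun hs => ⟨(h hs).1.mono hm, (h hs).2⟩

theorem skip : Runs x V Cmd.skip s s 0 := fun hs => ⟨Within.skip hs.inv, hs⟩

theorem seq (h : Runs x V c s s' m) (h' : Runs x V d s' s'' k) :
    Runs x V (Cmd.seq c d) s s'' (m + k) :=
  fun hs => ⟨(h hs).1.seq (h' (h hs).2).1, (h' (h hs).2).2⟩

theorem ite_true (hr : s.get r ≠ 0) (h : Runs x V c s s' m) :
    Runs x V (Cmd.ite r c d) s s' (m + 2) :=
  fun hs => ⟨(h hs).1.ite_true (by simpa [ramSem] using hr), (h hs).2⟩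

theorem ite_false (hr : s.get r = 0) (h : Runs x V d s s' m) :
    Runs x V (Cmd.ite r c d) s s' (m + 1) :=
  fun hs => ⟨(h hs).1.ite_false (by simpa [ramSem] using hr), (h hs).2⟩

theorem loop (F : ℕ → RS) (K : ℕ → ℕ) (T : ℕ) (h1 : ∀ t < T, (F t).get r ≠ 0)
    (h2 : (F T).get r = 0) (h3 : ∀ t < T, Runs x V c (F t) (F (t + 1)) (K t)) :
    Runs x V (Cmd.loop r c) (F 0) (F T) (∑ t ∈ Finset.range T, (K t + 2) + 1) := by
  intro hs
  have hle : ∀ t ≤ T, (F t).Le V := by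
    intro t
    induction t with
    | zero => exact fun _ => hs
    | succ t ih => exact fun ht => (h3 t ht (ih (by omega))).2
  exact ⟨Within.for_loop (fun t => (F t).get) K T (hle T le_rfl).inv
    (fun t ht => by simpa [ramSem] using h1 t ht) (by simpa [ramSem] using h2)
    (fun t ht => (h3 t ht (hle t ht.le)).1), hle T le_rfl⟩

theorem block (l : List Instr) (hl : l.all Instr.named = true) (h : SafeBlock x V l s)
    (h' : l.foldl (RS.exec x) s = s') : Runs x V (block l) s s' l.length :=
  fun hs => within_block l hs hl h h'

end Runs

namespace RS

theorem get_zero (s : RS) : s.get 0 = 0 := rfl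

theorem get_named (s : RS) :
    s.get 1 = s.one ∧
    s.get 2 = s.n ∧
    s.get 3 = s.e ∧
    s.get 4 = s.ptr ∧
    s.get 5 = s.cnt ∧
    s.get 6 = s.x ∧
    s.get 7 = s.y ∧
    s.get 8 = s.D ∧
    s.get 9 = s.C ∧
    s.get 10 = s.f ∧
    s.get 11 = s.q ∧
    s.get 12 = s.p ∧
    s.get 13 = s.k ∧
    s.get 14 = s.m :=
  ⟨rfl, rfl, rfl, rfl, rfl, rfl, rfl, rfl, rfl, rfl, rfl, rfl, rfl, rfl⟩

theorem set_named (s : RS) (v : ℕ) :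
    s.set 1 v = { s with one := v } ∧
    s.set 2 v = { s with n := v } ∧
    s.set 3 v = { s with e := v } ∧
    s.set 4 v = { s with ptr := v } ∧
    s.set 5 v = { s with cnt := v } ∧
    s.set 6 v = { s with x := v } ∧
    s.set 7 v = { s with y := v } ∧
    s.set 8 v = { s with D := v } ∧
    s.set 9 v = { s with C := v } ∧
    s.set 10 v = { s with f := v } ∧
    s.set 11 v = { s with q := v } ∧
    s.set 12 v = { s with p := v } ∧
    s.set 13 v = { s with k := v } ∧
    s.set 14 v = { s with m := v } :=
  ⟨rfl, rfl, rfl, rfl, rfl, rfl, rfl, rfl, rfl, rfl, rfl, rfl, rfl, rfl⟩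

theorem get_array (s : RS) (u : ℕ) :
    s.get (u + u + 16) = s.W u ∧ s.get (u + u + 17) = s.S u :=
  ⟨s.get_W u, s.get_S u⟩

theorem put_array (s : RS) (u v : ℕ) :
    s.put (u + u + 16) v = { s with W := Function.update s.W u v } ∧
      s.put (u + u + 17) v = { s with S := Function.update s.S u v } :=
  ⟨s.put_W u v, s.put_S u v⟩

end RS

/-! ### The description of an automaton as functions on the natural numbers -/

/-- The numbers of states and transitions, for each state whether it is initial and whether it is
accepting, and the sources and targets of the transitions. -/
structure Table where
  n : ℕ
  e : ℕ
  st : ℕ → ℕ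
  ac : ℕ → ℕ
  src : ℕ → ℕ
  tgt : ℕ → ℕ

namespace Table

/-- The number of the first `k` transitions that enter a state, and whether it is initial. -/
def W (T : Table) : ℕ → ℕ → ℕ
  | 0, u => if u < T.n then T.st u else 0
  | k + 1, u => Function.update (T.W k) (T.tgt k) (T.W k (T.tgt k) + 1) u

/-- The target of the last one of the first `k` transitions that leaves a state. -/
def S (T : Table) : ℕ → ℕ → ℕ
  | 0, _ => 0
  | k + 1, u => Function.update (T.S k) (T.src k) (T.tgt k) u

/-- The number of the states among the first `t` that are not accepting. -/
def D (T : Table) (t : ℕ) : ℕ := ∑ u ∈ Finset.range t, (1 - T.ac u)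

/-- The `j`-th successor of a state. -/
def orbit (T : Table) (u j : ℕ) : ℕ := (T.S T.e)^[j] u

/-- The contribution of the `j`-th successor of `f` to the number of the pairs of a time `t ≤ n`
and a cycle that is in an accepting state at the time `t`. The length of the cycle is `P`. -/
def hits (T : Table) (f P j : ℕ) : ℕ := if T.ac (T.orbit f j) = 0 then 0 else (T.n - j) / P + 1

/-- Whether the `j`-th successor of `f` is not accepting. -/
def misses (T : Table) (f j : ℕ) : ℕ := 1 - T.ac (T.orbit f j)

/-- The array `x` contains the description of an automaton. -/
structure In (T : Table) (x : List ℕ) : Prop where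
  n_eq : x.getD 0 0 = T.n
  e_eq : x.getD 1 0 = T.e
  st_eq : ∀ u < T.n, x.getD (2 + 2 * u) 0 = T.st u
  ac_eq : ∀ u < T.n, x.getD (3 + 2 * u) 0 = T.ac u
  src_eq : ∀ k < T.e, x.getD (2 + 2 * T.n + 2 * k) 0 = T.src k
  tgt_eq : ∀ k < T.e, x.getD (3 + 2 * T.n + 2 * k) 0 = T.tgt k
  st_le : ∀ u, T.st u ≤ 1
  ac_le : ∀ u, T.ac u ≤ 1
  src_lt : ∀ k < T.e, T.src k < T.n
  tgt_lt : ∀ k < T.e, T.tgt k < T.n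
  e_le : T.e ≤ 2 * T.n

variable {T : Table} {x : List ℕ}

theorem In.W_le (hT : T.In x) (k u : ℕ) : T.W k u ≤ k + 1 := by
  induction k generalizing u with
  | zero => unfold W; split_ifs <;> simp [hT.st_le]
  | succ k ih =>
    unfold W
    by_cases h : u = T.tgt k
    · subst h; simp [ih]
    · rw [Function.update_of_ne h]; exact (ih u).trans (by omega)

/-- States without a recorded successor have the default `0`, which is a state only if there is any.
-/
theorem In.S_lt (hT : T.In x) (hn : 0 < T.n) {k : ℕ} (hk : k ≤ T.e) (u : ℕ) : T.S k u < T.n := by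
  induction k generalizing u with
  | zero => exact hn
  | succ k ih =>
    unfold S
    by_cases h : u = T.src k
    · subst h; simpa using hT.tgt_lt k hk
    · rw [Function.update_of_ne h]; exact ih (by omega) u

theorem In.orbit_lt (hT : T.In x) {u : ℕ} (hu : u < T.n) (j : ℕ) : T.orbit u j < T.n := by
  cases j with
  | zero => exact hu
  | succ j =>
    rw [orbit, Function.iterate_succ_apply']
    exact hT.S_lt (by omega) le_rfl _

theorem orbit_succ (T : Table) (u j : ℕ) : T.orbit u (j + 1) = T.S T.e (T.orbit u j) := by
  rw [orbit, Function.iterate_succ_apply', orbit]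

theorem D_le (T : Table) (t : ℕ) : T.D t ≤ t := by
  refine (Finset.sum_le_card_nsmul _ _ 1 (fun u _ => by omega)).trans (by simp)

end Table

/-! ### The program for universality -/

/-- Read the numbers of states and transitions. -/
def readHeader : Cmd Instr ℕ := block [.const 1 1, .read 2 0, .read 3 1, .const 4 2, .copy 5 2]

/-- Read which states are initial, and count the states that are not accepting. -/
def readStates : Cmd Instr ℕ := .loop 5 <| block
  -- The initial bit goes to the entry of `W` in register 2f + 16, and register `8` grows by 1 minus
  -- the accepting bit. Scratch registers are cleared, so that every passage ends in a configuration
  -- of the same shape.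
  [.read 6 4, .add 7 10 10, .const 13 16, .add 7 7 13, .store 7 6, .add 4 4 1, .read 6 4,
    .sub 6 1 6, .add 8 8 6, .add 4 4 1, .add 10 10 1, .sub 5 5 1, .const 6 0, .const 7 0,
    .const 13 0]

/-- Read the transitions. -/
def readEdges : Cmd Instr ℕ := .seq (block [.copy 5 3, .const 10 0]) <| .loop 5 <| block
  -- The target is stored as the successor of the source, in the array with offset 17; then the
  -- entry of the target in the array with offset 16 is increased by one.
  [.read 6 4, .add 4 4 1, .read 7 4, .add 4 4 1, .add 13 6 6, .const 14 17, .add 13 13 14,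
    .store 13 7, .add 13 7 7, .const 14 16, .add 13 13 14, .load 6 13, .add 6 6 1, .store 13 6,
    .sub 5 5 1, .const 6 0, .const 7 0, .const 13 0, .const 14 0]

/-- Measure the length of a cycle. -/
def measureCycle : Cmd Instr ℕ :=
  .seq (block [.copy 11 10, .const 13 1, .const 6 0, .const 7 0]) <| .loop 13 <| block
    -- The sum of the two truncated differences is the distance from the current state to the first
    -- one; it vanishes on the return. The initial value `1` of register `13` forces the first
    -- passage.
    [.add 6 11 11, .const 7 17, .add 6 6 7, .load 11 6, .add 12 12 1, .sub 13 11 10, .sub 6 10 11,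
      .add 13 13 6, .const 6 0, .const 7 0]

/-- Evaluate a state of a cycle. -/
def evalState : Cmd Instr ℕ :=
  .seq (block [.add 6 11 11, .const 7 3, .add 6 6 7, .read 6 6]) <| .seq
    -- An accepting state adds its number of visits at times up to n, where register `14` holds n -
    -- j. A rejecting state is removed from the count, so that in the end only rejecting states of
    -- the stem remain in register `8`.
    (.ite 6 (block [.div 6 14 12, .add 9 9 6, .add 9 9 1, .const 6 0]) (block [.sub 8 8 1])) <|
    block [.sub 14 14 1, .add 6 11 11, .const 7 17, .add 6 6 7, .load 11 6, .const 6 0, .const 7 0,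
      .sub 13 13 1]

/-- Evaluate the states of a cycle. -/
def evalCycle : Cmd Instr ℕ :=
  .seq (block [.copy 13 12, .copy 14 2]) <| .seq (.loop 13 evalState) <|
    block [.const 11 0, .const 12 0, .const 14 0]

/-- Process a state, which is perhaps the first state of a cycle. -/
def processState : Cmd Instr ℕ :=
  .seq (block [.add 6 10 10, .const 7 16, .add 6 6 7, .load 6 6, .sub 6 6 1]) <| .seq
    (.ite 6 (.seq measureCycle evalCycle) .skip) <|
    block [.const 6 0, .const 7 0, .add 10 10 1, .sub 5 5 1]

/-- Process all states. -/
def processStates : Cmd Instr ℕ := .seq (block [.copy 5 2, .const 10 0]) (.loop 5 processState)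

/-- The final comparison. -/
def compareCounts : Cmd Instr ℕ :=
  -- The result is the distance between the count and n + 1, plus the number of remaining rejecting
  -- states; it is `0` exactly if both conditions hold.
  block [.add 2 2 1, .sub 6 9 2, .sub 7 2 9, .add 6 6 7, .add 6 6 8]

/-- The program for universality. -/
def universalityCmd : Cmd Instr ℕ :=
  .seq readHeader <| .seq readStates <| .seq readEdges <| .seq processStates compareCounts

theorem universalityCmd_fine : (universalityCmd.comp 0).all Node.fine = true := by rfl

theorem universalityCmd_size : universalityCmd.size < 1000 := by
  simp [universalityCmd, readHeader, readStates, readEdges, processStates, processState, compareCounts,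
    measureCycle, evalCycle, evalState, Cmd.size, block]

/-! ### The specification of the program -/


section spec

variable {T : Table} {x : List ℕ} {V : ℕ}

theorem runs_readHeader (hT : T.In x) (hV : 20 * (T.n + 40) ≤ V) :
    Runs x V readHeader {} { one := 1, n := T.n, e := T.e, ptr := 2, cnt := T.n } 5 := by
  have h1 := hT.n_eq
  have h2 := hT.e_eq
  have h3 := hT.e_le
  refine Runs.block _ rfl ?_ ?_
  · simp only [SafeBlock, Instr.Safe, RS.exec, RS.get_zero, RS.get_named, RS.set_named, h1, h2,
      and_true]
    omega
  · simp only [List.foldl, RS.exec, RS.get_zero, RS.get_named, RS.set_named, h1, h2]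

/-- The registers after `t` states have been read. -/
def Table.readingStates (T : Table) (t : ℕ) : RS :=
  { one := 1, n := T.n, e := T.e, ptr := 2 + 2 * t, cnt := T.n - t, f := t, D := T.D t
    W := fun u => if u < t then T.st u else 0 }

theorem runs_readStates (hT : T.In x) (hV : 20 * (T.n + 40) ≤ V) :
    Runs x V readStates (T.readingStates 0) (T.readingStates T.n)
      (∑ _t ∈ Finset.range T.n, (15 + 2) + 1) := by
  refine Runs.loop T.readingStates (fun _ => 15) T.n ?_ ?_ fun t ht => ?_
  · intro t ht; simp [Table.readingStates, RS.get_named]; omega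
  · simp [Table.readingStates, RS.get_named]
  have h1 := hT.st_eq t ht
  have h2 := hT.ac_eq t ht
  have h3 := hT.st_le t
  have h4 := hT.ac_le t
  have h5 := T.D_le t
  have h6 : 2 + 2 * t + 1 = 3 + 2 * t := by omega
  have h7 : 3 + 2 * t + 1 = 2 + 2 * (t + 1) := by omega
  have h8 : Function.update (fun u => if u < t then T.st u else 0) t (T.st t) =
      fun u => if u < t + 1 then T.st u else 0 := by
    funext u
    by_cases hu : u = t
    · subst hu; simp
    · rw [Function.update_of_ne hu]
      have : u < t ↔ u < t + 1 := by omega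
      simp [this]
  have h9 : T.D (t + 1) = T.D t + (1 - T.ac t) := Finset.sum_range_succ _ _
  refine Runs.block _ rfl ?_ ?_
  · simp only [SafeBlock, Instr.Safe, RS.exec, Table.readingStates, RS.get_named, RS.set_named,
      RS.put_array, h1, h2, h6, and_true, true_and]
    omega
  · simp only [List.foldl, RS.exec, Table.readingStates, RS.get_named, RS.set_named, RS.put_array,
      h1, h2, h6, h7, h8, h9, Nat.sub_sub]

/-- The registers after `t` transitions have been read. -/
def Table.readingEdges (T : Table) (t : ℕ) : RS :=
  { one := 1, n := T.n, e := T.e, ptr := 2 + 2 * T.n + 2 * t, cnt := T.e - t, D := T.D T.n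
    W := T.W t, S := T.S t }

theorem runs_readEdges (hT : T.In x) (hV : 20 * (T.n + 40) ≤ V) :
    Runs x V readEdges (T.readingStates T.n) (T.readingEdges T.e)
      (2 + (∑ _t ∈ Finset.range T.e, (19 + 2) + 1)) := by
  have he := hT.e_le
  have hD := T.D_le T.n
  refine (Runs.block (s' := T.readingEdges 0) _ rfl ?_ ?_).seq
    (Runs.loop T.readingEdges (fun _ => 19) T.e ?_ ?_ fun t ht => ?_)
  · simp only [SafeBlock, Instr.Safe, and_true, true_and]
    omega
  · simp only [List.foldl, RS.exec, Table.readingStates, Table.readingEdges, RS.get_named,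
      RS.set_named, Nat.sub_zero, Nat.mul_zero, Nat.add_zero]
    rfl
  · intro t ht; simp [Table.readingEdges, RS.get_named]; omega
  · simp [Table.readingEdges, RS.get_named]
  have h1 := hT.src_eq t ht
  have h2 := hT.tgt_eq t ht
  have h3 := hT.src_lt t ht
  have h4 := hT.tgt_lt t ht
  have h5 := hT.W_le t (T.tgt t)
  have h6 : 2 + 2 * T.n + 2 * t + 1 = 3 + 2 * T.n + 2 * t := by omega
  have h7 : 3 + 2 * T.n + 2 * t + 1 = 2 + 2 * T.n + 2 * (t + 1) := by omega
  have h8 : Function.update (T.W t) (T.tgt t) (T.W t (T.tgt t) + 1) = T.W (t + 1) := rfl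
  have h9 : Function.update (T.S t) (T.src t) (T.tgt t) = T.S (t + 1) := rfl
  refine Runs.block _ rfl ?_ ?_
  · simp only [SafeBlock, Instr.Safe, RS.exec, Table.readingEdges, RS.get_named, RS.set_named,
      RS.put_array, RS.get_array, h1, h2, h6, and_true, true_and]
    omega
  · simp only [List.foldl, RS.exec, Table.readingEdges, RS.get_named, RS.set_named, RS.put_array,
      RS.get_array, h1, h2, h6, h7, h8, h9, Nat.sub_sub]

/-- The registers when the states before `f` have been processed. -/
def Table.processing (T : Table) (f C D : ℕ) : RS :=
  { one := 1, n := T.n, e := T.e, ptr := 2 + 2 * T.n + 2 * T.e, cnt := T.n - f, D := D, C := C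
    f := f, W := T.W T.e, S := T.S T.e }

/-- The registers after `j` steps along a cycle whose length is measured. -/
def Table.measuring (T : Table) (f C D j : ℕ) : RS :=
  { T.processing f C D with
    q := T.orbit f j, p := j
    k := if j = 0 then 1 else T.orbit f j - f + (f - T.orbit f j) }

/-- Minimality of `P` is what keeps the loop from stopping before a full round. -/
theorem runs_measureCycle (hT : T.In x) (hV : 20 * (T.n + 40) ≤ V) {f P : ℕ} (C D v w : ℕ)
    (hf : f < T.n) (hP : 0 < P) (hPn : P ≤ T.n) (h1 : T.orbit f P = f)
    (h2 : ∀ j, 0 < j → j < P → T.orbit f j ≠ f) :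
    Runs x V measureCycle { T.processing f C D with x := v, y := w } (T.measuring f C D P)
      (4 + (∑ _t ∈ Finset.range P, (10 + 2) + 1)) := by
  refine (Runs.block (s' := T.measuring f C D 0) _ rfl ?_ ?_).seq
    (Runs.loop (T.measuring f C D) (fun _ => 10) P ?_ ?_ fun j hj => ?_)
  · simp only [SafeBlock, Instr.Safe, and_true, true_and]
    omega
  · simp only [List.foldl, RS.exec, Table.processing, Table.measuring, RS.get_named, RS.set_named]
    rfl
  · intro j hj
    simp only [Table.measuring, RS.get_named]
    split_ifs with h0
    · omega
    · have := h2 j (by omega) hj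
      omega
  · simp only [Table.measuring, RS.get_named, h1]
    split_ifs <;> omega
  have h3 := hT.orbit_lt hf j
  have h4 := hT.orbit_lt hf (j + 1)
  have h5 := T.orbit_succ f j
  refine Runs.block _ rfl ?_ ?_
  · simp only [SafeBlock, Instr.Safe, RS.exec, Table.measuring, Table.processing, RS.get_named,
      RS.set_named, RS.get_array, ← h5, and_true, true_and]
    omega
  · simp only [List.foldl, RS.exec, Table.measuring, Table.processing, RS.get_named, RS.set_named,
      RS.get_array, ← h5, Nat.succ_ne_zero, if_false]

/-- The registers after `j` states of a cycle have been evaluated. -/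
def Table.evaluating (T : Table) (f C D P j : ℕ) : RS :=
  { T.processing f (C + ∑ i ∈ Finset.range j, T.hits f P i)
      (D - ∑ i ∈ Finset.range j, T.misses f i) with
    q := T.orbit f j, p := P, k := P - j, m := T.n - j }

theorem runs_evalState (hT : T.In x) (hV : 20 * (T.n + 40) ≤ V) {f P j : ℕ} (C D : ℕ)
    (hf : f < T.n) (hC : C + ∑ i ∈ Finset.range (j + 1), T.hits f P i ≤ V) :
    Runs x V evalState (T.evaluating f C D P j) (T.evaluating f C D P (j + 1)) 18 := by
  obtain ⟨C', hC'⟩ : ∃ C', C' = C + ∑ i ∈ Finset.range j, T.hits f P i := ⟨_, rfl⟩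
  obtain ⟨D', hD'⟩ : ∃ D', D' = D - ∑ i ∈ Finset.range j, T.misses f i := ⟨_, rfl⟩
  have hC'' : C + ∑ i ∈ Finset.range (j + 1), T.hits f P i = C' + T.hits f P j := by
    rw [Finset.sum_range_succ, hC', Nat.add_assoc]
  have hD'' : D - ∑ i ∈ Finset.range (j + 1), T.misses f i = D' - T.misses f j := by
    rw [Finset.sum_range_succ, hD', Nat.sub_sub]
  rw [hC''] at hC
  have h3 := hT.orbit_lt hf j
  have h4 := hT.orbit_lt hf (j + 1)
  have h5 := T.orbit_succ f j
  have h6 := hT.ac_eq _ h3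
  have h7 := hT.ac_le (T.orbit f j)
  have h8 : T.orbit f j + T.orbit f j + 3 = 3 + 2 * T.orbit f j := by omega
  unfold evalState
  simp only [Table.evaluating, hC'', hD'', ← hC', ← hD']
  refine ((Runs.block (s' := { T.processing f C' D' with
      q := T.orbit f j, p := P, k := P - j, m := T.n - j, x := T.ac (T.orbit f j), y := 3 })
    _ rfl ?_ ?_).seq
    (Runs.seq (m := 6) (s' := { T.processing f (C' + T.hits f P j) (D' - T.misses f j) with
      q := T.orbit f j, p := P, k := P - j, m := T.n - j, y := 3 }) ?_
      (Runs.block _ rfl ?_ ?_))).mono (by decide)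
  · simp only [SafeBlock, Instr.Safe, RS.exec, Table.processing, RS.get_named,
      RS.set_named, h8, h6, and_true]
    omega
  · simp only [List.foldl, RS.exec, Table.processing, RS.get_named, RS.set_named, h8, h6]
  · by_cases h0 : T.ac (T.orbit f j) = 0
    · have e1 : T.hits f P j = 0 := if_pos h0
      have e2 : T.misses f j = 1 := by simp [Table.misses, h0]
      rw [e1, e2, h0]
      refine ((Runs.ite_false rfl (Runs.block _ rfl ?_ ?_))).mono (by decide)
      · simp only [SafeBlock, Instr.Safe, and_true]
      · simp only [List.foldl, RS.exec, Table.processing, RS.get_named, RS.set_named, Nat.add_zero]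
    · have e1 : T.hits f P j = (T.n - j) / P + 1 := if_neg h0
      have e2 : T.misses f j = 0 := by simp only [Table.misses]; omega
      rw [e1] at hC
      rw [e1, e2]
      refine (Runs.ite_true ?_ (Runs.block _ rfl ?_ ?_)).mono (by decide)
      · exact h0
      · simp only [SafeBlock, Instr.Safe, RS.exec, Table.processing, RS.get_named, RS.set_named,
          and_true, true_and]
        omega
      · simp only [List.foldl, RS.exec, Table.processing, RS.get_named, RS.set_named, Nat.sub_zero,
          Nat.add_assoc]
  · simp only [SafeBlock, Instr.Safe, RS.exec, Table.processing, RS.get_named,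
      RS.set_named, and_true, true_and]
    omega
  · simp only [List.foldl, RS.exec, Table.processing, RS.get_named, RS.set_named, RS.get_array,
      ← h5, Nat.sub_sub]

theorem runs_evalCycle (hT : T.In x) (hV : 20 * (T.n + 40) ≤ V) {f P : ℕ} (C D : ℕ)
    (hf : f < T.n) (h1 : T.orbit f P = f)
    (hC : C + ∑ i ∈ Finset.range P, T.hits f P i ≤ V) :
    Runs x V evalCycle (T.measuring f C D P)
      (T.processing f (C + ∑ i ∈ Finset.range P, T.hits f P i)
        (D - ∑ i ∈ Finset.range P, T.misses f i))
      (2 + ((∑ _t ∈ Finset.range P, (18 + 2) + 1) + 3)) := by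
  refine (Runs.block (s' := T.evaluating f C D P 0) _ rfl ?_ ?_).seq
    ((Runs.loop (T.evaluating f C D P) (fun _ => 18) P ?_ ?_ fun j hj => ?_).seq
      (Runs.block _ rfl ?_ ?_))
  · simp only [SafeBlock, Instr.Safe, and_true]
  · have h0 : T.orbit f 0 = f := rfl
    simp only [List.foldl, RS.exec, Table.processing, Table.measuring, Table.evaluating,
      RS.get_named, RS.set_named, h1, h0, Finset.range_zero, Finset.sum_empty, Nat.sub_zero,
      Nat.add_zero]
  · intro j hj; simp only [Table.evaluating, RS.get_named]; omega
  · simp only [Table.evaluating, RS.get_named, Nat.sub_self]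
  · refine runs_evalState hT hV C D hf (le_trans ?_ hC)
    exact Nat.add_le_add_left (Finset.sum_le_sum_of_subset
      (Finset.range_subset_range.2 (by omega))) _
  · simp only [SafeBlock, Instr.Safe, and_true]
    omega
  · simp only [List.foldl, RS.exec, Table.processing, Table.evaluating, RS.set_named, Nat.sub_self]

/-- The contribution of the state `f`, if it is the first state of a cycle of length `per f`. -/
def Table.cycleHits (T : Table) (per : ℕ → ℕ) (f : ℕ) : ℕ :=
  if T.W T.e f ≤ 1 then 0 else ∑ i ∈ Finset.range (per f), T.hits f (per f) i

/-- The number of states that are not accepting on the cycle of length `per f` whose first state is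
`f`, if there is one. -/
def Table.cycleMisses (T : Table) (per : ℕ → ℕ) (f : ℕ) : ℕ :=
  if T.W T.e f ≤ 1 then 0 else ∑ i ∈ Finset.range (per f), T.misses f i

/-- The first state of each cycle is entered by two transitions, or it is initial and is entered by
one transition; `per` gives the lengths of the cycles. -/
structure Table.Cycles (T : Table) (per : ℕ → ℕ) : Prop where
  pos : ∀ f < T.n, 1 < T.W T.e f → 0 < per f
  le : ∀ f < T.n, 1 < T.W T.e f → per f ≤ T.n
  eq : ∀ f < T.n, 1 < T.W T.e f → T.orbit f (per f) = f
  ne : ∀ f < T.n, 1 < T.W T.e f → ∀ j, 0 < j → j < per f → T.orbit f j ≠ f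
  sum_le : ∑ f ∈ Finset.range T.n, (if T.W T.e f ≤ 1 then 0 else per f) ≤ T.n

variable {per : ℕ → ℕ}

theorem Table.hits_le (T : Table) (f P j : ℕ) : T.hits f P j ≤ T.n + 1 := by
  unfold Table.hits
  split_ifs
  · omega
  · exact Nat.add_le_add_right ((Nat.div_le_self _ _).trans (Nat.sub_le _ _)) 1

/-- A crude bound without unambiguity: only the number of digits of the counter matters, so any
polynomial will do. -/
theorem Table.Cycles.cycleHits_le (hc : T.Cycles per) {f : ℕ} (hf : f < T.n) :
    T.cycleHits per f ≤ T.n * (T.n + 1) := by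
  unfold Table.cycleHits
  split_ifs with h
  · exact Nat.zero_le _
  · refine (Finset.sum_le_card_nsmul _ _ (T.n + 1) fun i _ => T.hits_le f _ i).trans ?_
    rw [Finset.card_range, smul_eq_mul]
    exact Nat.mul_le_mul_right _ (hc.le f hf (not_le.1 h))

theorem Table.Cycles.sum_cycleHits_le (hc : T.Cycles per) {t : ℕ} (ht : t ≤ T.n) :
    ∑ f ∈ Finset.range t, T.cycleHits per f ≤ T.n * (T.n * (T.n + 1)) := by
  refine (Finset.sum_le_card_nsmul _ _ (T.n * (T.n + 1)) fun f hf => hc.cycleHits_le ?_).trans ?_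
  · rw [Finset.mem_range] at hf; omega
  · rw [Finset.card_range, smul_eq_mul]
    exact Nat.mul_le_mul_right _ ht

theorem runs_processState (hT : T.In x) (hc : T.Cycles per) (hV : 20 * (T.n + 40) ≤ V) {f : ℕ}
    (C D : ℕ) (hf : f < T.n) (hC : C + T.cycleHits per f ≤ V) :
    Runs x V processState (T.processing f C D)
      (T.processing (f + 1) (C + T.cycleHits per f) (D - T.cycleMisses per f))
      (30 + 32 * (if T.W T.e f ≤ 1 then 0 else per f)) := by
  have h1 := hT.W_le T.e f
  have h2 := hT.e_le
  have hb : ∀ C D v w, Runs x V (block [.const 6 0, .const 7 0, .add 10 10 1, .sub 5 5 1])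
      { T.processing f C D with x := v, y := w } (T.processing (f + 1) C D) 4 := by
    intro C D v w
    refine Runs.block _ rfl ?_ ?_
    · simp only [SafeBlock, Instr.Safe, RS.exec, Table.processing, RS.get_named, RS.set_named,
        and_true]
      omega
    · simp only [List.foldl, RS.exec, Table.processing, RS.get_named, RS.set_named, Nat.sub_sub]
  have ha : Runs x V (block [.add 6 10 10, .const 7 16, .add 6 6 7, .load 6 6, .sub 6 6 1])
      (T.processing f C D) { T.processing f C D with x := T.W T.e f - 1, y := 16 } 5 := by
    refine Runs.block _ rfl ?_ ?_
    · simp only [SafeBlock, Instr.Safe, RS.exec, Table.processing, RS.get_named, RS.set_named,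
        and_true]
      omega
    · simp only [List.foldl, RS.exec, Table.processing, RS.get_named, RS.set_named, RS.get_array]
  unfold Table.cycleHits at hC ⊢
  unfold Table.cycleMisses
  unfold processState
  by_cases h : T.W T.e f ≤ 1
  · simp only [if_pos h]
    refine (ha.seq ((Runs.ite_false ?_ Runs.skip).seq (hb C D (T.W T.e f - 1) 16))).mono (by decide)
    simp only [RS.get_named]
    omega
  · simp only [if_neg h] at hC ⊢
    have h' := not_le.1 h
    have h0 := hc.eq f hf h'
    refine (ha.seq ((Runs.ite_true ?_ ((runs_measureCycle hT hV C D _ 16 hf (hc.pos f hf h')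
      (hc.le f hf h') h0 (hc.ne f hf h')).seq (runs_evalCycle hT hV C D hf h0 hC))).seq
        (hb _ _ 0 0))).mono ?_
    · simp only [RS.get_named]
      omega
    -- Per state of the cycle, measuring takes 12 instructions and evaluating 20, with the control
    -- of the loops included.
    · simp only [Finset.sum_const, Finset.card_range, smul_eq_mul]
      omega

/-- The registers when all states have been processed. -/
def Table.processed (T : Table) (per : ℕ → ℕ) : RS :=
  T.processing T.n (∑ f ∈ Finset.range T.n, T.cycleHits per f)
    (T.D T.n - ∑ f ∈ Finset.range T.n, T.cycleMisses per f)

theorem runs_processStates (hT : T.In x) (hc : T.Cycles per) (hV : 20 * (T.n + 40) ≤ V)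
    (hV' : T.n * (T.n * (T.n + 1)) ≤ V) :
    Runs x V processStates (T.readingEdges T.e) (T.processed per)
      (2 + (∑ f ∈ Finset.range T.n, (30 + 32 * (if T.W T.e f ≤ 1 then 0 else per f) + 2) + 1)) := by
  refine (Runs.block (s' := T.processing 0 (∑ f ∈ Finset.range 0, T.cycleHits per f)
    (T.D T.n - ∑ f ∈ Finset.range 0, T.cycleMisses per f)) _ rfl ?_ ?_).seq
    (Runs.loop (fun t => T.processing t (∑ f ∈ Finset.range t, T.cycleHits per f)
      (T.D T.n - ∑ f ∈ Finset.range t, T.cycleMisses per f)) _ T.n ?_ ?_ fun t ht => ?_)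
  · simp only [SafeBlock, Instr.Safe, and_true, true_and]
    omega
  · simp only [List.foldl, RS.exec, Table.readingEdges, Table.processing, RS.get_named,
      RS.set_named, Finset.range_zero, Finset.sum_empty, Nat.sub_zero, Nat.sub_self]
  · intro t ht
    simp only [Table.processing, RS.get_named]
    omega
  · simp only [Table.processing, RS.get_named, Nat.sub_self]
  · simp only [Finset.sum_range_succ, ← Nat.sub_sub]
    refine runs_processState hT hc hV _ _ ht ?_
    rw [← Finset.sum_range_succ]
    exact (hc.sum_cycleHits_le ht).trans hV'

/-- The registers at the end. -/
def Table.compared (T : Table) (per : ℕ → ℕ) : RS :=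
  { T.processed per with
    n := T.n + 1
    x := ((T.processed per).C - (T.n + 1)) + ((T.n + 1) - (T.processed per).C) + (T.processed per).D
    y := (T.n + 1) - (T.processed per).C }

theorem runs_compareCounts (hc : T.Cycles per) (hV : 20 * (T.n + 40) ≤ V)
    (hV' : 2 * (T.n * (T.n * (T.n + 1))) ≤ V) :
    Runs x V compareCounts (T.processed per) (T.compared per) 5 := by
  have h1 := hc.sum_cycleHits_le le_rfl
  have h2 := T.D_le T.n
  refine Runs.block _ rfl ?_ ?_
  · simp only [SafeBlock, Instr.Safe, RS.exec, Table.processed, Table.processing, RS.get_named,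
      RS.set_named, and_true, true_and]
    generalize T.n * (T.n * (T.n + 1)) = H at h1 hV'
    generalize ∑ f ∈ Finset.range T.n, T.cycleHits per f = C at h1 ⊢
    omega
  · simp only [List.foldl, RS.exec, Table.compared, Table.processed, Table.processing,
      RS.get_named, RS.set_named]

/-- The number of instructions is linear because there are at most `2 * T.n` transitions and the
lengths of the cycles add up to at most `T.n`. -/
theorem runs_universalityCmd (hT : T.In x) (hc : T.Cycles per) (hV : 20 * (T.n + 40) ≤ V)
    (hV' : 2 * (T.n * (T.n * (T.n + 1))) ≤ V) :
    Runs x V universalityCmd {} (T.compared per) (200 * (T.n + 1)) := by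
  have h0 : ({ one := 1, n := T.n, e := T.e, ptr := 2, cnt := T.n } : RS) = T.readingStates 0 := by
    simp only [Table.readingStates, Table.D, Finset.range_zero, Finset.sum_empty, Nat.not_lt_zero,
      if_false]
    rfl
  refine ((h0 ▸ runs_readHeader hT hV).seq ((runs_readStates hT hV).seq
    ((runs_readEdges hT hV).seq ((runs_processStates hT hc hV (by omega)).seq
      (runs_compareCounts hc hV hV'))))).mono ?_
  have h1 := hc.sum_le
  have h2 := hT.e_le
  simp only [Finset.sum_add_distrib, ← Finset.mul_sum, Finset.sum_const, Finset.card_range,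
    smul_eq_mul]
  omega

end spec

end

end UnaryUFA

/-! ### Time: correctness of the counting -/

namespace UnaryUFA

section

/-! ### Counting -/

/-- The numbers up to `n` that are congruent to `j`. -/
theorem card_filter_mod (n P j : ℕ) (hj : j < P) (hjn : j ≤ n) :
    ((Finset.range (n + 1)).filter (fun t => t % P = j)).card = (n - j) / P + 1 := by
  have : (Finset.range (n + 1)).filter (fun t => t % P = j) =
      (Finset.range ((n - j) / P + 1)).image (fun k => j + P * k) := by
    ext t
    simp only [Finset.mem_filter, Finset.mem_range, Finset.mem_image]
    constructor
    · rintro ⟨h1, h2⟩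
      refine ⟨t / P, ?_, ?_⟩
      · refine Nat.lt_succ_of_le ((Nat.le_div_iff_mul_le (by omega)).2 ?_)
        have := Nat.mod_add_div t P
        rw [Nat.mul_comm]; omega
      · have := Nat.mod_add_div t P
        omega
    · rintro ⟨k, h1, rfl⟩
      have h2 := (Nat.le_div_iff_mul_le (by omega)).1 (Nat.le_of_lt_succ h1)
      rw [Nat.mul_comm] at h2
      exact ⟨by omega, by rw [Nat.add_mul_mod_self_left, Nat.mod_eq_of_lt hj]⟩
  rw [this, Finset.card_image_of_injective _ (fun a b h => ?_), Finset.card_range]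
  have : P * a = P * b := by simpa using h
  exact Nat.eq_of_mul_eq_mul_left (by omega) this

/-- The sum of a periodic function over the numbers up to `n`. -/
theorem sum_range_mod (n P : ℕ) (hP : P ≤ n) (h0 : 0 < P) (g : ℕ → ℕ) :
    ∑ t ∈ Finset.range (n + 1), g (t % P) = ∑ j ∈ Finset.range P, ((n - j) / P + 1) * g j := by
  rw [← Finset.sum_fiberwise_of_maps_to (s := Finset.range (n + 1)) (t := Finset.range P)
    (g := fun t => t % P) (fun t _ => Finset.mem_range.2 (Nat.mod_lt _ h0))]
  refine Finset.sum_congr rfl fun j hj => ?_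
  rw [Finset.mem_range] at hj
  rw [← card_filter_mod n P j hj (by omega), ← smul_eq_mul, ← Finset.sum_const]
  refine Finset.sum_congr rfl fun t ht => ?_
  rw [(Finset.mem_filter.1 ht).2]

/-! ### The arrays that are computed from a description -/

namespace Table

theorem W_eq (T : Table) (k u : ℕ) :
    T.W k u = (if u < T.n then T.st u else 0) +
      ((Finset.range k).filter (fun j => T.tgt j = u)).card := by
  induction k with
  | zero => simp [W]
  | succ k ih =>
    rw [W, Finset.range_add_one, Finset.filter_insert]
    by_cases h : T.tgt k = u
    · subst h
      rw [Function.update_self, if_pos rfl, Finset.card_insert_of_notMem (by simp), ih]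
      omega
    · rw [Function.update_of_ne (Ne.symm h), if_neg h, ih]

/-- The last transition read wins, which is harmless for states with only one successor. -/
theorem S_eq (T : Table) {k u z : ℕ} (h1 : ∃ j < k, T.src j = u)
    (h2 : ∀ j < k, T.src j = u → T.tgt j = z) : T.S k u = z := by
  induction k with
  | zero => obtain ⟨j, hj, _⟩ := h1; omega
  | succ k ih =>
    rw [S]
    by_cases h : T.src k = u
    · subst h
      rw [Function.update_self, h2 k (by omega) rfl]
    · rw [Function.update_of_ne (Ne.symm h)]
      obtain ⟨j, hj, hju⟩ := h1
      refine ih ⟨j, ?_, hju⟩ fun i hi => h2 i (by omega)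
      have : j ≠ k := by rintro rfl; exact h hju
      omega

end Table

/-- The description of an automaton. -/
noncomputable def table (A : UnaryNFA) : Table where
  n := A.1
  e := (edgePairs A).length
  st u := ((stateList A).getD u (0, 0)).1
  ac u := ((stateList A).getD u (0, 0)).2
  src k := ((edgePairs A).getD k (0, 0)).1
  tgt k := ((edgePairs A).getD k (0, 0)).2

theorem getD_flat (l : List (ℕ × ℕ)) (L : List ℕ) {k : ℕ} (hk : k < l.length) :
    (flat l ++ L).getD (2 * k) 0 = (l.getD k (0, 0)).1 ∧
      (flat l ++ L).getD (2 * k + 1) 0 = (l.getD k (0, 0)).2 := by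
  induction l generalizing k with
  | nil => simp at hk
  | cons p l ih =>
    cases k with
    | zero => simp [flat]
    | succ k =>
      have := ih (k := k) (by simpa using hk)
      have e : flat (p :: l) ++ L = p.1 :: p.2 :: (flat l ++ L) := by simp [flat]
      rw [e, show 2 * (k + 1) = 2 * k + 1 + 1 by omega]
      simpa using this

theorem nodup_edgePairs (A : UnaryNFA) : (edgePairs A).Nodup := by
  refine List.Nodup.map ?_ (List.Nodup.filter _
    ((List.nodup_finRange _).product (List.nodup_finRange _)))
  rintro ⟨a, b⟩ ⟨c, d⟩ h
  simpa [Fin.ext_iff] using h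

section

variable {A : UnaryNFA}

theorem table_edge {k : ℕ} (hk : k < (table A).e) :
    ∃ u v : Fin A.1, v ∈ A.2.step u () ∧ (table A).src k = u ∧ (table A).tgt k = v := by
  have hk' : k < (edgePairs A).length := hk
  obtain ⟨u, v, h, h'⟩ := (mem_edgePairs A _).1 (List.getElem_mem hk')
  refine ⟨u, v, h, ?_, ?_⟩ <;> simp [table, List.getD_eq_getElem?_getD, hk', h']

theorem exists_table_edge {u v : Fin A.1} (h : v ∈ A.2.step u ()) :
    ∃ k < (table A).e, (table A).src k = u ∧ (table A).tgt k = v := by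
  obtain ⟨k, hk, hk'⟩ := List.mem_iff_getElem.1 ((mem_edgePairs A (u.val, v.val)).2 ⟨u, v, h, rfl⟩)
  refine ⟨k, hk, ?_, ?_⟩ <;> simp [table, List.getD_eq_getElem?_getD, hk, hk']

/-- No transition is listed twice, so that counting list entries counts transitions. -/
theorem table_edge_injective {k l : ℕ} (hk : k < (table A).e) (hl : l < (table A).e)
    (h1 : (table A).src k = (table A).src l) (h2 : (table A).tgt k = (table A).tgt l) : k = l := by
  have hk' : k < (edgePairs A).length := hk
  have hl' : l < (edgePairs A).length := hl
  simp only [table, List.getD_eq_getElem?_getD, List.getElem?_eq_getElem hk',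
    List.getElem?_eq_getElem hl', Option.getD_some] at h1 h2
  exact (nodup_edgePairs A).getElem_inj_iff.1 (Prod.ext h1 h2)

theorem table_state (u : Fin A.1) :
    ((table A).st u ≠ 0 ↔ u ∈ A.2.start) ∧ ((table A).ac u ≠ 0 ↔ u ∈ A.2.accept) := by
  obtain ⟨p, h1, h2, h3, _⟩ := getElem?_stateList A u u.isLt
  simp [table, List.getD_eq_getElem?_getD, h1, h2, h3]

theorem table_le (u : ℕ) : (table A).st u ≤ 1 ∧ (table A).ac u ≤ 1 := by
  by_cases h : u < A.1
  · obtain ⟨p, h1, _, _, h2⟩ := getElem?_stateList A u h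
    simpa [table, List.getD_eq_getElem?_getD, h1] using h2
  · have : (stateList A)[u]? = none := by simp [length_stateList]; omega
    simp [table, List.getD_eq_getElem?_getD, this]

variable {s c : ℕ} {p : Fin c → ℕ} (K : Chrobak A.2 s c p)

/-- A state has at most one predecessor on the stem and at most one on the cycles, since going
around a cycle is injective. -/
theorem StemCycles.Edge.eq {u u' v : StemCycles s c p} (h : u.Edge v) (h' : u'.Edge v)
    (hu : u.isLeft = u'.isLeft) : u = u' := by
  rcases u with u | ⟨i, j⟩ <;> rcases u' with u' | ⟨i', j'⟩ <;> simp at hu <;>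
    rcases v with v | ⟨k, l⟩ <;> simp only [StemCycles.Edge] at h h'
  · exact congrArg _ (Fin.ext (by omega))
  · exact congrArg _ (Fin.ext (by omega))
  · obtain ⟨rfl, h⟩ := h
    obtain ⟨rfl, h'⟩ := h'
    have e : (j.val + 1) % p k = (j'.val + 1) % p k := by omega
    have hj := j.isLt
    have hj' := j'.isLt
    have : j.val = j'.val := by
      rcases Nat.lt_or_ge (j.val + 1) (p k) with h1 | h1 <;>
        rcases Nat.lt_or_ge (j'.val + 1) (p k) with h2 | h2
      · rw [Nat.mod_eq_of_lt h1, Nat.mod_eq_of_lt h2] at e; omega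
      · have : j'.val + 1 = p k := by omega
        rw [Nat.mod_eq_of_lt h1, this, Nat.mod_self] at e; omega
      · have : j.val + 1 = p k := by omega
        rw [Nat.mod_eq_of_lt h2, this, Nat.mod_self] at e; omega
      · omega
    rw [Fin.ext this]

namespace Chrobak

include K in
-- A transition is determined by its target and by whether its source lies on the stem.
theorem length_edgePairs_le : (table A).e ≤ 2 * A.1 := by
  have : (Finset.range (table A).e).card ≤
      ((Finset.univ : Finset (Fin A.1 × Bool)).card) := by
    have hex : ∀ k : Finset.range (table A).e, ∃ y : Fin A.1 × Bool,
        ∃ u : StemCycles s c p, u.Edge (K.e.symm y.1) ∧ y.2 = u.isLeft ∧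
          (table A).src k = (K.e u).val ∧ (table A).tgt k = y.1.val := by
      rintro ⟨k, hk⟩
      obtain ⟨u, v, h, h1, h2⟩ := table_edge (Finset.mem_range.1 hk)
      refine ⟨(v, (K.e.symm u).isLeft), K.e.symm u, ?_, rfl, by simpa using h1, h2⟩
      rw [← K.step]
      simpa using h
    choose f hf using hex
    rw [← Finset.card_attach]
    refine Finset.card_le_card_of_injOn f (fun _ _ => Finset.mem_univ _) ?_
    intro k _ l _ hkl
    obtain ⟨u, h1, h2, h3, h4⟩ := hf k
    obtain ⟨u', h1', h2', h3', h4'⟩ := hf l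
    rw [hkl] at h1 h2 h4
    have := h1.eq h1' (h2.symm.trans h2')
    subst this
    exact Subtype.ext (table_edge_injective (Finset.mem_range.1 k.2) (Finset.mem_range.1 l.2)
      (h3.trans h3'.symm) (h4.trans h4'.symm))
  simpa [Nat.mul_comm] using this

include K in
theorem table_in : (table A).In (code A) where
  n_eq := by rw [code_eq]; rfl
  e_eq := by rw [code_eq]; rfl
  st_eq u hu := by
    rw [code_eq, descr, Nat.add_comm 2]
    exact (getD_flat _ _ (by rw [length_stateList]; exact hu)).1
  ac_eq u hu := by
    rw [code_eq, descr, show 3 + 2 * u = 2 * u + 1 + 2 by omega]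
    exact (getD_flat _ _ (by rw [length_stateList]; exact hu)).2
  src_eq k hk := by
    have h := (getD_flat (edgePairs A) [] hk).1
    have hn : (table A).n = A.1 := rfl
    rw [List.append_nil] at h
    rw [code_eq, descr, show 2 + 2 * (table A).n + 2 * k = 2 * A.1 + 2 * k + 2 by omega]
    simp only [List.getD_cons_succ]
    rw [List.getD_append_right _ _ _ _ (by rw [length_flat, length_stateList]; omega),
      length_flat, length_stateList, Nat.add_sub_cancel_left]
    exact h
  tgt_eq k hk := by
    have h := (getD_flat (edgePairs A) [] hk).2
    have hn : (table A).n = A.1 := rfl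
    rw [List.append_nil] at h
    rw [code_eq, descr, show 3 + 2 * (table A).n + 2 * k = 2 * A.1 + (2 * k + 1) + 2 by omega]
    simp only [List.getD_cons_succ]
    rw [List.getD_append_right _ _ _ _ (by rw [length_flat, length_stateList]; omega),
      length_flat, length_stateList, Nat.add_sub_cancel_left]
    exact h
  st_le u := (table_le u).1
  ac_le u := (table_le u).2
  src_lt k hk := by
    obtain ⟨u, v, _, h1, h2⟩ := table_edge hk
    rw [h1]; exact u.isLt
  tgt_lt k hk := by
    obtain ⟨u, v, _, h1, h2⟩ := table_edge hk
    rw [h2]; exact v.isLt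
  e_le := K.length_edgePairs_le

/-- The number of the state `k` steps after the distinguished state of the cycle `i`. -/
def num (i : Fin c) (k : ℕ) : ℕ := (K.e (K.cyc i k)).val

theorem num_lt (i : Fin c) (k : ℕ) : K.num i k < A.1 := (K.e (K.cyc i k)).isLt

theorem edge_cyc (i : Fin c) (k : ℕ) (v : StemCycles s c p) :
    (K.cyc i k).Edge v ↔ v = K.cyc i (k + 1) := by
  rcases v with t | ⟨i', j⟩
  · simp [StemCycles.Edge, cyc]
  · simp only [StemCycles.Edge, cyc, Sum.inr.injEq, Sigma.mk.injEq, Nat.mod_add_mod]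
    constructor
    · rintro ⟨rfl, h⟩
      exact ⟨rfl, heq_of_eq (Fin.ext h)⟩
    · rintro ⟨rfl, h⟩
      exact ⟨rfl, congrArg Fin.val (eq_of_heq h)⟩

/-- A state on a cycle has exactly one successor, which therefore is the one recorded. -/
theorem S_num (i : Fin c) (k : ℕ) : (table A).S (table A).e (K.num i k) = K.num i (k + 1) := by
  have h : ∀ v, v ∈ A.2.step (K.e (K.cyc i k)) () ↔ v = K.e (K.cyc i (k + 1)) := by
    intro v
    obtain ⟨w, rfl⟩ := K.e.surjective v
    rw [K.step, K.edge_cyc, EmbeddingLike.apply_eq_iff_eq]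
  refine Table.S_eq _ ?_ fun j hj hju => ?_
  · obtain ⟨j, hj, h1, h2⟩ := exists_table_edge ((h _).2 rfl)
    exact ⟨j, hj, h1⟩
  · obtain ⟨u, v, h0, h1, h2⟩ := table_edge hj
    have : u = K.e (K.cyc i k) := Fin.ext (h1.symm.trans hju)
    subst this
    rw [h2, (h v).1 h0]
    rfl

theorem orbit_num (i : Fin c) (k : ℕ) : (table A).orbit (K.num i 0) k = K.num i k := by
  induction k with
  | zero => rfl
  | succ k ih => rw [Table.orbit_succ, ih, K.S_num]

theorem num_eq_zero_iff (i : Fin c) (k : ℕ) : K.num i k = K.num i 0 ↔ k % p i = 0 := by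
  rw [num, num, ← Fin.ext_iff, EmbeddingLike.apply_eq_iff_eq]
  simp [cyc]

theorem num_zero_injective : Function.Injective (fun i => K.num i 0) := by
  intro i j h
  have h' : K.cyc i 0 = K.cyc j 0 := K.e.injective (Fin.ext h)
  simp only [cyc, Sum.inr.injEq, Sigma.mk.injEq] at h'
  exact h'.1

/-- A distinguished state is entered from its own cycle, and in addition either from the stem or, if
there is none, by being initial. Any other state has at most one predecessor, and the first state of
the stem, though initial, has none. -/
theorem one_lt_W_iff (f : ℕ) (hf : f < A.1) :
    1 < (table A).W (table A).e f ↔ ∃ i, f = K.num i 0 := by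
  obtain ⟨v, hv⟩ := K.e.surjective ⟨f, hf⟩
  have hvf : f = (K.e v).val := by rw [hv]
  have hst : (table A).st f ≠ 0 ↔ v.IsStart := by
    rw [hvf, (table_state _).1, K.start]
  have hn : (table A).n = A.1 := rfl
  rw [Table.W_eq, hn, if_pos hf]
  have hle := (table_le (A := A) f).1
  have hedge : ∀ k, k ∈ (Finset.range (table A).e).filter (fun j => (table A).tgt j = f) ↔
      k < (table A).e ∧ ∃ u : StemCycles s c p, u.Edge v ∧ (table A).src k = (K.e u).val ∧
        (table A).tgt k = f := by
    intro k
    rw [Finset.mem_filter, Finset.mem_range, and_congr_right_iff]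
    intro hk
    refine ⟨fun h => ?_, fun ⟨_, _, _, h⟩ => h⟩
    obtain ⟨u, w, h0, h1, h2⟩ := table_edge hk
    have : w = K.e v := Fin.ext (by rw [← h2, h, hvf])
    subst this
    refine ⟨K.e.symm u, ?_, by simpa using h1, h⟩
    rw [← K.step]; simpa using h0
  have hmem : ∀ u : StemCycles s c p, u.Edge v →
      ∃ k ∈ (Finset.range (table A).e).filter (fun j => (table A).tgt j = f),
        (table A).src k = (K.e u).val := by
    intro u hu
    obtain ⟨k, hk, h1, h2⟩ := exists_table_edge ((K.step u v).2 hu)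
    exact ⟨k, by rw [Finset.mem_filter, Finset.mem_range]; exact ⟨hk, by rw [h2, hvf]⟩, h1⟩
  constructor
  · intro h
    by_contra hno
    -- Two different predecessors would lie one on the stem and one on a cycle; then `v` would be on
    -- a cycle and entered from the stem, hence distinguished.
    have hl : ∀ u : StemCycles s c p, u.Edge v → ∀ u' : StemCycles s c p, u'.Edge v → u = u' := by
      intro u hu u' hu'
      refine hu.eq hu' ?_
      rcases u with t | ⟨i, j⟩ <;> rcases u' with t' | ⟨i', j'⟩ <;> try rfl
      · exfalso
        rcases v with w | ⟨k, l⟩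
        · exact hu'
        · refine hno ⟨k, ?_⟩
          have hl0 : l.val = 0 := hu.2
          rw [hvf, num]
          congr 2
          have : l = ⟨0 % p k, Nat.mod_lt _ (K.pos k)⟩ := Fin.ext (by simpa using hl0)
          rw [this]; rfl
      · exfalso
        rcases v with w | ⟨k, l⟩
        · exact hu
        · refine hno ⟨k, ?_⟩
          have hl0 : l.val = 0 := hu'.2
          rw [hvf, num]
          congr 2
          have : l = ⟨0 % p k, Nat.mod_lt _ (K.pos k)⟩ := Fin.ext (by simpa using hl0)
          rw [this]; rfl
    have h1 : ((Finset.range (table A).e).filter (fun j => (table A).tgt j = f)).card ≤ 1 := by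
      rw [Finset.card_le_one]
      intro a ha b hb
      obtain ⟨ha', u, h1, h2, h3⟩ := (hedge a).1 ha
      obtain ⟨hb', u', h1', h2', h3'⟩ := (hedge b).1 hb
      rw [hl u h1 u' h1'] at h2
      exact table_edge_injective ha' hb' (h2.trans h2'.symm) (h3.trans h3'.symm)
    -- With at most one predecessor, an entry above `1` means that `v` is both initial and the
    -- target of a transition. This is impossible on the stem, and on a cycle it makes `v`
    -- distinguished.
    have h2 : (table A).st f ≠ 0 := by omega
    have h3 : ((Finset.range (table A).e).filter (fun j => (table A).tgt j = f)).Nonempty := by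
      rw [← Finset.card_pos]; omega
    obtain ⟨k, hk⟩ := h3
    obtain ⟨_, u, hu, _⟩ := (hedge k).1 hk
    have hs := hst.1 h2
    rcases v with w | ⟨k, l⟩
    · rcases u with t | ⟨i, j⟩
      · have h4 : w.val = t.val + 1 := hu
        have h5 : w.val = 0 := hs
        omega
      · exact hu
    · refine hno ⟨k, ?_⟩
      have hl0 : l.val = 0 := hs.2
      rw [hvf, num]
      congr 2
      have : l = ⟨0 % p k, Nat.mod_lt _ (K.pos k)⟩ := Fin.ext (by simpa using hl0)
      rw [this]; rfl
  · rintro ⟨i, hi⟩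
    have hv' : v = K.cyc i 0 := K.e.injective (Fin.ext (by rw [← hvf, hi]; rfl))
    have hpi := K.pos i
    -- The predecessor on the cycle is the state itself if the cycle has length `1`.
    have hu : (K.cyc i (p i - 1)).Edge v := by
      rw [K.edge_cyc, hv', show p i - 1 + 1 = 0 + p i by omega, K.cyc_add]
    obtain ⟨k, hk, hk1⟩ := hmem _ hu
    rcases Nat.eq_zero_or_pos s with hs | hs
    · have : (table A).st f ≠ 0 := hst.2 (by rw [hv']; exact ⟨hs, by simp⟩)
      have := Finset.card_pos.2 ⟨k, hk⟩
      omega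
    · have hu' : StemCycles.Edge (Sum.inl ⟨s - 1, by omega⟩ : StemCycles s c p) v := by
        rw [hv']
        exact ⟨show s - 1 + 1 = s by omega, by simp⟩
      obtain ⟨l, hl, hl1⟩ := hmem _ hu'
      have : 1 < ((Finset.range (table A).e).filter (fun j => (table A).tgt j = f)).card := by
        rw [Finset.one_lt_card]
        refine ⟨k, hk, l, hl, ?_⟩
        rintro rfl
        rw [hk1, ← Fin.ext_iff, EmbeddingLike.apply_eq_iff_eq] at hl1
        simp [cyc] at hl1
      omega

/-- The length of the cycle that is entered at `f`. -/
noncomputable def period (f : ℕ) : ℕ :=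
  if h : ∃ i, f = K.num i 0 then p h.choose else 0

theorem period_num (i : Fin c) : K.period (K.num i 0) = p i := by
  have h : ∃ j, K.num i 0 = K.num j 0 := ⟨i, rfl⟩
  rw [period, dif_pos h, ← K.num_zero_injective h.choose_spec]

/-- Translates the loop over all states into a sum over the cycles; it is applied to the lengths,
the accepting visits and the rejecting states. -/
theorem sum_entries (G : ℕ → ℕ) :
    ∑ f ∈ Finset.range A.1, (if (table A).W (table A).e f ≤ 1 then 0 else G f) =
      ∑ i, G (K.num i 0) := by
  have : (Finset.range A.1).filter (fun f => ¬ (table A).W (table A).e f ≤ 1) =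
      Finset.univ.image (fun i => K.num i 0) := by
    ext f
    simp only [Finset.mem_filter, Finset.mem_range, Finset.mem_image, Finset.mem_univ, true_and,
      not_le]
    constructor
    · rintro ⟨h1, h2⟩
      obtain ⟨i, hi⟩ := (K.one_lt_W_iff f h1).1 h2
      exact ⟨i, hi.symm⟩
    · rintro ⟨i, rfl⟩
      exact ⟨K.num_lt i 0, (K.one_lt_W_iff _ (K.num_lt i 0)).2 ⟨i, rfl⟩⟩
  rw [← Finset.sum_image (fun i _ j _ h => K.num_zero_injective h), ← this, Finset.sum_filter]
  refine Finset.sum_congr rfl fun f _ => ?_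
  simp only [ite_not]

include K in
theorem sum_period_le : ∑ i, p i ≤ A.1 := by
  have := K.card_eq
  rw [Fintype.card_fin] at this
  omega

theorem table_cycles : (table A).Cycles K.period := by
  have key : ∀ f < (table A).n, 1 < (table A).W (table A).e f →
      ∃ i, f = K.num i 0 := fun f hf => (K.one_lt_W_iff f hf).1
  refine ⟨?_, ?_, ?_, ?_, ?_⟩
  · intro f hf h
    obtain ⟨i, rfl⟩ := key f hf h
    rw [K.period_num]; exact K.pos i
  · intro f hf h
    obtain ⟨i, rfl⟩ := key f hf h
    rw [K.period_num]
    exact (Finset.single_le_sum (fun _ _ => Nat.zero_le _) (Finset.mem_univ i)).trans K.sum_period_le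
  · intro f hf h
    obtain ⟨i, rfl⟩ := key f hf h
    rw [K.period_num, K.orbit_num, K.num_eq_zero_iff, Nat.mod_self]
  · intro f hf h j h0 hj
    obtain ⟨i, rfl⟩ := key f hf h
    rw [K.period_num] at hj
    rw [K.orbit_num, Ne, K.num_eq_zero_iff, Nat.mod_eq_of_lt hj]
    omega
  · refine (K.sum_entries _).trans_le ?_
    simp only [K.period_num]
    exact K.sum_period_le

theorem ac_num (i : Fin c) (k : ℕ) :
    (table A).ac (K.num i k) ≠ 0 ↔ K.e (K.cyc i k) ∈ A.2.accept :=
  (table_state _).2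

theorem cyc_mod (i : Fin c) (k : ℕ) : K.cyc i (k % p i) = K.cyc i k := by
  simp [cyc]

/-- Double counting of pairs of a time and a cycle: on a cycle, the position `j` is visited at the
times `t ≤ A.1` congruent to `j`, and `sum_range_mod` counts these. -/
theorem sum_cycleHits : ∑ f ∈ Finset.range A.1, (table A).cycleHits K.period f =
    ∑ t ∈ Finset.range (A.1 + 1), ∑ i, (table A).ac (K.num i t) := by
  have h := K.sum_entries (fun f =>
    ∑ j ∈ Finset.range (K.period f), (table A).hits f (K.period f) j)
  refine h.trans ?_
  rw [Finset.sum_comm]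
  refine Finset.sum_congr rfl fun i _ => ?_
  have hpi : p i ≤ A.1 :=
    (Finset.single_le_sum (fun _ _ => Nat.zero_le _) (Finset.mem_univ i)).trans K.sum_period_le
  have e : ∀ t, (table A).ac (K.num i t) = (table A).ac (K.num i (t % p i)) := by
    intro t
    rw [num, num, K.cyc_mod]
  refine Eq.trans ?_ (Finset.sum_congr rfl fun t _ => (e t).symm)
  rw [sum_range_mod A.1 (p i) hpi (K.pos i) (fun t => (table A).ac (K.num i t)), K.period_num]
  refine Finset.sum_congr rfl fun j _ => ?_
  rw [Table.hits, K.orbit_num]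
  have h1 := (table_le (A := A) (K.num i j)).2
  have hn : (table A).n = A.1 := rfl
  split_ifs with h0
  · simp [h0]
  · have : (table A).ac (K.num i j) = 1 := by omega
    rw [this, hn, Nat.mul_one]

/-- By unambiguity each of the `A.1 + 1` times contributes at most `1`, so the total is maximal
exactly if each of them contributes. -/
theorem sum_cycleHits_eq_iff (hM : Unambiguous A.2) :
    ∑ f ∈ Finset.range A.1, (table A).cycleHits K.period f = A.1 + 1 ↔
      ∀ t ≤ A.1, ∃ i, K.e (K.cyc i t) ∈ A.2.accept := by
  have hle : ∀ t, ∑ i, (table A).ac (K.num i t) ≤ 1 := by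
    intro t
    by_cases h : ∃ i, (table A).ac (K.num i t) ≠ 0
    · obtain ⟨i, hi⟩ := h
      rw [Finset.sum_eq_single i]
      · exact (table_le _).2
      · intro j _ hj
        by_contra h0
        exact hj (K.eq_of_unambiguous hM ((K.ac_num j t).1 h0) ((K.ac_num i t).1 hi))
      · simp
    · push Not at h
      simp [h]
  have h1 : A.1 + 1 = ∑ t ∈ Finset.range (A.1 + 1), 1 := by simp
  rw [K.sum_cycleHits]
  refine (Eq.congr_right h1).trans ?_
  rw [Finset.sum_eq_sum_iff_of_le fun t _ => hle t]
  simp only [Finset.mem_range, Nat.lt_succ_iff]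
  refine forall₂_congr fun t _ => ?_
  constructor
  · intro h
    by_contra hno
    push Not at hno
    have : ∀ i, (table A).ac (K.num i t) = 0 := fun i => by
      by_contra h0; exact hno i ((K.ac_num i t).1 h0)
    simp [this] at h
  · rintro ⟨i, hi⟩
    refine le_antisymm (hle t) ?_
    have h2 := (K.ac_num i t).2 hi
    have h3 := Finset.single_le_sum (f := fun i => (table A).ac (K.num i t))
      (fun _ _ => Nat.zero_le _) (Finset.mem_univ i)
    omega

theorem sum_cycleMisses : ∑ f ∈ Finset.range A.1, (table A).cycleMisses K.period f =
    ∑ i, ∑ j : Fin (p i), (1 - (table A).ac (K.num i j)) := by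
  have h := K.sum_entries (fun f => ∑ j ∈ Finset.range (K.period f), (table A).misses f j)
  refine h.trans (Finset.sum_congr rfl fun i _ => ?_)
  rw [K.period_num, Finset.sum_range]
  simp only [Table.misses, K.orbit_num]

/-- Every state is on the stem or on exactly one cycle, so the difference counts the rejecting
states of the stem. -/
theorem D_sub_eq_zero_iff :
    (table A).D A.1 - ∑ f ∈ Finset.range A.1, (table A).cycleMisses K.period f = 0 ↔
      ∀ t : Fin s, K.e (Sum.inl t) ∈ A.2.accept := by
  have h1 : (table A).D A.1 = ∑ t : Fin s, (1 - (table A).ac (K.e (Sum.inl t)).val) +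
      ∑ f ∈ Finset.range A.1, (table A).cycleMisses K.period f := by
    rw [Table.D, Finset.sum_range, ← K.e.sum_comp, Fintype.sum_sum_type, Fintype.sum_sigma,
      K.sum_cycleMisses]
    congr 1
    refine Finset.sum_congr rfl fun i _ => Finset.sum_congr rfl fun j _ => ?_
    have : K.cyc i j = Sum.inr ⟨i, j⟩ := by simp [cyc, Nat.mod_eq_of_lt j.isLt]
    rw [num, this]
  rw [h1, Nat.add_sub_cancel, Finset.sum_eq_zero_iff]
  simp only [Finset.mem_univ, true_implies]
  refine forall_congr' fun t => ?_
  rw [← (table_state _).2]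
  have := (table_le (A := A) (K.e (Sum.inl t)).val).2
  omega

/-- The times up to `A.1` after the entry into the cycles contain a full window, because the lengths
of the cycles add up to at most `A.1`. -/
theorem universal_iff_cycles (hM : Unambiguous A.2) : (∀ w, w ∈ A.2.accepts) ↔
    (∀ t ≤ A.1, ∃ i, K.e (K.cyc i t) ∈ A.2.accept) ∧
      ∀ t : Fin s, K.e (Sum.inl t) ∈ A.2.accept := by
  constructor
  · intro h
    refine ⟨fun t _ => ?_, fun t => ?_⟩
    · simpa using (K.mem_accepts_of_le (w := List.replicate (s + t) ()) (by simp)).1 (h _)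
    · simpa using (K.mem_accepts_of_lt (w := List.replicate t ()) (by simp)).1 (h _)
  · rintro ⟨h1, h2⟩ w
    rcases Nat.lt_or_ge w.length s with hw | hw
    · exact (K.mem_accepts_of_lt hw).2 (h2 _)
    · rw [K.mem_accepts_of_le hw]
      simpa using K.progression hM 0 1
        (fun k hk => by simpa using h1 k (hk.trans K.sum_period_le)) (w.length - s)

theorem compared_eq_zero_iff (hM : Unambiguous A.2) :
    ((table A).compared K.period).x = 0 ↔ ∀ w, w ∈ A.2.accepts := by
  rw [K.universal_iff_cycles hM, ← K.sum_cycleHits_eq_iff hM, ← K.D_sub_eq_zero_iff]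
  have hn : (table A).n = A.1 := rfl
  simp only [Table.compared, Table.processed, Table.processing, hn]
  omega

end Chrobak

end

/-! ### Universality in time `O(n log² n)` -/

/-- A bound for the numbers that the program for universality uses. -/
def ramBound (n : ℕ) : ℕ := (n + 40) ^ 4

/-- A bound for the time of the program for universality. -/
def ramTime (n : ℕ) : ℕ := (200 * (n + 1) + 1) * (40 * len (ramBound n) ^ 2)

theorem ramAnswers_universalityCmd (A : UnaryNFA) (hA : IsChrobak A.2) (hM : Unambiguous A.2) :
    ∃ b : Bool, RAMAnswers (ramProgram universalityCmd 6) (code A) b (ramTime A.1) ∧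
      (b = true ↔ ∀ w : List Unit, w ∈ A.2.accepts) := by
  obtain ⟨s, c, p, ⟨K⟩⟩ := hA.exists_chrobak
  have hn : (table A).n = A.1 := rfl
  have hV : 20 * ((table A).n + 40) ≤ ramBound A.1 := by
    rw [hn, ramBound]
    nlinarith [Nat.zero_le (A.1 ^ 2), Nat.zero_le (A.1 ^ 3), Nat.zero_le (A.1 ^ 4)]
  have hV' : 2 * ((table A).n * ((table A).n * ((table A).n + 1))) ≤ ramBound A.1 := by
    rw [hn, ramBound]
    nlinarith [Nat.zero_le (A.1 ^ 2), Nat.zero_le (A.1 ^ 3), Nat.zero_le (A.1 ^ 4)]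
  have h0 : RS.get {} = fun _ => 0 := by
    funext r
    by_cases hr : r < 16
    · interval_cases r <;> rfl
    · obtain ⟨j, rfl⟩ := Nat.exists_eq_add_of_le' (not_lt.1 hr)
      simp [RS.get]
  have h := (runs_universalityCmd K.table_in K.table_cycles hV hV'
    (fun r => by rw [h0]; exact Nat.zero_le _)).1
  rw [h0] at h
  refine ⟨_, ramProgram_answers universalityCmd_fine (by norm_num) universalityCmd_size h, ?_⟩
  rw [beq_iff_eq]
  exact K.compared_eq_zero_iff hM

theorem ramTime_isBigO :
    (fun n => (ramTime n : ℝ)) =O[atTop] (fun n : ℕ => (n : ℝ) * Real.log n ^ 2) := by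
  have h1 : (fun n : ℕ => ((200 * (n + 1) + 1 : ℕ) : ℝ)) =O[atTop] (fun n : ℕ => (n : ℝ)) := by
    refine IsBigO.of_bound 500 ?_
    filter_upwards [eventually_ge_atTop 1] with n hn
    rw [Real.norm_of_nonneg (by positivity), Real.norm_of_nonneg (by positivity)]
    have : (1 : ℝ) ≤ n := by exact_mod_cast hn
    push_cast
    linarith
  have h2 : (fun n : ℕ => ((len (ramBound n) : ℕ) : ℝ)) =O[atTop] (fun n : ℕ => Real.log n) := by
    have h1 : ∀ᶠ n : ℕ in atTop, (1 : ℝ) ≤ Real.log n :=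
      (Real.tendsto_log_atTop.comp tendsto_natCast_atTop_atTop).eventually_ge_atTop 1
    refine IsBigO.of_bound (8 / Real.log 2 + 1) ?_
    filter_upwards [h1, eventually_ge_atTop 41] with n hn hn2
    have hl2 : 0 < Real.log 2 := Real.log_pos one_lt_two
    rw [Real.norm_of_nonneg (Nat.cast_nonneg _), Real.norm_of_nonneg (by linarith)]
    -- For `n ≥ 41`, `n + 40 ≤ n ^ 2`, so the fourth power is at most the eighth power of `n`, with
    -- logarithm `8 * Real.log n`.
    have e1 : len (ramBound n) ≤ Nat.log 2 ((n ^ 2) ^ 4) + 1 :=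
      len_mono (Nat.pow_le_pow_left (by nlinarith) 4)
    have e2 : (Nat.log 2 ((n ^ 2) ^ 4) : ℝ) ≤ Real.log ((n ^ 2) ^ 4 : ℕ) / Real.log 2 := by
      rw [le_div_iff₀ hl2, ← Real.log_pow]
      apply Real.log_le_log (by positivity)
      exact_mod_cast Nat.pow_log_le_self 2 (by positivity)
    have e3 : Real.log ((n ^ 2) ^ 4 : ℕ) = 8 * Real.log n := by
      push_cast
      rw [← pow_mul, Real.log_pow]
      norm_num
    have e4 : (len (ramBound n) : ℝ) ≤ Nat.log 2 ((n ^ 2) ^ 4) + 1 := by exact_mod_cast e1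
    rw [e3] at e2
    calc (len (ramBound n) : ℝ) ≤ 8 * Real.log n / Real.log 2 + 1 := by linarith
      _ ≤ 8 * Real.log n / Real.log 2 + Real.log n := by linarith
      _ = _ := by ring
  have h3 := h1.mul ((h2.pow 2).const_mul_left 40)
  refine h3.congr_left fun n => ?_
  simp [ramTime]

theorem universality_in_time : DecidableInTime code (fun A : UnaryNFA => A.1)
    (fun A => IsChrobak A.2 ∧ Unambiguous A.2) (fun A => ∀ w : List Unit, w ∈ A.2.accepts)
    (fun n => (n : ℝ) * Real.log n ^ 2) :=
  ⟨ramProgram universalityCmd 6, ramTime, ramTime_isBigO,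
    fun A hA => ramAnswers_universalityCmd A hA.1 hA.2⟩

end

end UnaryUFA

theorem mainTheorem6 :
    -- (a) universality of a UFA in Chrobak normal form: in LOGSPACE, and in time `O(n log² n)`
    (UnaryUFA.DecidableInLogspace UnaryUFA.word
      (fun A : UnaryUFA.UnaryNFA => UnaryUFA.IsChrobak A.2 ∧ UnaryUFA.Unambiguous A.2)
      (fun A => ∀ w : List Unit, w ∈ A.2.accepts)) ∧
    (UnaryUFA.DecidableInTime UnaryUFA.code
      (fun A : UnaryUFA.UnaryNFA => A.1)
      (fun A => UnaryUFA.IsChrobak A.2 ∧ UnaryUFA.Unambiguous A.2)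
      (fun A => ∀ w : List Unit, w ∈ A.2.accepts)
      (fun n => (n : ℝ) * Real.log n ^ 2)) ∧
    -- (b) inclusion of an NFA in a UFA, both in Chrobak normal form: in LOGSPACE
    (UnaryUFA.DecidableInLogspace UnaryUFA.pairWord
      (fun A : UnaryUFA.UnaryNFA × UnaryUFA.UnaryNFA =>
        UnaryUFA.IsChrobak A.1.2 ∧ UnaryUFA.IsChrobak A.2.2 ∧ UnaryUFA.Unambiguous A.2.2)
      (fun A => ∀ w : List Unit, w ∈ A.1.2.accepts → w ∈ A.2.2.accepts)) :=
  ⟨UnaryUFA.universality_in_logspace, UnaryUFA.universality_in_time,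
    UnaryUFA.inclusion_in_logspace⟩
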